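/- **Proposition 6.1 (modulated Fourier expansion for two opposite initial phases).** Let $\kappa\neq 0$ and $\lambda\neq 0$ be fixed real numbers and $\mathbb T=\mathbb R/2\pi\mathbb Z$. Let $\varepsilon$ range over the values in $(0,1]$ with $\kappa/\varepsilon\in\mathbb Z$. Let $a^0_{1},a^0_{-1}:\mathbb T\to\mathbb C$ be smooth functions (possibly depending on $\varepsilon$) all of whose derivatives are bounded independently of $\varepsilon$. Let $u$ be the classical solution, $2\pi$-periodic in $x$, of $$ i\varepsilon\,\partial_t u+\tfrac{\varepsilon^2}{2}\,\partial_x^2u=\varepsilon\lambda|u|^2u,\qquad u(0,x)=a^0_1(x)e^{i\kappa x/\varepsilon}+a^0_{-1}(x)e^{-i\kappa x/\varepsilon}. $$ Put $\kappa_{\pm1}=\pm\kappa$, $\kappa_{\pm3}=\pm3\kappa$, $\omega_{\pm1}=\omega_{\pm3}=\tfrac12\kappa^2$, $\omega^\star_{\pm3}=\tfrac12(3\kappa)^2$ and $\delta_{\pm3}=\omega_{\pm3}-\omega^\star_{\pm3}=-4\kappa^2$. Consider the following system, $2\pi$-periodic in $x$: * $a_1$ and $a_{-1}$ solve the coupled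 advected nonlinear Schrödinger equations $$\partial_t a_1+\kappa_1\partial_xa_1-\tfrac{i\varepsilon}{2}\partial_x^2a_1=-i\lambda\Bigl((|a_1|^2+2|a_{-1}|^2)a_1+\varepsilon\lambda\,(2a_{-1}\bar a_1b_3+a_{-1}\bar b_{-3}a_{-1})\Bigr),\qquad a_1(0,\cdot)=a_1^0,$$ and the same equation with the signs of all subscripts reversed, $a_{-1}(0,\cdot)=a^0_{-1}$, where $$b_3=\frac1{\delta_3}\,a_1\bar a_{-1}a_1,\qquad b_{-3}=\frac1{\delta_{-3}}\,a_{-1}\bar a_{1}a_{-1};$$ * $b^\star_{\nu}$, for $\nu=\pm3$, solves the linear advected Schrödinger equation $$\partial_tb^\star_\nu+\kappa_\nu\partial_xb^\star_\nu-\tfrac{i\varepsilon}2\partial_x^2b_\nu^\star=-2i\lambda(|a_1|^2+|a_{-1}|^2)b^\star_\nu,\qquad b^\star_\nu(0,\cdot)=-b_\nu(0,\cdot).$$ Then for every $T>0$ there are $\varepsilon_0>0$, a constant $C$ and constants $B_0,B_1,B_2,\dots$, all independent of $\varepsilon$, such that for all these $\varepsilon$ with $\varepsilon<\varepsilon_0$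 the following holds. Classical solutions $u$ and $a_{\pm1},b^\star_{\pm3}$ of the above initial value problems exist on $[0,T]\times\mathbb T$. For any such solutions, the modulation functions $a_{\pm1}$, $b^\star_{\pm3}$, $b_{\pm3}$ are smooth on $[0,T]\times\mathbb T$, with their $n$-th order derivatives bounded there by $B_n$ for every $n\ge 0$, and $$u(t,x)=\sum_{r=\pm1}a_r(t,x)\,e^{i(\kappa_rx-\omega_rt)/\varepsilon}+\varepsilon\lambda\sum_{\nu=\pm3}\Bigl(b^\star_\nu(t,x)\,e^{i(\kappa_\nu x-\omega^\star_\nu t)/\varepsilon}+b_\nu(t,x)\,e^{i(\kappa_\nu x-\omega_\nu t)/\varepsilon}\Bigr)+e(t,x)$$ with $$\max_{0\le t\le T,\;x\in\mathbb T}|e(t,x)|\le C\varepsilon^2 .$$ -/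

import Mathlib

open Set
open scoped ContDiff ComplexConjugate

namespace TwoPhaseMFE

/-- The values of `ε ∈ (0, 1]` for which `e ^ (i κ x / ε)` is `2π`-periodic, i.e. `κ / ε ∈ ℤ`. -/
def Admissible (κ : ℝ) : Set ℝ := {ε | 0 < ε ∧ ε ≤ 1 ∧ ∃ n : ℤ, κ / ε = n}

/-- A family of smooth `2π`-periodic profiles, indexed by the admissible `ε` (it may be constant
in `ε`), each of whose derivatives is bounded independently of `ε`. -/
structure SmoothProfile (κ : ℝ) (f : ℝ → ℝ → ℂ) : Prop where
  periodic : ∀ ε ∈ Admissible κ, Function.Periodic (f ε) (2 * Real.pi)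
  smooth : ∀ ε ∈ Admissible κ, ContDiff ℝ ∞ (f ε)
  bounded : ∀ n : ℕ, ∃ B : ℝ, ∀ ε ∈ Admissible κ, ∀ x : ℝ, ‖iteratedDeriv n (f ε) x‖ ≤ B

/-- The strip `[0, T] × ℝ`; functions on `[0, T] × 𝕋` are `2π`-periodic functions on it. -/
def strip (T : ℝ) : Set (ℝ × ℝ) := Icc 0 T ×ˢ univ

/-- `∂ₜ f` (one-sided at the end points of `[0, T]`). -/
noncomputable def dt (T : ℝ) (f : ℝ → ℝ → ℂ) (t x : ℝ) : ℂ :=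
  derivWithin (fun s => f s x) (Icc 0 T) t

/-- `∂ₓ f`. -/
noncomputable def dx (f : ℝ → ℝ → ℂ) (t x : ℝ) : ℂ := deriv (f t) x

/-- `∂ₓ² f`. -/
noncomputable def dxx (f : ℝ → ℝ → ℂ) (t x : ℝ) : ℂ := iteratedDeriv 2 (f t) x

/-- The class of classical solutions: `f` is `2π`-periodic in `x`, and `f`, `∂ₜ f`, `∂ₓ f`, `∂ₓ² f`
exist and are continuous on `[0, T] × ℝ`. -/
structure IsClassical (T : ℝ) (f : ℝ → ℝ → ℂ) : Prop where
  periodic : ∀ t ∈ Icc 0 T, Function.Periodic (f t) (2 * Real.pi)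
  differentiable_time : ∀ t ∈ Icc 0 T, ∀ x : ℝ,
    DifferentiableWithinAt ℝ (fun s => f s x) (Icc 0 T) t
  contDiff_space : ∀ t ∈ Icc 0 T, ContDiff ℝ 2 (f t)
  continuousOn : ContinuousOn (fun p : ℝ × ℝ => f p.1 p.2) (strip T)
  continuousOn_dt : ContinuousOn (fun p : ℝ × ℝ => dt T f p.1 p.2) (strip T)
  continuousOn_dx : ContinuousOn (fun p : ℝ × ℝ => dx f p.1 p.2) (strip T)
  continuousOn_dxx : ContinuousOn (fun p : ℝ × ℝ => dxx f p.1 p.2) (strip T)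

/-- `f` is smooth on `[0, T] × ℝ`, with all its partial derivatives of order `n` controlled
by `B n`. -/
def SmoothWithBounds (T : ℝ) (B : ℕ → ℝ) (f : ℝ → ℝ → ℂ) : Prop :=
  ContDiffOn ℝ ∞ (fun p : ℝ × ℝ => f p.1 p.2) (strip T) ∧
    ∀ n : ℕ, ∀ p ∈ strip T,
      ‖iteratedFDerivWithin ℝ n (fun p : ℝ × ℝ => f p.1 p.2) (strip T) p‖ ≤ B n

/-- `u` is a classical solution on `[0, T] × 𝕋` of the semiclassical cubic Schrödinger equation
`i ε ∂ₜ u + (ε² / 2) ∂ₓ² u = ε lam |u|² u` with `u(0, ·) = u0`. -/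
structure SolvesNLS (ε lam T : ℝ) (u0 : ℝ → ℂ) (u : ℝ → ℝ → ℂ) : Prop where
  classical : IsClassical T u
  equation : ∀ t ∈ Icc 0 T, ∀ x : ℝ,
    Complex.I * ε * dt T u t x + (ε : ℂ) ^ 2 / 2 * dxx u t x
      = ε * lam * (‖u t x‖ : ℂ) ^ 2 * u t x
  initial : ∀ x : ℝ, u 0 x = u0 x

/-- `f` is a classical solution on `[0, T] × 𝕋` of the advected Schrödinger equation
`∂ₜ f + c ∂ₓ f - (i ε / 2) ∂ₓ² f = F` with `f(0, ·) = f0`. -/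
structure SolvesAdvected (ε c T : ℝ) (F : ℝ → ℝ → ℂ) (f0 : ℝ → ℂ) (f : ℝ → ℝ → ℂ) : Prop where
  classical : IsClassical T f
  equation : ∀ t ∈ Icc 0 T, ∀ x : ℝ,
    dt T f t x + c * dx f t x - Complex.I * ε / 2 * dxx f t x = F t x
  initial : ∀ x : ℝ, f 0 x = f0 x

/-- The plane wave `e ^ (i (k x - w t) / ε)`. -/
noncomputable def wave (ε k w t x : ℝ) : ℂ :=
  Complex.exp (Complex.I * (k * x - w * t) / ε)

/-- The frequency `k² / 2` that the free equation associates with the wave number `k`. -/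
noncomputable def freq (k : ℝ) : ℝ := k ^ 2 / 2

/-- `δ₃ = ω₃ - ω₃⋆` with `ω₃ = κ² / 2` and `ω₃⋆ = (3 κ)² / 2` (and `δ₋₃ = δ₃`). -/
noncomputable def delta (κ : ℝ) : ℝ := freq κ - freq (3 * κ)

theorem delta_eq (κ : ℝ) : delta κ = -4 * κ ^ 2 := by
  unfold delta freq; ring

/-- `b₃ = a₁ ā₋₁ a₁ / δ₃` for `(p, m) = (a₁, a₋₁)`, and `b₋₃` for `(p, m) = (a₋₁, a₁)`. -/
noncomputable def bCoeff (κ : ℝ) (p m : ℝ → ℝ → ℂ) (t x : ℝ) : ℂ :=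
  1 / (delta κ : ℂ) * (p t x * conj (m t x) * p t x)

/-- The right-hand side of the equation for `a₁` if `(p, m) = (a₁, a₋₁)`:
`-i lam ((|a₁|² + 2 |a₋₁|²) a₁ + ε lam (2 a₋₁ ā₁ b₃ + a₋₁ b̄₋₃ a₋₁))`;
the one for `a₋₁` is obtained with `(p, m) = (a₋₁, a₁)`. -/
noncomputable def aForcing (ε lam κ : ℝ) (p m : ℝ → ℝ → ℂ) (t x : ℝ) : ℂ :=
  -Complex.I * lam *
    (((‖p t x‖ : ℂ) ^ 2 + 2 * (‖m t x‖ : ℂ) ^ 2) * p t x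
      + ε * lam * (2 * m t x * conj (p t x) * bCoeff κ p m t x
          + m t x * conj (bCoeff κ m p t x) * m t x))

/-- The right-hand side `-2 i lam (|a₁|² + |a₋₁|²) b⋆` of the linear equations for `b⋆₃`, `b⋆₋₃`. -/
noncomputable def bForcing (lam : ℝ) (p m bs : ℝ → ℝ → ℂ) (t x : ℝ) : ℂ :=
  -2 * Complex.I * lam * ((‖p t x‖ : ℂ) ^ 2 + (‖m t x‖ : ℂ) ^ 2) * bs t x

/-- `(ap, am, sp, sm) = (a₁, a₋₁, b⋆₃, b⋆₋₃)` solve the modulation equations on `[0, T] × 𝕋`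
with `a₁(0, ·) = ap0` and `a₋₁(0, ·) = am0`. -/
structure SolvesModulation (ε lam κ T : ℝ) (ap0 am0 : ℝ → ℂ) (ap am sp sm : ℝ → ℝ → ℂ) :
    Prop where
  a_pos : SolvesAdvected ε κ T (aForcing ε lam κ ap am) ap0 ap
  a_neg : SolvesAdvected ε (-κ) T (aForcing ε lam κ am ap) am0 am
  b_pos : SolvesAdvected ε (3 * κ) T (bForcing lam ap am sp) (fun x => -bCoeff κ ap am 0 x) sp
  b_neg : SolvesAdvected ε (-(3 * κ)) T (bForcing lam ap am sm) (fun x => -bCoeff κ am ap 0 x) sm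

/-- The initial value `a⁰₁(x) e ^ (i κ x / ε) + a⁰₋₁(x) e ^ (-i κ x / ε)`. -/
noncomputable def initialData (ε κ : ℝ) (ap0 am0 : ℝ → ℂ) (x : ℝ) : ℂ :=
  ap0 x * Complex.exp (Complex.I * κ * x / ε) + am0 x * Complex.exp (-Complex.I * κ * x / ε)

/-- The truncated modulated Fourier expansion with `(ap, am, sp, sm) = (a₁, a₋₁, b⋆₃, b⋆₋₃)`. -/
noncomputable def uMFE (ε lam κ : ℝ) (ap am sp sm : ℝ → ℝ → ℂ) (t x : ℝ) : ℂ :=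
  (ap t x * wave ε κ (freq κ) t x + am t x * wave ε (-κ) (freq κ) t x)
    + ε * lam * (sp t x * wave ε (3 * κ) (freq (3 * κ)) t x
        + sm t x * wave ε (-(3 * κ)) (freq (3 * κ)) t x)
    + ε * lam * (bCoeff κ ap am t x * wave ε (3 * κ) (freq κ) t x
        + bCoeff κ am ap t x * wave ε (-(3 * κ)) (freq κ) t x)

end TwoPhaseMFE

/-! Everything is done in a Wiener algebra in which uniformity in `ε` is part of the norm. A family
of periodic functions is stored through its Fourier coefficients, each coefficient being an element
of `Coef E T`, a bounded family over the parameters `E` of continuous functions on `[0, T]`; the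
norm is `∑ₖ sup_{ε,t}`. This is a Banach algebra dominating the sup norm, the free flows act by
unimodular multipliers, and plane waves have norm at most one, so that high oscillation costs
nothing.

Existence of `a₁, a₋₁` on all of `[0, T]`. Without the terms of size `ε` the equations are two
transport equations with real cross-phase potentials. Each modulus is carried along its own
characteristics, hence known beforehand, and the limit system is in effect linear and globally
solvable (`exists_limit`). Its solution is rapidly decaying, so dispersion and quintic term change
the mild equation by `O(ε)`. A contraction argument around an approximate fixed point
(`exists_fixedPoint_near`), in the norm damped by `e ^ (-L t)` that makes Duhamel integrals small on
any time interval, then gives the solution for small `ε` (`exists_mild_modulation`). The functions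
`b⋆` solve linear equations.

Regularity. Tame product estimates for truncated polynomial weights, with constants independent of
the truncation, give rapid decay of the coefficients (`rapidDecay_of_mild`). Time derivatives are
read off the equations (`smooth_of_evolves`), and `contDiffOn_ev` converts this into derivative
bounds uniform in `ε`.

Error bound. Multiplying an amplitude that travels with velocity `k κ` by the wave with wave number
`k κ` and frequency `w κ² / 2` turns it into a solution of the free Schrödinger equation up to the
detuning `(w - k²) κ² / (2 ε)` (`Evolves.mul_pw`). Inserting the expansion in the equation, the
cubic terms at `(k, w) = (±3, 1)` are cancelled by the detuning of `ε lam b`; the resonant terms of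
order `ε` are those at `(±1, 1)`, absorbed by the quintic terms, and those at `(±3, 9)`, absorbed by
the potential in the equation of `b⋆` (`expansion_identity`, `forcing_eq`). What remains has size
`ε²`, or has size `ε` and satisfies `w ≠ k²`; in the latter case integration by parts in the Duhamel
integral gains another `ε` (`norm_duh_mul_pw_le`). The expansion is thus a mild solution up to
`O(ε²)`. Because `b⋆ = -b` at time zero it has the right initial value, and the same fixed point
lemma yields an exact solution at distance `O(ε²)` (`exists_nls_solution_near`).

Finally an energy estimate shows that classical solutions are unique (`eq_of_system`), so all
statements carry over from the constructed solutions to arbitrary ones. -/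

/-! ### The Wiener algebra as a Banach algebra. -/

/-- The Wiener algebra over `R`: absolutely summable sequences `ℤ → R` under convolution. -/
structure Wiener (R : Type*) [NormedCommRing R] where
  /-- the coefficients -/
  coeff : ℤ → R
  summable_norm : Summable fun k => ‖coeff k‖

namespace Wiener

section Basic

variable {R : Type*} [NormedCommRing R]

instance : CoeFun (Wiener R) fun _ => ℤ → R := ⟨coeff⟩

@[ext] theorem ext {f g : Wiener R} (h : ∀ k, f k = g k) : f = g := by
  cases f; cases g; congr; exact funext h

theorem coeff_injective : Function.Injective (coeff : Wiener R → ℤ → R) :=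
  fun _ _ h => ext (congrFun h)

instance : Zero (Wiener R) := ⟨⟨0, by simp⟩⟩

instance : Add (Wiener R) :=
  ⟨fun f g => ⟨f.coeff + g.coeff, Summable.of_nonneg_of_le (fun _ => norm_nonneg _)
    (fun _ => norm_add_le _ _) (f.summable_norm.add g.summable_norm)⟩⟩

instance : Neg (Wiener R) := ⟨fun f => ⟨-f.coeff, by simpa using f.summable_norm⟩⟩

instance : Sub (Wiener R) :=
  ⟨fun f g => ⟨f.coeff - g.coeff, Summable.of_nonneg_of_le (fun _ => norm_nonneg _)
    (fun _ => norm_sub_le _ _) (f.summable_norm.add g.summable_norm)⟩⟩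

instance : SMul ℕ (Wiener R) :=
  ⟨fun n f => ⟨n • f.coeff, Summable.of_nonneg_of_le (fun _ => norm_nonneg _)
    (fun _ => norm_nsmul_le) (f.summable_norm.mul_left (n : ℝ))⟩⟩

instance : SMul ℤ (Wiener R) :=
  ⟨fun n f => ⟨n • f.coeff, Summable.of_nonneg_of_le (fun _ => norm_nonneg _)
    (fun k => norm_zsmul_le n (f.coeff k)) (f.summable_norm.mul_left (‖n‖ : ℝ))⟩⟩

instance : AddCommGroup (Wiener R) :=
  coeff_injective.addCommGroup coeff rfl (fun _ _ => rfl) (fun _ => rfl) (fun _ _ => rfl)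
    (fun _ _ => rfl) (fun _ _ => rfl)

/-- The Wiener algebra as a sequence space. -/
def toLp : Wiener R →+ lp (fun _ : ℤ => R) 1 where
  toFun f := ⟨f.coeff, memℓp_gen (by simpa using f.summable_norm)⟩
  map_zero' := rfl
  map_add' _ _ := rfl

theorem toLp_injective : Function.Injective (toLp : Wiener R → _) := fun _ _ h =>
  coeff_injective (congrArg (fun u : lp (fun _ : ℤ => R) 1 => (u : ℤ → R)) h)

noncomputable instance : NormedAddCommGroup (Wiener R) :=
  NormedAddCommGroup.induced _ _ toLp toLp_injective

theorem norm_def (f : Wiener R) : ‖f‖ = ∑' k, ‖f k‖ := by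
  have h := lp.norm_eq_tsum_rpow (p := 1) (by simp) (toLp f)
  simp only [ENNReal.toReal_one, Real.rpow_one, div_one] at h
  exact h

/-- The map `toLp` is a surjective isometry onto `ℓ¹`, which is complete. -/
instance [CompleteSpace R] : CompleteSpace (Wiener R) := by
  have hi : Isometry (toLp : Wiener R → lp (fun _ : ℤ => R) 1) :=
    AddMonoidHomClass.isometry_of_norm toLp fun _ => rfl
  have hs : Function.Surjective (toLp : Wiener R → lp (fun _ : ℤ => R) 1) := fun u =>
    ⟨⟨u, by simpa using (lp.memℓp u).summable (by simp)⟩, rfl⟩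
  exact ((IsometryEquiv.mk (Equiv.ofBijective _ ⟨hi.injective, hs⟩)
    hi).completeSpace_iff).mpr inferInstance

@[simp] theorem mk_apply (f : ℤ → R) (hf : Summable fun k => ‖f k‖) (k : ℤ) :
    (mk f hf) k = f k := rfl
@[simp] theorem zero_apply (k : ℤ) : (0 : Wiener R) k = 0 := rfl
@[simp] theorem add_apply (f g : Wiener R) (k : ℤ) : (f + g) k = f k + g k := rfl
@[simp] theorem sub_apply (f g : Wiener R) (k : ℤ) : (f - g) k = f k - g k := rfl
@[simp] theorem neg_apply (f : Wiener R) (k : ℤ) : (-f) k = -f k := rfl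

theorem norm_apply_le (f : Wiener R) (k : ℤ) : ‖f k‖ ≤ ‖f‖ := by
  rw [norm_def]
  exact f.summable_norm.le_tsum k fun _ _ => norm_nonneg _

/-- `(m, n) ↦ (m, n - m)`, the change of variables behind convolution. -/
def shear : ℤ × ℤ ≃ ℤ × ℤ where
  toFun p := (p.1, p.2 - p.1)
  invFun p := (p.1, p.2 + p.1)
  left_inv p := by simp
  right_inv p := by simp

theorem summable_shear {u v : ℤ → ℝ} (hu : Summable u) (hv : Summable v)
    (hu0 : ∀ k, 0 ≤ u k) (hv0 : ∀ k, 0 ≤ v k) :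
    Summable fun p : ℤ × ℤ => u p.1 * v (p.2 - p.1) :=
  shear.summable_iff.mpr (hu.mul_of_nonneg hv hu0 hv0)

theorem tsum_shear {u v : ℤ → ℝ} (hu : Summable u) (hv : Summable v)
    (hu0 : ∀ k, 0 ≤ u k) (hv0 : ∀ k, 0 ≤ v k) :
    ∑' n, ∑' m, u m * v (n - m) = (∑' k, u k) * ∑' k, v k := by
  have h := summable_shear hu hv hu0 hv0
  rw [hu.tsum_mul_tsum hv (hu.mul_of_nonneg hv hu0 hv0), ← shear.tsum_eq]
  rw [← (Equiv.prodComm ℤ ℤ).tsum_eq]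
  exact ((h.prod_symm).tsum_prod' fun n => h.prod_symm.prod_factor n).symm

theorem summable_conv {u v : ℤ → ℝ} (hu : Summable u) (hv : Summable v)
    (hu0 : ∀ k, 0 ≤ u k) (hv0 : ∀ k, 0 ≤ v k) :
    Summable fun n => ∑' m, u m * v (n - m) :=
  ((summable_shear hu hv hu0 hv0).prod_symm).prod

theorem summable_conv_inner {u v : ℤ → ℝ} (hu : Summable u) (hv : Summable v)
    (hu0 : ∀ k, 0 ≤ u k) (hv0 : ∀ k, 0 ≤ v k) (n : ℤ) :
    Summable fun m => u m * v (n - m) :=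
  ((summable_shear hu hv hu0 hv0).prod_symm).prod_factor n

theorem summable_norm_conv (f g : Wiener R) (n : ℤ) :
    Summable fun m => ‖f m * g (n - m)‖ :=
  Summable.of_nonneg_of_le (fun _ => norm_nonneg _) (fun _ => norm_mul_le _ _)
    (summable_conv_inner f.summable_norm g.summable_norm (fun _ => norm_nonneg _)
      (fun _ => norm_nonneg _) n)

theorem norm_conv_le (f g : Wiener R) (n : ℤ) :
    ‖∑' m, f m * g (n - m)‖ ≤ ∑' m, ‖f m‖ * ‖g (n - m)‖ := by
  refine (norm_tsum_le_tsum_norm (summable_norm_conv f g n)).trans ?_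
  exact (summable_norm_conv f g n).tsum_le_tsum (fun _ => norm_mul_le _ _)
    (summable_conv_inner f.summable_norm g.summable_norm (fun _ => norm_nonneg _)
      (fun _ => norm_nonneg _) n)

theorem summable_norm_tsum (f g : Wiener R) : Summable fun n => ∑' m, ‖f m‖ * ‖g (n - m)‖ :=
  summable_conv (u := fun k => ‖f k‖) (v := fun k => ‖g k‖) f.summable_norm g.summable_norm
    (fun _ => norm_nonneg _) (fun _ => norm_nonneg _)

theorem summable_norm_mul (f g : Wiener R) : Summable fun n => ‖∑' m, f m * g (n - m)‖ :=
  Summable.of_nonneg_of_le (fun _ => norm_nonneg _) (norm_conv_le f g) (summable_norm_tsum f g)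

noncomputable instance : Mul (Wiener R) where
  mul f g := ⟨fun n => ∑' m, f m * g (n - m), summable_norm_mul f g⟩

theorem mul_apply (f g : Wiener R) (n : ℤ) : (f * g) n = ∑' m, f m * g (n - m) := rfl

/-- The sequence supported at `n` with value `r`. -/
noncomputable def single (n : ℤ) (r : R) : Wiener R :=
  mk (Pi.single n r) (summable_of_hasFiniteSupport ((Set.finite_singleton n).subset (by
    intro k hk
    by_contra h
    exact hk (by simp [Pi.single_eq_of_ne h]))))

theorem single_apply (n : ℤ) (r : R) (k : ℤ) : single n r k = if k = n then r else 0 := by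
  simp [single, Pi.single_apply]

noncomputable instance : One (Wiener R) := ⟨single 0 1⟩

theorem one_def : (1 : Wiener R) = single 0 1 := rfl

theorem single_mul_apply (n : ℤ) (r : R) (f : Wiener R) (k : ℤ) :
    (single n r * f) k = r * f (k - n) := by
  rw [mul_apply, tsum_eq_single n]
  · simp [single_apply]
  · intro m hm; simp [single_apply, hm]

theorem conv_comm (f g : Wiener R) : f * g = g * f := by
  ext n
  rw [mul_apply, mul_apply, ← (Equiv.subLeft n).tsum_eq]
  simp [mul_comm]

theorem norm_conv (f g : Wiener R) : ‖f * g‖ ≤ ‖f‖ * ‖g‖ := by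
  rw [norm_def, norm_def f, norm_def g, ← tsum_shear f.summable_norm g.summable_norm
    (fun _ => norm_nonneg _) (fun _ => norm_nonneg _)]
  exact (summable_norm_mul f g).tsum_le_tsum (norm_conv_le f g) (summable_norm_tsum f g)

theorem one_conv (f : Wiener R) : 1 * f = f := by
  ext n; rw [one_def, single_mul_apply]; simp

variable [CompleteSpace R]

theorem summable_mul_apply (f g : Wiener R) (n : ℤ) : Summable fun m => f m * g (n - m) :=
  (summable_norm_conv f g n).of_norm

theorem conv_assoc (f g h : Wiener R) : f * g * h = f * (g * h) := by
  ext n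
  -- Bounding the third factor by its norm leaves a sheared product of two summable families; this
  -- licenses the exchange of the two sums below.
  have hs : Summable fun p : ℤ × ℤ => f p.1 * g (p.2 - p.1) * h (n - p.2) := by
    refine Summable.of_norm_bounded (g := fun p : ℤ × ℤ => ‖f p.1‖ * ‖g (p.2 - p.1)‖ * ‖h‖)
      ((summable_shear f.summable_norm g.summable_norm (fun _ => norm_nonneg _)
        (fun _ => norm_nonneg _)).mul_right _) fun p => ?_
    refine (norm_mul_le _ _).trans ?_
    gcongr
    · exact norm_mul_le _ _
    · exact norm_apply_le _ _
  calc (f * g * h) n = ∑' m, ∑' l, f l * g (m - l) * h (n - m) := by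
        rw [mul_apply]
        congr 1; ext m
        rw [mul_apply, (summable_mul_apply f g m).tsum_mul_right]
    _ = ∑' l, ∑' m, f l * g (m - l) * h (n - m) :=
        (Summable.tsum_comm (f := fun l m => f l * g (m - l) * h (n - m)) hs)
    _ = (f * (g * h)) n := by
        rw [mul_apply]
        congr 1; ext l
        rw [mul_apply, ← (summable_mul_apply g h _).tsum_mul_left,
          ← (Equiv.subRight l).tsum_eq fun j => f l * (g j * h (n - l - j))]
        simp [mul_assoc]

theorem conv_add (f g h : Wiener R) : f * (g + h) = f * g + f * h := by
  ext n
  simp only [mul_apply, add_apply, mul_add]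
  exact (summable_mul_apply f g n).tsum_add (summable_mul_apply f h n)

noncomputable instance : NormedCommRing (Wiener R) :=
  { (inferInstance : NormedAddCommGroup (Wiener R)),
    (inferInstance : Mul (Wiener R)), (inferInstance : One (Wiener R)) with
    mul_assoc := conv_assoc
    mul_comm := conv_comm
    one_mul := one_conv
    mul_one := fun f => by rw [conv_comm, one_conv]
    left_distrib := conv_add
    right_distrib := fun f g h => by rw [conv_comm, conv_add, conv_comm h f, conv_comm h g]
    zero_mul := fun f => by ext n; simp [mul_apply]
    mul_zero := fun f => by ext n; simp [mul_apply]
    norm_mul_le := norm_conv }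

end Basic

end Wiener

/-! ### Conjugation, constants and ring homomorphisms of the Wiener algebra. -/

namespace Wiener

section Maps

variable {R S : Type*} [NormedCommRing R] [NormedCommRing S]

theorem norm_single (n : ℤ) (r : R) : ‖single n r‖ = ‖r‖ := by
  rw [norm_def, tsum_eq_single n]
  · simp [single_apply]
  · intro m hm; simp [single_apply, hm]

/-- The additive map acting coefficientwise by uniformly bounded additive maps. -/
noncomputable def mapCoeff (φ : ℤ → R →+ S) (C : ℝ) (h : ∀ k r, ‖φ k r‖ ≤ C * ‖r‖) :
    Wiener R →+ Wiener S where
  toFun f := ⟨fun k => φ k (f k), Summable.of_nonneg_of_le (fun _ => norm_nonneg _)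
    (fun k => h k (f k)) (f.summable_norm.mul_left C)⟩
  map_zero' := by ext k; simp
  map_add' f g := by ext k; simp

@[simp] theorem mapCoeff_apply (φ : ℤ → R →+ S) (C : ℝ) (h : ∀ k r, ‖φ k r‖ ≤ C * ‖r‖)
    (f : Wiener R) (k : ℤ) : mapCoeff φ C h f k = φ k (f k) := rfl

theorem norm_le_of_forall {f : Wiener R} {g : Wiener S} {C : ℝ}
    (h : ∀ k, ‖g k‖ ≤ C * ‖f k‖) : ‖g‖ ≤ C * ‖f‖ := by
  rw [norm_def, norm_def, ← tsum_mul_left]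
  exact g.summable_norm.tsum_le_tsum h (f.summable_norm.mul_left C)

theorem norm_mapCoeff_le (φ : ℤ → R →+ S) (C : ℝ) (h : ∀ k r, ‖φ k r‖ ≤ C * ‖r‖)
    (f : Wiener R) : ‖mapCoeff φ C h f‖ ≤ C * ‖f‖ :=
  norm_le_of_forall fun k => h k (f k)

section StarSection

variable [StarRing R] [NormedStarGroup R]

/-- The conjugate of `∑ fₖ e ^ (i k x)` has coefficients `conj f₋ₖ`, hence the reflection of the
index. -/
noncomputable instance : Star (Wiener R) where
  star f := ⟨fun k => star (f (-k)), by
    simpa [Function.comp_def] using (Equiv.neg ℤ).summable_iff.mpr f.summable_norm⟩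

@[simp] theorem star_apply (f : Wiener R) (k : ℤ) : (star f) k = star (f (-k)) := rfl

theorem norm_star_eq (f : Wiener R) : ‖star f‖ = ‖f‖ := by
  rw [norm_def, norm_def, ← (Equiv.neg ℤ).tsum_eq]
  simp

theorem star_single (n : ℤ) (r : R) : star (single n r) = single (-n) (star r) := by
  ext k
  by_cases h : k = -n
  · simp [single_apply, h]
  · have : -k ≠ n := fun h' => h (by omega)
    simp [single_apply, h, this]

variable [CompleteSpace R]

noncomputable instance : StarRing (Wiener R) where
  star_involutive f := by ext k; simp
  star_add f g := by ext k; simp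
  star_mul f g := by
    rw [mul_comm]
    ext n
    rw [star_apply, mul_apply, mul_apply, tsum_star, ← (Equiv.neg ℤ).tsum_eq]
    congr 1; ext m
    simp only [Equiv.neg_apply, star_apply, star_mul']
    congr 3
    · ring_nf

end StarSection

theorem single_mul_single (m n : ℤ) (r s : R) :
    single m r * single n s = single (m + n) (r * s) := by
  ext k
  rw [single_mul_apply, single_apply, single_apply]
  simp only [sub_eq_iff_eq_add, add_comm m n, mul_ite, mul_zero]

theorem norm_mulLeft_le {u : R} (hu : ‖u‖ ≤ 1) (r : R) : ‖AddMonoidHom.mulLeft u r‖ ≤ 1 * ‖r‖ :=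
  (norm_mul_le u r).trans (mul_le_mul_of_nonneg_right hu (norm_nonneg r))

variable [CompleteSpace R]

/-- The elements of `R`, as sequences supported at `0`. -/
noncomputable def const : R →+* Wiener R where
  toFun r := single 0 r
  map_one' := rfl
  map_zero' := by ext k; simp [single_apply]
  map_add' r s := by ext k; simp only [single_apply, add_apply]; split_ifs <;> simp
  map_mul' r s := by rw [single_mul_single]; simp

theorem const_def (r : R) : const r = single 0 r := rfl

@[simp] theorem const_mul_apply (r : R) (f : Wiener R) (k : ℤ) :
    (const r * f) k = r * f k := by
  rw [const_def, single_mul_apply]; simp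

theorem norm_const (r : R) : ‖const r‖ = ‖r‖ := norm_single 0 r

theorem star_const [StarRing R] [NormedStarGroup R] (r : R) :
    star (const r) = const (star r) := by
  rw [const_def, star_single]; simp [const_def]

/-- The ring homomorphism induced by a contractive homomorphism of the coefficients. -/
noncomputable def mapRing [CompleteSpace S] (φ : R →+* S) (h : ∀ r, ‖φ r‖ ≤ 1 * ‖r‖) :
    Wiener R →+* Wiener S where
  toFun := mapCoeff (fun _ => φ.toAddMonoidHom) 1 fun _ => h
  map_zero' := map_zero _
  map_add' := map_add _
  map_one' := by
    ext k
    rw [one_def, one_def, mapCoeff_apply]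
    simp only [single_apply]; split_ifs <;> simp
  map_mul' f g := by
    ext n
    rw [mapCoeff_apply, mul_apply, mul_apply]
    have := (summable_mul_apply f g n).map_tsum φ.toAddMonoidHom
      (AddMonoidHomClass.continuous_of_bound φ.toAddMonoidHom 1 h)
    rw [this]
    simp

/-- Characters `k ↦ u k` of `ℤ` with values in the unit ball of `R` act by ring homomorphisms. -/
noncomputable def twist (u : ℤ → R) (hu : ∀ k, ‖u k‖ ≤ 1) (h0 : u 0 = 1)
    (hadd : ∀ j k, u (j + k) = u j * u k) : Wiener R →+* Wiener R where
  toFun := mapCoeff (fun k => AddMonoidHom.mulLeft (u k)) 1 fun k =>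
    norm_mulLeft_le (hu k)
  map_zero' := map_zero _
  map_add' := map_add _
  map_one' := by
    ext k
    rw [one_def, mapCoeff_apply]
    simp only [single_apply, AddMonoidHom.coe_mulLeft]
    split_ifs with h
    · simp [h, h0]
    · simp
  map_mul' f g := by
    ext n
    rw [mapCoeff_apply, mul_apply, mul_apply]
    simp only [AddMonoidHom.coe_mulLeft, mapCoeff_apply]
    rw [← (summable_mul_apply f g n).tsum_mul_left]
    congr 1; ext m
    rw [← add_sub_cancel m n, hadd]
    simp only [add_sub_cancel]
    ring

end Maps

/-! ### Truncated weights, tame estimates and rapid decay. -/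

section Weights

/-- The truncated polynomial weight `min (1 + |k|) (N + 1) ^ m`. -/
noncomputable def weight (m N : ℕ) (k : ℤ) : ℝ := (min (1 + |(k : ℝ)|) (N + 1)) ^ m

theorem one_le_min_weight (N : ℕ) (k : ℤ) : (1 : ℝ) ≤ min (1 + |(k : ℝ)|) (N + 1) := by
  refine le_min ?_ ?_
  · linarith [abs_nonneg (k : ℝ)]
  · linarith [(Nat.cast_nonneg N : (0 : ℝ) ≤ N)]

theorem weight_nonneg (m N : ℕ) (k : ℤ) : 0 ≤ weight m N k :=
  pow_nonneg (zero_le_one.trans (one_le_min_weight N k)) m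

theorem weight_le (m N : ℕ) (k : ℤ) : weight m N k ≤ (1 + |(k : ℝ)|) ^ m :=
  pow_le_pow_left₀ (zero_le_one.trans (one_le_min_weight N k)) (min_le_left _ _) m

theorem weight_le_const (m N : ℕ) (k : ℤ) : weight m N k ≤ ((N : ℝ) + 1) ^ m :=
  pow_le_pow_left₀ (zero_le_one.trans (one_le_min_weight N k)) (min_le_right _ _) m

theorem weight_zero (m N : ℕ) : weight m N 0 = 1 := by simp [weight]

theorem weight_neg (m N : ℕ) (k : ℤ) : weight m N (-k) = weight m N k := by simp [weight]

theorem weight_eq {m N : ℕ} {k : ℤ} (h : |k| ≤ N) : weight m N k = (1 + |(k : ℝ)|) ^ m := by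
  rw [weight, min_eq_left]
  have : |(k : ℝ)| ≤ N := by exact_mod_cast h
  linarith

/-- Truncation preserves subadditivity of the base of the power, so the constant depends on `m`
only. Independence of `N` is what allows the truncation to be removed at the end. -/
theorem weight_add_le (m N : ℕ) (j k : ℤ) :
    weight m N (j + k) ≤ 2 ^ m * (weight m N j + weight m N k) := by
  have hj := one_le_min_weight N j
  have hk := one_le_min_weight N k
  have h1 : min (1 + |((j + k : ℤ) : ℝ)|) ((N : ℝ) + 1)
      ≤ min (1 + |(j : ℝ)|) (N + 1) + min (1 + |(k : ℝ)|) (N + 1) := by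
    push_cast
    have := abs_add_le (j : ℝ) k
    rcases min_cases (1 + |(j : ℝ)|) ((N : ℝ) + 1) with ⟨h, -⟩ | ⟨h, -⟩ <;>
    rcases min_cases (1 + |(k : ℝ)|) ((N : ℝ) + 1) with ⟨h', -⟩ | ⟨h', -⟩ <;>
    rcases min_cases (1 + |(j : ℝ) + k|) ((N : ℝ) + 1) with ⟨h'', h3⟩ | ⟨h'', h3⟩ <;>
    rw [h, h', h''] <;> linarith
  unfold weight
  have h0 := zero_le_one.trans (one_le_min_weight N (j + k))
  set a := min (1 + |(j : ℝ)|) ((N : ℝ) + 1)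
  set b := min (1 + |(k : ℝ)|) ((N : ℝ) + 1)
  have ha : 0 ≤ a := by linarith
  have hb : 0 ≤ b := by linarith
  have h2 : (max a b) ^ m ≤ a ^ m + b ^ m := by
    rcases max_cases a b with ⟨h, -⟩ | ⟨h, -⟩ <;> rw [h]
    · linarith [pow_nonneg hb m]
    · linarith [pow_nonneg ha m]
  calc _ ≤ (a + b) ^ m := pow_le_pow_left₀ h0 h1 m
    _ ≤ (2 * max a b) ^ m := pow_le_pow_left₀ (by linarith)
        (by linarith [le_max_left a b, le_max_right a b]) m
    _ = 2 ^ m * max a b ^ m := mul_pow _ _ _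
    _ ≤ _ := by gcongr

variable {R S : Type*} [NormedCommRing R] [NormedCommRing S]

/-- The norm weighted by `weight m N`. -/
noncomputable def wnorm (m N : ℕ) (f : Wiener R) : ℝ := ∑' k, weight m N k * ‖f k‖

theorem summable_wnorm (m N : ℕ) (f : Wiener R) : Summable fun k => weight m N k * ‖f k‖ :=
  Summable.of_nonneg_of_le (fun _ => mul_nonneg (weight_nonneg _ _ _) (norm_nonneg _))
    (fun k => mul_le_mul_of_nonneg_right (weight_le_const m N k) (norm_nonneg _))
    (f.summable_norm.mul_left _)

theorem wnorm_nonneg (m N : ℕ) (f : Wiener R) : 0 ≤ wnorm m N f :=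
  tsum_nonneg fun _ => mul_nonneg (weight_nonneg _ _ _) (norm_nonneg _)

theorem wnorm_le_of_forall {m N : ℕ} {f : Wiener R} {g : Wiener S} {C : ℝ}
    (h : ∀ k, ‖g k‖ ≤ C * ‖f k‖) : wnorm m N g ≤ C * wnorm m N f := by
  rw [wnorm, wnorm, ← tsum_mul_left]
  refine (summable_wnorm m N g).tsum_le_tsum (fun k => ?_) ((summable_wnorm m N f).mul_left C)
  calc _ ≤ weight m N k * (C * ‖f k‖) := by gcongr; exacts [weight_nonneg _ _ _, h k]
    _ = _ := by ring

theorem wnorm_add_le (m N : ℕ) (f g : Wiener R) :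
    wnorm m N (f + g) ≤ wnorm m N f + wnorm m N g := by
  rw [wnorm, wnorm, wnorm, ← (summable_wnorm m N f).tsum_add (summable_wnorm m N g)]
  refine (summable_wnorm m N _).tsum_le_tsum (fun k => ?_)
    ((summable_wnorm m N f).add (summable_wnorm m N g))
  rw [← mul_add]
  gcongr
  · exact weight_nonneg _ _ _
  · exact norm_add_le _ _

theorem wnorm_star [StarRing R] [NormedStarGroup R] (m N : ℕ) (f : Wiener R) :
    wnorm m N (star f) = wnorm m N f := by
  rw [wnorm, wnorm, ← (Equiv.neg ℤ).tsum_eq]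
  simp [weight_neg]

theorem wnorm_const [CompleteSpace R] (m N : ℕ) (r : R) : wnorm m N (const r) = ‖r‖ := by
  rw [wnorm, tsum_eq_single 0]
  · simp [weight_zero, const_def, single_apply]
  · intro k hk; simp [const_def, single_apply, hk]

/-- A tame estimate: the weight at `n` is shared between the indices `j` and `n - j`, so only one
factor at a time carries the weighted norm and the other the plain norm. Once plain norms are
bounded, polynomial expressions therefore grow at most linearly in the weighted norm. The factor `d`
can be attached to either term; it will be the damping factor in time. -/
theorem wnorm_const_mul_le [CompleteSpace R] (m N : ℕ) (d : R) (f g : Wiener R) :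
    wnorm m N (const d * (f * g))
      ≤ 2 ^ m * (wnorm m N (const d * f) * ‖g‖ + ‖f‖ * wnorm m N (const d * g)) := by
  have h0 : ∀ h : Wiener R, ∀ k, 0 ≤ weight m N k * ‖h k‖ := fun _ _ =>
    mul_nonneg (weight_nonneg _ _ _) (norm_nonneg _)
  have n0 : ∀ h : Wiener R, ∀ k, 0 ≤ ‖h k‖ := fun _ _ => norm_nonneg _
  have sf := summable_wnorm m N (const d * f)
  have sg := summable_wnorm m N (const d * g)
  have s1 := summable_conv_inner sf g.summable_norm (h0 _) (n0 g)
  have s2 := summable_conv_inner f.summable_norm sg (n0 f) (h0 _)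
  have t1 := summable_conv sf g.summable_norm (h0 _) (n0 g)
  have t2 := summable_conv f.summable_norm sg (n0 f) (h0 _)
  rw [wnorm, wnorm, wnorm, norm_def, norm_def, ← tsum_shear sf g.summable_norm (h0 _) (n0 g),
    ← tsum_shear f.summable_norm sg (n0 f) (h0 _), ← t1.tsum_add t2, ← tsum_mul_left]
  refine (summable_wnorm m N _).tsum_le_tsum (fun n => ?_) ((t1.add t2).mul_left _)
  rw [← (s1 n).tsum_add (s2 n), ← tsum_mul_left, const_mul_apply, mul_apply,
    ← (summable_mul_apply f g n).tsum_mul_left]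
  have s3 : ∀ j, ‖d * (f j * g (n - j))‖ ≤ ‖d‖ * ‖f j * g (n - j)‖ := fun j => norm_mul_le _ _
  have s4 : Summable fun j => ‖d * (f j * g (n - j))‖ := Summable.of_nonneg_of_le
    (fun _ => norm_nonneg _) s3 ((summable_norm_conv f g n).mul_left _)
  calc weight m N n * ‖∑' j, d * (f j * g (n - j))‖
      ≤ weight m N n * ∑' j, ‖d * (f j * g (n - j))‖ := by
        gcongr
        · exact weight_nonneg _ _ _
        · exact norm_tsum_le_tsum_norm s4
    _ = ∑' j, weight m N n * ‖d * (f j * g (n - j))‖ := by rw [tsum_mul_left]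
    _ ≤ _ := by
        refine (s4.mul_left _).tsum_le_tsum (fun j => ?_) (((s1 n).add (s2 n)).mul_left _)
        have h := weight_add_le m N j (n - j)
        rw [add_sub_cancel] at h
        rw [const_mul_apply, const_mul_apply]
        have e1 : ‖d * (f j * g (n - j))‖ ≤ ‖d * f j‖ * ‖g (n - j)‖ := by
          rw [← mul_assoc]; exact norm_mul_le _ _
        have e2 : ‖d * (f j * g (n - j))‖ ≤ ‖f j‖ * ‖d * g (n - j)‖ := by
          rw [mul_left_comm]; exact norm_mul_le _ _
        calc _ ≤ 2 ^ m * (weight m N j + weight m N (n - j)) * ‖d * (f j * g (n - j))‖ := by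
              gcongr
          _ = 2 ^ m * (weight m N j * ‖d * (f j * g (n - j))‖
              + weight m N (n - j) * ‖d * (f j * g (n - j))‖) := by ring
          _ ≤ 2 ^ m * (weight m N j * (‖d * f j‖ * ‖g (n - j)‖)
              + weight m N (n - j) * (‖f j‖ * ‖d * g (n - j)‖)) := by
              have := weight_nonneg m N j
              have := weight_nonneg m N (n - j)
              gcongr
          _ = _ := by ring

/-- All polynomially weighted norms are finite. -/
def RapidDecay (f : Wiener R) : Prop :=
  ∀ m : ℕ, Summable fun k : ℤ => (1 + |(k : ℝ)|) ^ m * ‖f k‖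

/-- On a finite set of indices the truncation is invisible once `N` exceeds them all; `N` is taken
as the sum of their absolute values. A bound uniform in `N` thus bounds all finite partial sums. -/
theorem RapidDecay.of_wnorm_le {f : Wiener R} (h : ∀ m, ∃ C, ∀ N, wnorm m N f ≤ C) :
    RapidDecay f := by
  intro m
  obtain ⟨C, hC⟩ := h m
  refine summable_of_sum_le (c := C) (fun k => by positivity) fun s => ?_
  have hN : ∀ k ∈ s, |k| ≤ ((∑ k ∈ s, k.natAbs : ℕ) : ℤ) := fun k hk => by
    rw [Int.abs_eq_natAbs]
    exact_mod_cast Finset.single_le_sum (f := Int.natAbs) (fun _ _ => Nat.zero_le _) hk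
  calc _ = ∑ k ∈ s, weight m (∑ k ∈ s, k.natAbs) k * ‖f k‖ :=
        Finset.sum_congr rfl fun k hk => by rw [weight_eq (hN k hk)]
    _ ≤ wnorm m (∑ k ∈ s, k.natAbs) f := (summable_wnorm m _ f).sum_le_tsum s
        fun k _ => mul_nonneg (weight_nonneg _ _ _) (norm_nonneg _)
    _ ≤ C := hC _

theorem RapidDecay.wnorm_le {f : Wiener R} (hf : RapidDecay f) (m N : ℕ) :
    wnorm m N f ≤ ∑' k : ℤ, (1 + |(k : ℝ)|) ^ m * ‖f k‖ :=
  (summable_wnorm m N f).tsum_le_tsum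
    (fun k => mul_le_mul_of_nonneg_right (weight_le m N k) (norm_nonneg _)) (hf m)

theorem RapidDecay.of_le {f : Wiener R} (hf : RapidDecay f) {g : Wiener S} {C : ℝ} {p : ℕ}
    (h : ∀ k, ‖g k‖ ≤ C * (1 + |(k : ℝ)|) ^ p * ‖f k‖) : RapidDecay g := fun m => by
  refine Summable.of_nonneg_of_le (fun k => by positivity) (fun k => ?_)
    ((hf (m + p)).mul_left C)
  calc _ ≤ (1 + |(k : ℝ)|) ^ m * (C * (1 + |(k : ℝ)|) ^ p * ‖f k‖) := by gcongr; exact h k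
    _ = _ := by ring

theorem RapidDecay.add {f g : Wiener R} (hf : RapidDecay f) (hg : RapidDecay g) :
    RapidDecay (f + g) := fun m => by
  refine Summable.of_nonneg_of_le (fun k => by positivity) (fun k => ?_) ((hf m).add (hg m))
  rw [← mul_add]
  gcongr
  exact norm_add_le _ _

theorem RapidDecay.star [StarRing R] [NormedStarGroup R] {f : Wiener R} (hf : RapidDecay f) :
    RapidDecay (star f) := fun m => by
  simpa [Function.comp_def] using (Equiv.neg ℤ).summable_iff.mpr (hf m)

theorem RapidDecay.single (n : ℤ) (r : R) : RapidDecay (single n r) := fun m => by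
  refine summable_of_hasFiniteSupport ((Set.finite_singleton n).subset fun k hk => ?_)
  by_contra h
  exact hk (by simp [single_apply, show k ≠ n from h])

theorem RapidDecay.mul [CompleteSpace R] {f g : Wiener R} (hf : RapidDecay f)
    (hg : RapidDecay g) : RapidDecay (f * g) := fun m => by
  have p0 : ∀ h : Wiener R, ∀ k : ℤ, 0 ≤ (1 + |(k : ℝ)|) ^ m * ‖h k‖ := fun h k => by positivity
  refine Summable.of_nonneg_of_le (fun k => by positivity) (fun n => ?_)
    (summable_conv (hf m) (hg m) (p0 f) (p0 g))
  calc _ ≤ (1 + |(n : ℝ)|) ^ m * ∑' j, ‖f j‖ * ‖g (n - j)‖ := by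
        gcongr; exact norm_conv_le f g n
    _ = ∑' j, (1 + |(n : ℝ)|) ^ m * (‖f j‖ * ‖g (n - j)‖) := by rw [tsum_mul_left]
    _ ≤ _ := by
        refine ((summable_conv_inner f.summable_norm g.summable_norm (fun _ => norm_nonneg _)
          (fun _ => norm_nonneg _) n).mul_left _).tsum_le_tsum (fun j => ?_)
          (summable_conv_inner (hf m) (hg m) (p0 f) (p0 g) n)
        -- The untruncated weight is submultiplicative, so it can be distributed over both factors.
        have h : (1 + |(n : ℝ)|) ≤ (1 + |(j : ℝ)|) * (1 + |((n - j : ℤ) : ℝ)|) := by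
          push_cast
          have := abs_add_le (j : ℝ) (n - j)
          rw [add_sub_cancel] at this
          nlinarith [mul_nonneg (abs_nonneg (j : ℝ)) (abs_nonneg ((n : ℝ) - j))]
        calc _ ≤ ((1 + |(j : ℝ)|) * (1 + |((n - j : ℤ) : ℝ)|)) ^ m * (‖f j‖ * ‖g (n - j)‖) := by
              gcongr
          _ = _ := by rw [mul_pow]; ring

end Weights

end Wiener

/-! ### The coefficient ring: time dependence, primitives and Duhamel integrals. -/

/-- Families of continuous functions on `[0, T]`, bounded uniformly in the parameter. -/
def Coef (E : Type*) [TopologicalSpace E] (T : ℝ) : Type _ :=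
  BoundedContinuousFunction E C(Icc (0 : ℝ) T, ℂ)

namespace Coef

section Instances

variable (E : Type*) [TopologicalSpace E] (T : ℝ)

noncomputable instance : NormedCommRing (Coef E T) :=
  inferInstanceAs (NormedCommRing (BoundedContinuousFunction E C(Icc (0 : ℝ) T, ℂ)))

noncomputable instance : StarRing (Coef E T) :=
  inferInstanceAs (StarRing (BoundedContinuousFunction E C(Icc (0 : ℝ) T, ℂ)))

instance : NormedStarGroup (Coef E T) :=
  inferInstanceAs (NormedStarGroup (BoundedContinuousFunction E C(Icc (0 : ℝ) T, ℂ)))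

instance : CompleteSpace (Coef E T) :=
  inferInstanceAs (CompleteSpace (BoundedContinuousFunction E C(Icc (0 : ℝ) T, ℂ)))

end Instances

variable {E : Type*} [TopologicalSpace E] {T : ℝ} [hT : Fact (0 < T)]

/-- The underlying family of functions on the interval. -/
def toBounded (c : Coef E T) : BoundedContinuousFunction E C(Icc (0 : ℝ) T, ℂ) := c

/-- The value at the parameter `e` and the time `t` (projected to `[0, T]`). -/
noncomputable def val (c : Coef E T) (e : E) (t : ℝ) : ℂ :=
  c.toBounded e (projIcc 0 T hT.out.le t)

theorem continuous_val (c : Coef E T) (e : E) : Continuous (c.val e) :=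
  (c.toBounded e).continuous.comp continuous_projIcc

theorem norm_val_le (c : Coef E T) (e : E) (t : ℝ) : ‖c.val e t‖ ≤ ‖c‖ :=
  ((c.toBounded e).norm_coe_le_norm _).trans (c.toBounded.norm_coe_le_norm e)

theorem norm_le {c : Coef E T} {C : ℝ} (hC : 0 ≤ C)
    (h : ∀ e, ∀ t ∈ Icc 0 T, ‖c.val e t‖ ≤ C) : ‖c‖ ≤ C := by
  change ‖c.toBounded‖ ≤ C
  rw [BoundedContinuousFunction.norm_le hC]
  intro e
  rw [ContinuousMap.norm_le _ hC]
  intro t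
  simpa [val, projIcc_val] using h e t t.2

theorem ext_val {c d : Coef E T} (h : ∀ e, ∀ t ∈ Icc 0 T, c.val e t = d.val e t) : c = d := by
  refine BoundedContinuousFunction.ext (f := c.toBounded) (g := d.toBounded) fun e => ?_
  ext t
  simpa [val, projIcc_val] using h e t t.2

@[simp] theorem val_zero (e : E) (t : ℝ) : (0 : Coef E T).val e t = 0 := rfl
@[simp] theorem val_one (e : E) (t : ℝ) : (1 : Coef E T).val e t = 1 := rfl
@[simp] theorem val_add (c d : Coef E T) (e : E) (t : ℝ) :
    (c + d).val e t = c.val e t + d.val e t := rfl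
@[simp] theorem val_sub (c d : Coef E T) (e : E) (t : ℝ) :
    (c - d).val e t = c.val e t - d.val e t := rfl
@[simp] theorem val_neg (c : Coef E T) (e : E) (t : ℝ) : (-c).val e t = -c.val e t := rfl
@[simp] theorem val_mul (c d : Coef E T) (e : E) (t : ℝ) :
    (c * d).val e t = c.val e t * d.val e t := rfl
@[simp] theorem val_star (c : Coef E T) (e : E) (t : ℝ) :
    (star c).val e t = conj (c.val e t) := rfl

theorem norm_integral_val_le (g : Coef E T) (e : E) {t : ℝ} (ht : t ∈ Icc 0 T) :
    ‖∫ s in (0 : ℝ)..t, g.val e s‖ ≤ T * ‖g‖ := by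
  have := intervalIntegral.norm_integral_le_of_norm_le_const (a := 0) (b := t)
    (f := g.val e) (C := ‖g‖) fun s _ => g.norm_val_le e s
  rw [sub_zero, abs_of_nonneg ht.1] at this
  calc _ ≤ ‖g‖ * t := this
    _ ≤ ‖g‖ * T := by gcongr; exact ht.2
    _ = _ := mul_comm _ _

variable [DiscreteTopology E]

/-- A bounded family of continuous functions as an element of `Coef E T`. -/
noncomputable def ofFun (f : E → ℝ → ℂ) (hf : ∀ e, Continuous (f e)) (C : ℝ)
    (h : ∀ e, ∀ t ∈ Icc 0 T, ‖f e t‖ ≤ C) : Coef E T :=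
  BoundedContinuousFunction.ofNormedAddCommGroupDiscrete
    (fun e => (⟨fun t : Icc (0 : ℝ) T => f e t, (hf e).comp continuous_subtype_val⟩ :
      C(Icc (0 : ℝ) T, ℂ))) (max C 0) fun e => by
        rw [ContinuousMap.norm_le _ (le_max_right _ _)]
        exact fun t => (h e t t.2).trans (le_max_left _ _)

theorem val_ofFun {f : E → ℝ → ℂ} {hf : ∀ e, Continuous (f e)} {C : ℝ}
    {h : ∀ e, ∀ t ∈ Icc 0 T, ‖f e t‖ ≤ C} (e : E) {t : ℝ} (ht : t ∈ Icc 0 T) :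
    (ofFun f hf C h).val e t = f e t := by
  change f e (projIcc 0 T hT.out.le t) = f e t
  rw [projIcc_of_mem _ ht]

/-- `e ^ (i σ t)`. -/
noncomputable def osc (T : ℝ) [Fact (0 < T)] (σ : E → ℝ) : Coef E T :=
  ofFun (fun e t => Complex.exp ((σ e * t : ℝ) * Complex.I)) (fun _ => by fun_prop) 1
    fun e t _ => (Complex.norm_exp_ofReal_mul_I _).le

/-- `e ^ (-L t)`. -/
noncomputable def damp (E : Type*) [TopologicalSpace E] [DiscreteTopology E] (T : ℝ)
    [Fact (0 < T)] (L : ℝ) : Coef E T :=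
  ofFun (fun _ t => (Real.exp (-L * t) : ℂ)) (fun _ => by fun_prop) (Real.exp (|L| * T))
    fun _ t ht => by
      rw [Complex.norm_real, Real.norm_eq_abs, abs_of_pos (Real.exp_pos _), Real.exp_le_exp]
      calc -L * t ≤ |L| * t := mul_le_mul_of_nonneg_right (neg_le_abs L) ht.1
        _ ≤ |L| * T := mul_le_mul_of_nonneg_left ht.2 (abs_nonneg L)

/-- A bounded family of constants. -/
noncomputable def cst (T : ℝ) [Fact (0 < T)] (c : E → ℂ) (C : ℝ) (h : ∀ e, ‖c e‖ ≤ C) :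
    Coef E T :=
  ofFun (fun e _ => c e) (fun _ => continuous_const) C fun e _ _ => h e

/-- `z : ℂ` as a constant family. -/
noncomputable def num (E : Type*) [TopologicalSpace E] [DiscreteTopology E] (T : ℝ)
    [Fact (0 < T)] (z : ℂ) : Coef E T :=
  cst T (fun _ => z) ‖z‖ fun _ => le_rfl

theorem val_osc (σ : E → ℝ) (e : E) {t : ℝ} (ht : t ∈ Icc 0 T) :
    (osc T σ).val e t = Complex.exp ((σ e * t : ℝ) * Complex.I) := val_ofFun e ht

theorem val_damp (L : ℝ) (e : E) {t : ℝ} (ht : t ∈ Icc 0 T) :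
    (damp E T L).val e t = (Real.exp (-L * t) : ℂ) := val_ofFun e ht

@[simp] theorem val_cst (c : E → ℂ) (C : ℝ) (h : ∀ e, ‖c e‖ ≤ C) (e : E) (t : ℝ) :
    (cst T c C h).val e t = c e := rfl

@[simp] theorem val_num (z : ℂ) (e : E) (t : ℝ) : (num E T z).val e t = z := rfl

theorem norm_osc_le (σ : E → ℝ) : ‖osc T σ‖ ≤ 1 :=
  norm_le zero_le_one fun e t ht => by
    rw [val_osc σ e ht]; exact (Complex.norm_exp_ofReal_mul_I _).le

theorem norm_cst_le (c : E → ℂ) {C : ℝ} (hC : 0 ≤ C) (h : ∀ e, ‖c e‖ ≤ C) :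
    ‖cst T c C h‖ ≤ C :=
  norm_le hC fun e t _ => by simpa using h e

theorem norm_num_le (z : ℂ) : ‖num E T z‖ ≤ ‖z‖ := norm_cst_le _ (norm_nonneg z) _

theorem osc_add (σ τ : E → ℝ) : osc T (σ + τ) = osc T σ * osc T τ :=
  ext_val fun e t ht => by
    rw [val_mul, val_osc _ e ht, val_osc _ e ht, val_osc _ e ht, ← Complex.exp_add]
    simp only [Pi.add_apply]
    push_cast
    ring_nf

theorem osc_zero : osc T (0 : E → ℝ) = 1 :=
  ext_val fun e t ht => by rw [val_osc _ e ht]; simp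

theorem osc_mul_osc_neg (σ : E → ℝ) : osc T σ * osc T (-σ) = 1 := by
  rw [← osc_add, add_neg_cancel, osc_zero]

theorem osc_neg_mul_osc (σ : E → ℝ) : osc T (-σ) * osc T σ = 1 := by
  rw [mul_comm, osc_mul_osc_neg]

theorem star_osc (σ : E → ℝ) : star (osc T σ) = osc T (-σ) :=
  ext_val fun e t ht => by
    rw [val_star, val_osc _ e ht, val_osc _ e ht, ← Complex.exp_conj]
    simp

theorem star_damp (L : ℝ) : star (damp E T L) = damp E T L :=
  ext_val fun e t ht => by
    rw [val_star, val_damp _ e ht, Complex.conj_ofReal]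

theorem norm_damp_le {L : ℝ} (hL : 0 ≤ L) : ‖damp E T L‖ ≤ 1 :=
  norm_le zero_le_one fun e t ht => by
    rw [val_damp _ e ht, Complex.norm_real, Real.norm_eq_abs, abs_of_pos (Real.exp_pos _),
      Real.exp_le_one_iff]
    nlinarith [ht.1]

/-- On a bounded time interval damping changes the norm only by the factor `e ^ (L T)`, so
contraction in the damped norm is as good as contraction in the norm. -/
theorem norm_le_damp {L : ℝ} (hL : 0 ≤ L) (c : Coef E T) :
    ‖c‖ ≤ Real.exp (L * T) * ‖damp E T L * c‖ := by
  refine norm_le (by positivity) fun e t ht => ?_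
  have h := (damp E T L * c).norm_val_le e t
  rw [val_mul, val_damp _ e ht, norm_mul, Complex.norm_real, Real.norm_eq_abs,
    abs_of_pos (Real.exp_pos _)] at h
  calc ‖c.val e t‖ = Real.exp (L * t) * (Real.exp (-L * t) * ‖c.val e t‖) := by
        rw [← mul_assoc, ← Real.exp_add]; simp
    _ ≤ Real.exp (L * T) * ‖damp E T L * c‖ := by
        gcongr
        exact ht.2

/-- The value at `t = 0`, as a family of constants. -/
noncomputable def ini : Coef E T →+ Coef E T where
  toFun c := cst T (fun e => c.val e 0) ‖c‖ fun e => c.norm_val_le e 0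
  map_zero' := ext_val fun e t _ => by simp
  map_add' c d := ext_val fun e t _ => by simp

@[simp] theorem val_ini (c : Coef E T) (e : E) (t : ℝ) : (ini c).val e t = c.val e 0 := rfl

theorem norm_ini_le (c : Coef E T) : ‖ini c‖ ≤ 1 * ‖c‖ := by
  
  rw [one_mul]
  exact norm_cst_le _ (norm_nonneg _) fun e => c.norm_val_le e 0

/-- The primitive `∫₀ᵗ`. -/
noncomputable def intg : Coef E T →+ Coef E T where
  toFun g := ofFun (fun e t => ∫ s in (0 : ℝ)..t, g.val e s)
    (fun e => intervalIntegral.continuous_primitive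
      (fun a b => (g.continuous_val e).intervalIntegrable a b) 0) (T * ‖g‖)
    fun e _ ht => g.norm_integral_val_le e ht
  map_zero' := ext_val fun e t ht => by rw [val_ofFun e ht]; simp
  map_add' f g := ext_val fun e t ht => by
    rw [val_add, val_ofFun e ht, val_ofFun e ht, val_ofFun e ht,
      ← intervalIntegral.integral_add ((f.continuous_val e).intervalIntegrable _ _)
        ((g.continuous_val e).intervalIntegrable _ _)]
    rfl

theorem val_intg (g : Coef E T) (e : E) {t : ℝ} (ht : t ∈ Icc 0 T) :
    (intg g).val e t = ∫ s in (0 : ℝ)..t, g.val e s := val_ofFun e ht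

theorem norm_intg_le (g : Coef E T) : ‖intg g‖ ≤ T * ‖g‖ :=
  norm_le (mul_nonneg hT.out.le (norm_nonneg _)) fun e t ht => by
    rw [val_intg g e ht]; exact g.norm_integral_val_le e ht

theorem ini_intg (g : Coef E T) : ini (intg g) = 0 :=
  ext_val fun e t _ => by
    rw [val_ini, val_intg g e (left_mem_Icc.mpr hT.out.le)]; simp

theorem ini_ini (c : Coef E T) : ini (ini c) = ini c :=
  ext_val fun e t _ => by simp

theorem ini_mul (c d : Coef E T) : ini (c * d) = ini c * ini d :=
  ext_val fun e t _ => by simp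

theorem ini_osc (σ : E → ℝ) : ini (osc T σ) = 1 :=
  ext_val fun e t _ => by
    rw [val_ini, val_osc _ e (left_mem_Icc.mpr hT.out.le)]; simp

/-- `h` is the time derivative of `c`. -/
def IsDt (c h : Coef E T) : Prop := c = ini c + intg h

/-- The integral form used as definition is stable under sums and continuous additive maps; the
pointwise form proved equivalent here gives the product rule and conjugation. -/
theorem isDt_iff {c h : Coef E T} : IsDt c h ↔ ∀ e, ∀ t ∈ Icc 0 T,
    HasDerivWithinAt (c.val e) (h.val e t) (Icc 0 T) t := by
  constructor
  · intro H e t ht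
    -- As `val` projects times to `[0, T]`, the integrand is continuous on the whole line and the
    -- primitive is differentiable at the end points too.
    have h1 : HasDerivAt (fun t => c.val e 0 + ∫ s in (0 : ℝ)..t, h.val e s) (h.val e t) t :=
      (intervalIntegral.integral_hasDerivAt_right ((h.continuous_val e).intervalIntegrable _ _)
        ((h.continuous_val e).stronglyMeasurableAtFilter _ _)
        (h.continuous_val e).continuousAt).const_add _
    have h2 : ∀ t ∈ Icc 0 T, c.val e t = c.val e 0 + ∫ s in (0 : ℝ)..t, h.val e s := by
      intro t ht
      conv_lhs => rw [show c = ini c + intg h from H]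
      rw [val_add, val_ini, val_intg h e ht]
    exact h1.hasDerivWithinAt.congr h2 (h2 t ht)
  · intro H
    refine ext_val fun e t ht => ?_
    rw [val_add, val_ini, val_intg h e ht, intervalIntegral.integral_eq_sub_of_hasDerivAt_of_le
      ht.1 (c.continuous_val e).continuousOn _ ((h.continuous_val e).intervalIntegrable _ _)]
    · ring
    · intro s hs
      have hs' : s ∈ Ioo 0 T := ⟨hs.1, hs.2.trans_le ht.2⟩
      exact (H e s (Ioo_subset_Icc_self hs')).hasDerivAt (Icc_mem_nhds hs'.1 hs'.2)

theorem IsDt.add {c c' h h' : Coef E T} (H : IsDt c h) (H' : IsDt c' h') :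
    IsDt (c + c') (h + h') := by
  unfold IsDt at *
  rw [map_add, map_add]
  nth_rewrite 1 [H, H']
  abel

theorem IsDt.mul {c c' h h' : Coef E T} (H : IsDt c h) (H' : IsDt c' h') :
    IsDt (c * c') (h * c' + c * h') := by
  rw [isDt_iff] at *
  exact fun e t ht => (H e t ht).mul (H' e t ht)

theorem IsDt.star {c h : Coef E T} (H : IsDt c h) : IsDt (star c) (star h) := by
  rw [isDt_iff] at *
  exact fun e t ht => (H e t ht).star

theorem isDt_ini (c : Coef E T) : IsDt (ini c) 0 := by
  unfold IsDt; rw [map_zero, add_zero, ini_ini]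

theorem isDt_cst (c : E → ℂ) (C : ℝ) (h : ∀ e, ‖c e‖ ≤ C) : IsDt (cst T c C h) 0 := by
  unfold IsDt; rw [map_zero, add_zero]; exact ext_val fun e t _ => by simp

theorem isDt_zero : IsDt (0 : Coef E T) 0 := by simp [IsDt]

theorem isDt_intg (g : Coef E T) : IsDt (intg g) g := by
  unfold IsDt; rw [ini_intg, zero_add]

theorem isDt_osc (σ : E → ℝ) (s : Coef E T) (hs : ∀ e t, s.val e t = Complex.I * σ e) :
    IsDt (osc T σ) (s * osc T σ) := by
  rw [isDt_iff]
  intro e t ht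
  have h1 : HasDerivAt (fun t : ℝ => Complex.exp ((σ e * t : ℝ) * Complex.I))
      (Complex.I * σ e * Complex.exp ((σ e * t : ℝ) * Complex.I)) t := by
    have h2 : HasDerivAt (fun t : ℝ => ((σ e * t : ℝ) : ℂ) * Complex.I)
        (σ e * Complex.I) t := by
      have := (((hasDerivAt_id t).const_mul (σ e)).ofReal_comp).mul_const Complex.I
      simpa using this
    convert h2.cexp using 1
    ring
  rw [val_mul, hs, val_osc _ e ht]
  exact h1.hasDerivWithinAt.congr (fun t ht => val_osc _ e ht) (val_osc _ e ht)

/-- The Duhamel integral `∫₀ᵗ e ^ (-i σ (t - s)) g s ds`. -/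
noncomputable def duhamel (σ : E → ℝ) : Coef E T →+ Coef E T :=
  (AddMonoidHom.mulLeft (osc T (-σ))).comp (intg.comp (AddMonoidHom.mulLeft (osc T σ)))

theorem duhamel_apply (σ : E → ℝ) (g : Coef E T) :
    duhamel σ g = osc T (-σ) * intg (osc T σ * g) := rfl

theorem norm_duhamel_le (σ : E → ℝ) (g : Coef E T) : ‖duhamel σ g‖ ≤ T * ‖g‖ := by
  have hT0 := hT.out.le
  calc ‖duhamel σ g‖ ≤ ‖osc T (-σ)‖ * ‖intg (osc T σ * g)‖ := norm_mul_le _ _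
    _ ≤ 1 * (T * (1 * ‖g‖)) := by
        gcongr
        · exact norm_osc_le _
        · refine (norm_intg_le _).trans ?_
          gcongr
          exact (norm_mul_le _ _).trans (by gcongr; exact norm_osc_le _)
    _ = T * ‖g‖ := by ring

/-- The free flow is unimodular and `e ^ (-L t) ∫₀ᵗ e ^ (L s) ds ≤ 1 / L`. Large `L` makes any
Lipschitz Duhamel map a contraction, with no smallness of `T`. -/
theorem norm_damp_duhamel_le (σ : E → ℝ) (g : Coef E T) {L : ℝ} (hL : 0 < L) :
    ‖damp E T L * duhamel σ g‖ ≤ L⁻¹ * ‖damp E T L * g‖ := by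
  refine norm_le (by positivity) fun e t ht => ?_
  set K := ‖damp E T L * g‖
  have hK : ∀ s ∈ Icc 0 T, ‖g.val e s‖ ≤ Real.exp (L * s) * K := fun s hs => by
    have h := (damp E T L * g).norm_val_le e s
    rw [val_mul, val_damp _ e hs, norm_mul, Complex.norm_real, Real.norm_eq_abs,
      abs_of_pos (Real.exp_pos _)] at h
    calc ‖g.val e s‖ = Real.exp (L * s) * (Real.exp (-L * s) * ‖g.val e s‖) := by
          rw [← mul_assoc, ← Real.exp_add]; simp
      _ ≤ _ := by gcongr
  rw [duhamel_apply, val_mul, val_mul, val_damp _ e ht, val_osc _ e ht, val_intg _ e ht, norm_mul,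
    norm_mul, Complex.norm_exp_ofReal_mul_I, Complex.norm_real, Real.norm_eq_abs,
    abs_of_pos (Real.exp_pos _), one_mul]
  have h1 : ‖∫ s in (0 : ℝ)..t, (osc T σ * g).val e s‖
      ≤ ∫ s in (0 : ℝ)..t, Real.exp (L * s) * K := by
    refine intervalIntegral.norm_integral_le_of_norm_le ht.1 ?_
      ((by fun_prop : Continuous fun s => Real.exp (L * s) * K).intervalIntegrable _ _)
    refine Filter.Eventually.of_forall fun s hs => ?_
    have hs' : s ∈ Icc 0 T := ⟨hs.1.le, hs.2.trans ht.2⟩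
    rw [val_mul, norm_mul, val_osc _ e hs', Complex.norm_exp_ofReal_mul_I, one_mul]
    exact hK s hs'
  have h2 : ∫ s in (0 : ℝ)..t, Real.exp (L * s) * K = L⁻¹ * (Real.exp (L * t) - 1) * K := by
    rw [intervalIntegral.integral_mul_const, intervalIntegral.integral_comp_mul_left _ hL.ne']
    simp
  have hK0 : 0 ≤ K := norm_nonneg _
  calc _ ≤ Real.exp (-L * t) * (L⁻¹ * (Real.exp (L * t) - 1) * K) := by gcongr; rw [← h2]; exact h1
    _ = L⁻¹ * (1 - Real.exp (-L * t)) * K := by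
        have : Real.exp (-L * t) * Real.exp (L * t) = 1 := by rw [← Real.exp_add]; simp
        linear_combination L⁻¹ * K * this
    _ ≤ L⁻¹ * 1 * K := by
        gcongr
        linarith [Real.exp_pos (-L * t)]
    _ = _ := by ring

/-- The solution of `c' + i σ c = g` with `c 0 = c₀`. -/
theorem isDt_duhamel (σ : E → ℝ) (s : Coef E T) (hs : ∀ e t, s.val e t = Complex.I * σ e)
    (c₀ g : Coef E T) :
    IsDt (osc T (-σ) * ini c₀ + duhamel σ g)
      (g - s * (osc T (-σ) * ini c₀ + duhamel σ g)) := by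
  have h1 : IsDt (osc T (-σ)) (-s * osc T (-σ)) :=
    isDt_osc (-σ) (-s) fun e t => by simp [hs]
  have h2 := h1.mul ((isDt_ini c₀).add (isDt_intg (osc T σ * g)))
  convert h2 using 1
  · rw [duhamel_apply]; ring
  · rw [duhamel_apply]
    linear_combination (-g) * osc_neg_mul_osc (T := T) σ

theorem ini_duhamel (σ : E → ℝ) (c₀ g : Coef E T) :
    ini (osc T (-σ) * ini c₀ + duhamel σ g) = ini c₀ := by
  rw [map_add, duhamel_apply, ini_mul, ini_mul, ini_intg, ini_osc, ini_ini]; simp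

/-- Variation of constants: the integrating factor `e ^ (i σ t)` removes the term `s c`, and
integrating gives the formula. -/
theorem eq_duhamel (σ : E → ℝ) (s : Coef E T) (hs : ∀ e t, s.val e t = Complex.I * σ e)
    {c g : Coef E T} (h : IsDt c (g - s * c)) : c = osc T (-σ) * ini c + duhamel σ g := by
  have h1 := (isDt_osc σ s hs).mul h
  have h2 : osc T σ * c = ini c + intg (osc T σ * g) := by
    have h3 : IsDt (osc T σ * c) (osc T σ * g) := by convert h1 using 1; ring
    unfold IsDt at h3
    rwa [ini_mul, ini_osc, one_mul] at h3
  rw [duhamel_apply, ← mul_add, ← h2, ← mul_assoc, osc_neg_mul_osc, one_mul]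

end Coef

/-! ### Fixed points near approximate fixed points. -/

/-- A self-map with an approximate fixed point `U`, contracting near `U` with respect to an
equivalent norm `N`, has a fixed point close to `U`. -/
theorem exists_fixedPoint_near {X : Type*} [NormedAddCommGroup X] [CompleteSpace X]
    (N : X → ℝ) (C : ℝ) (hC : 0 ≤ C) (hN : ∀ x, ‖x‖ ≤ C * N x) (hN' : ∀ x, N x ≤ 2 * ‖x‖)
    (hadd : ∀ x y, N (x + y) ≤ N x + N y) (Φ : X → X) (U : X) {ρ δ : ℝ}
    (hlip : ∀ x y, ‖x - U‖ ≤ ρ → ‖y - U‖ ≤ ρ → N (Φ x - Φ y) ≤ 1 / 2 * N (x - y))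
    (hU : N (Φ U - U) ≤ δ) (hδ : 0 ≤ δ) (hρ : C * (2 * δ) ≤ ρ) :
    ∃ A, Φ A = A ∧ ‖A - U‖ ≤ C * (2 * δ) := by
  set x : ℕ → X := fun n => Φ^[n] U with hx
  have hsucc : ∀ n, x (n + 1) = Φ (x n) := fun n => Function.iterate_succ_apply' Φ n U
  have hball : ∀ y, N (y - U) ≤ 2 * δ → ‖y - U‖ ≤ C * (2 * δ) := fun y hy =>
    (hN _).trans (by gcongr)
  -- The distance to `U` is a partial sum of a geometric series with total `2 * δ`, so the iterates
  -- never leave the ball on which the map contracts. The base case uses `hN'` at `0`.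
  have key : ∀ n, N (x n - U) ≤ 2 * δ * (1 - (1 / 2) ^ n) ∧
      N (x (n + 1) - x n) ≤ δ * (1 / 2) ^ n := by
    intro n
    induction n with
    | zero =>
      refine ⟨?_, by simpa [hx] using hU⟩
      simpa [hx] using hN' 0
    | succ n ih =>
      have hp : (0 : ℝ) < (1 / 2) ^ n := by positivity
      have h1 : N (x (n + 1) - U) ≤ 2 * δ * (1 - (1 / 2) ^ (n + 1)) := by
        have := hadd (x (n + 1) - x n) (x n - U)
        rw [sub_add_sub_cancel] at this
        rw [pow_succ]
        nlinarith [ih.1, ih.2]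
      refine ⟨h1, ?_⟩
      have hn : N (x n - U) ≤ 2 * δ := by nlinarith [ih.1]
      have hn1 : N (x (n + 1) - U) ≤ 2 * δ := by
        have : (0 : ℝ) < (1 / 2) ^ (n + 1) := by positivity
        nlinarith
      rw [hsucc (n + 1), hsucc n] at *
      have := hlip _ _ ((hball _ hn1).trans hρ) ((hball _ hn).trans hρ)
      rw [pow_succ]
      linarith [ih.2]
  have hx2 : ∀ n, ‖x n - U‖ ≤ C * (2 * δ) := fun n => hball _ (by
    have hp : (0 : ℝ) < (1 / 2) ^ n := by positivity
    nlinarith [(key n).1])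
  have hcau : CauchySeq x := by
    refine cauchySeq_of_le_geometric (1 / 2) (C * δ) (by norm_num) fun n => ?_
    rw [dist_comm, dist_eq_norm, mul_assoc]
    exact (hN _).trans (by gcongr; exact (key n).2)
  obtain ⟨A, hA⟩ := cauchySeq_tendsto_of_complete hcau
  have hAU : ‖A - U‖ ≤ C * (2 * δ) := le_of_tendsto ((hA.sub_const U).norm)
    (Filter.Eventually.of_forall hx2)
  refine ⟨A, ?_, hAU⟩
  -- `Φ` need not be continuous globally; its convergence along the iterates follows from the
  -- Lipschitz bound, since the iterates and `A` lie in the ball.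
  have h1 : Filter.Tendsto (fun n => x (n + 1)) Filter.atTop (nhds (Φ A)) := by
    rw [tendsto_iff_norm_sub_tendsto_zero]
    refine squeeze_zero (fun _ => norm_nonneg _) (g := fun n => C * ‖x n - A‖) (fun n => ?_) ?_
    · rw [hsucc]
      refine (hN _).trans ?_
      gcongr
      have h2 := hlip _ _ ((hx2 n).trans hρ) (hAU.trans hρ)
      linarith [hN' (x n - A)]
    · simpa using (tendsto_iff_norm_sub_tendsto_zero.mp hA).const_mul C
  exact tendsto_nhds_unique h1 ((Filter.tendsto_add_atTop_iff_nat 1).mpr hA)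

/-! ### Time derivatives, damped norms and propagation of decay. -/

namespace Wiener

open Coef

variable {E : Type*} [TopologicalSpace E] [DiscreteTopology E] {T : ℝ} [hT : Fact (0 < T)]

/-- `g` is the time derivative of `f`. -/
def IsDt (f g : Wiener (Coef E T)) : Prop := ∀ k, Coef.IsDt (f k) (g k)

theorem IsDt.add {f g f' g' : Wiener (Coef E T)} (h : IsDt f g) (h' : IsDt f' g') :
    IsDt (f + f') (g + g') := fun k => (h k).add (h' k)

theorem IsDt.star {f g : Wiener (Coef E T)} (h : IsDt f g) : IsDt (star f) (star g) :=
  fun k => (h (-k)).star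

theorem continuous_ini : Continuous (ini : Coef E T →+ Coef E T) :=
  AddMonoidHomClass.continuous_of_bound _ 1 norm_ini_le

theorem continuous_intg : Continuous (intg : Coef E T →+ Coef E T) :=
  AddMonoidHomClass.continuous_of_bound _ T norm_intg_le

/-- The product rule holds for each term of the convolution, and `ini` and `intg` are continuous and
additive, so they commute with the sum. -/
theorem IsDt.mul {f g f' g' : Wiener (Coef E T)} (h : IsDt f g) (h' : IsDt f' g') :
    IsDt (f * f') (g * f' + f * g') := by
  intro n
  have e1 := summable_mul_apply f f' n
  have e2 := summable_mul_apply g f' n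
  have e3 := summable_mul_apply f g' n
  have e4 := e2.add e3
  unfold Coef.IsDt
  rw [add_apply, mul_apply, mul_apply, mul_apply, ← e2.tsum_add e3,
    e1.map_tsum ini continuous_ini, e4.map_tsum intg continuous_intg]
  refine Eq.trans ?_ ((e1.map ini continuous_ini).tsum_add (e4.map intg continuous_intg))
  congr 1; ext1 m
  exact (h m).mul (h' (n - m))

theorem isDt_const {r : Coef E T} (h : Coef.IsDt r 0) : IsDt (const r) 0 := by
  intro k
  rw [const_def, single_apply, zero_apply]
  split_ifs
  · exact h
  · exact Coef.isDt_zero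

/-- The free propagator applied to the initial values of `f`. -/
noncomputable def prop (σ : ℤ → E → ℝ) : Wiener (Coef E T) →+ Wiener (Coef E T) :=
  mapCoeff (fun k => (AddMonoidHom.mulLeft (osc T (-σ k))).comp ini) 1 fun k r => by
    refine (norm_mul_le (osc T (-σ k)) (ini r)).trans ?_
    have := norm_ini_le r
    rw [one_mul] at *
    calc _ ≤ 1 * ‖r‖ := by gcongr; exact norm_osc_le _
      _ = _ := one_mul _

theorem prop_apply (σ : ℤ → E → ℝ) (f : Wiener (Coef E T)) (k : ℤ) :
    prop σ f k = osc T (-σ k) * ini (f k) := rfl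

/-- The Duhamel operator. -/
noncomputable def duh (σ : ℤ → E → ℝ) : Wiener (Coef E T) →+ Wiener (Coef E T) :=
  mapCoeff (fun k => duhamel (σ k)) T fun k => norm_duhamel_le (σ k)

theorem duh_apply (σ : ℤ → E → ℝ) (f : Wiener (Coef E T)) (k : ℤ) :
    duh σ f k = duhamel (σ k) (f k) := rfl

theorem norm_duh_le (σ : ℤ → E → ℝ) (f : Wiener (Coef E T)) : ‖duh σ f‖ ≤ T * ‖f‖ :=
  norm_mapCoeff_le _ _ _ f

theorem norm_prop_le (σ : ℤ → E → ℝ) (f : Wiener (Coef E T)) : ‖prop σ f‖ ≤ 1 * ‖f‖ :=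
  norm_mapCoeff_le _ _ _ f

/-- The norm with the factor `e ^ (-L t)`. -/
noncomputable def lnorm (L : ℝ) (f : Wiener (Coef E T)) : ℝ := ‖const (damp E T L) * f‖

/-- The weighted norm with the factor `e ^ (-L t)`. -/
noncomputable def lwnorm (L : ℝ) (m N : ℕ) (f : Wiener (Coef E T)) : ℝ :=
  wnorm m N (const (damp E T L) * f)

theorem lnorm_nonneg (L : ℝ) (f : Wiener (Coef E T)) : 0 ≤ lnorm L f := norm_nonneg _

theorem lwnorm_nonneg (L : ℝ) (m N : ℕ) (f : Wiener (Coef E T)) : 0 ≤ lwnorm L m N f :=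
  wnorm_nonneg _ _ _

theorem lnorm_add_le (L : ℝ) (f g : Wiener (Coef E T)) :
    lnorm L (f + g) ≤ lnorm L f + lnorm L g := by
  unfold lnorm; rw [mul_add]; exact norm_add_le _ _

theorem lnorm_mul_le (L : ℝ) (f g : Wiener (Coef E T)) :
    lnorm L (f * g) ≤ lnorm L f * ‖g‖ := by
  unfold lnorm; rw [← mul_assoc]; exact norm_mul_le _ _

theorem lnorm_star (L : ℝ) (f : Wiener (Coef E T)) : lnorm L (star f) = lnorm L f := by
  unfold lnorm
  rw [← norm_star_eq, star_mul, star_star, star_const, star_damp, mul_comm]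

theorem lnorm_le {L : ℝ} (hL : 0 ≤ L) (f : Wiener (Coef E T)) : lnorm L f ≤ ‖f‖ := by
  refine (norm_mul_le _ _).trans ?_
  rw [norm_const]
  exact mul_le_of_le_one_left (norm_nonneg _) (norm_damp_le hL)

theorem norm_le_lnorm {L : ℝ} (hL : 0 ≤ L) (f : Wiener (Coef E T)) :
    ‖f‖ ≤ Real.exp (L * T) * lnorm L f :=
  norm_le_of_forall fun k => by rw [const_mul_apply]; exact norm_le_damp hL _

theorem wnorm_le_lwnorm {L : ℝ} (hL : 0 ≤ L) (m N : ℕ) (f : Wiener (Coef E T)) :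
    wnorm m N f ≤ Real.exp (L * T) * lwnorm L m N f :=
  wnorm_le_of_forall fun k => by rw [const_mul_apply]; exact norm_le_damp hL _

theorem lnorm_duh_le (σ : ℤ → E → ℝ) (f : Wiener (Coef E T)) {L : ℝ} (hL : 0 < L) :
    lnorm L (duh σ f) ≤ L⁻¹ * lnorm L f :=
  norm_le_of_forall fun k => by
    rw [const_mul_apply, const_mul_apply]; exact norm_damp_duhamel_le (σ k) (f k) hL

theorem lwnorm_duh_le (σ : ℤ → E → ℝ) (f : Wiener (Coef E T)) {L : ℝ} (hL : 0 < L) (m N : ℕ) :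
    lwnorm L m N (duh σ f) ≤ L⁻¹ * lwnorm L m N f :=
  wnorm_le_of_forall fun k => by
    rw [const_mul_apply, const_mul_apply]; exact norm_damp_duhamel_le (σ k) (f k) hL

theorem lwnorm_le {L : ℝ} (hL : 0 ≤ L) (m N : ℕ) (f : Wiener (Coef E T)) :
    lwnorm L m N f ≤ wnorm m N f := by
  have : wnorm m N (const (damp E T L) * f) ≤ 1 * wnorm m N f :=
    wnorm_le_of_forall fun k => by
      rw [const_mul_apply]
      exact (norm_mul_le _ _).trans (by gcongr; exact norm_damp_le hL)
  rwa [one_mul] at this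

theorem lwnorm_add_le (L : ℝ) (m N : ℕ) (f g : Wiener (Coef E T)) :
    lwnorm L m N (f + g) ≤ lwnorm L m N f + lwnorm L m N g := by
  unfold lwnorm; rw [mul_add]; exact wnorm_add_le _ _ _ _

theorem lwnorm_star (L : ℝ) (m N : ℕ) (f : Wiener (Coef E T)) :
    lwnorm L m N (star f) = lwnorm L m N f := by
  unfold lwnorm
  rw [← wnorm_star, star_mul, star_star, star_const, star_damp, mul_comm]

theorem lwnorm_mul_le (L : ℝ) (m N : ℕ) (f g : Wiener (Coef E T)) :
    lwnorm L m N (f * g) ≤ 2 ^ m * (lwnorm L m N f * ‖g‖ + ‖f‖ * lwnorm L m N g) :=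
  wnorm_const_mul_le m N _ f g

theorem lwnorm_const_mul_le (L : ℝ) (m N : ℕ) (r : Coef E T) (f : Wiener (Coef E T)) :
    lwnorm L m N (const r * f) ≤ ‖r‖ * lwnorm L m N f :=
  wnorm_le_of_forall fun k => by
    rw [const_mul_apply, const_mul_apply, const_mul_apply, mul_left_comm]
    exact norm_mul_le _ _

theorem lnorm_const_mul_le (L : ℝ) (r : Coef E T) (f : Wiener (Coef E T)) :
    lnorm L (const r * f) ≤ ‖r‖ * lnorm L f :=
  norm_le_of_forall fun k => by
    rw [const_mul_apply, const_mul_apply, const_mul_apply, mul_left_comm]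
    exact norm_mul_le _ _

/-- Mild solutions with rapidly decaying initial values and tame forcing decay rapidly. -/
theorem rapidDecay_of_mild {ι : Type*} [Fintype ι] (σ : ι → ℤ → E → ℝ)
    (f f₀ g : ι → Wiener (Coef E T)) (hf : ∀ i, f i = prop (σ i) (f₀ i) + duh (σ i) (g i))
    (h₀ : ∀ i, RapidDecay (f₀ i))
    (hg : ∀ m, ∃ K c, 0 ≤ K ∧ 0 ≤ c ∧ ∀ N : ℕ, ∀ L : ℝ, 0 ≤ L → ∀ i,
      lwnorm L m N (g i) ≤ K * ∑ j, lwnorm L m N (f j) + c) (i : ι) : RapidDecay (f i) := by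
  refine RapidDecay.of_wnorm_le fun m => ?_
  obtain ⟨K, c, hK, hc, hg⟩ := hg m
  set n : ℝ := (Fintype.card ι : ℝ)
  have hn : 0 ≤ n := Nat.cast_nonneg _
  -- With this `L` the contribution of all Duhamel terms is at most half of `Y` plus a constant.
  -- Neither `L` nor the resulting bound depends on `N`, and the absorption is legitimate because
  -- truncated norms are finite for every element.
  set L : ℝ := 2 * n * K + 1
  have hL : 1 ≤ L := by have := mul_nonneg hn hK; simp only [L]; linarith
  have hL0 : 0 < L := by linarith
  set D : ℝ := ∑ j, ∑' k : ℤ, (1 + |(k : ℝ)|) ^ m * ‖f₀ j k‖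
  refine ⟨Real.exp (L * T) * (2 * (D + n * c)), fun N => ?_⟩
  set Y : ℝ := ∑ j, lwnorm L m N (f j)
  have hY : Y ≤ D + n * (L⁻¹ * (K * Y + c)) := by
    calc Y ≤ ∑ j, ((∑' k : ℤ, (1 + |(k : ℝ)|) ^ m * ‖f₀ j k‖) + L⁻¹ * (K * Y + c)) := by
          refine Finset.sum_le_sum fun j _ => ?_
          rw [hf j]
          refine (lwnorm_add_le _ _ _ _ _).trans (add_le_add ?_ ?_)
          · refine (lwnorm_le hL0.le m N _).trans (le_trans ?_ ((h₀ j).wnorm_le m N))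
            have : wnorm m N (prop (σ j) (f₀ j)) ≤ 1 * wnorm m N (f₀ j) :=
              wnorm_le_of_forall fun k => by
                rw [prop_apply]
                refine (norm_mul_le _ _).trans ?_
                have h1 := norm_ini_le (f₀ j k)
                calc _ ≤ 1 * (1 * ‖f₀ j k‖) := by gcongr; exact norm_osc_le _
                  _ = _ := by ring
            rwa [one_mul] at this
          · refine (lwnorm_duh_le _ _ hL0 _ _).trans ?_
            gcongr
            exact hg N L hL0.le j
      _ = _ := by
          rw [Finset.sum_add_distrib, Finset.sum_const, Finset.card_univ, nsmul_eq_mul]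
  have hY0 : 0 ≤ Y := Finset.sum_nonneg fun j _ => lwnorm_nonneg _ _ _ _
  have hY' : Y ≤ 2 * (D + n * c) := by
    have h1 : n * (L⁻¹ * (K * Y + c)) ≤ 1 / 2 * Y + n * c := by
      have e1 : L⁻¹ * (2 * n * K) ≤ 1 := by
        rw [inv_mul_le_iff₀ hL0]; simp only [L]; linarith
      have e2 : L⁻¹ ≤ 1 := inv_le_one_of_one_le₀ hL
      have e3 := mul_le_mul_of_nonneg_right e1 hY0
      have e4 := mul_le_mul_of_nonneg_right e2 (mul_nonneg hn hc)
      linarith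
    linarith
  refine (wnorm_le_lwnorm hL0.le m N (f i)).trans ?_
  gcongr
  refine le_trans ?_ hY'
  exact Finset.single_le_sum (f := fun j => lwnorm L m N (f j))
    (fun j _ => lwnorm_nonneg _ _ _ _) (Finset.mem_univ i)

/-- Rapidly decaying, with `j` rapidly decaying time derivatives. -/
def Smooth : ℕ → Wiener (Coef E T) → Prop
  | 0, f => RapidDecay f
  | j + 1, f => RapidDecay f ∧ ∃ g, IsDt f g ∧ Smooth j g

theorem Smooth.rapidDecay {j : ℕ} {f : Wiener (Coef E T)} (h : Smooth j f) : RapidDecay f := by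
  cases j with
  | zero => exact h
  | succ j => exact h.1

theorem Smooth.of_succ {j : ℕ} {f : Wiener (Coef E T)} (h : Smooth (j + 1) f) : Smooth j f := by
  induction j generalizing f with
  | zero => exact h.1
  | succ j ih =>
    obtain ⟨h1, g, hg, h2⟩ := h
    exact ⟨h1, g, hg, ih h2⟩

theorem Smooth.add {j : ℕ} {f g : Wiener (Coef E T)} (hf : Smooth j f) (hg : Smooth j g) :
    Smooth j (f + g) := by
  induction j generalizing f g with
  | zero => exact RapidDecay.add hf hg
  | succ j ih =>
    obtain ⟨h1, f', h2, h3⟩ := hf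
    obtain ⟨k1, g', k2, k3⟩ := hg
    exact ⟨h1.add k1, _, h2.add k2, ih h3 k3⟩

theorem Smooth.mul {j : ℕ} {f g : Wiener (Coef E T)} (hf : Smooth j f) (hg : Smooth j g) :
    Smooth j (f * g) := by
  induction j generalizing f g with
  | zero => exact RapidDecay.mul hf hg
  | succ j ih =>
    have hf' := hf.of_succ
    have hg' := hg.of_succ
    obtain ⟨h1, f', h2, h3⟩ := hf
    obtain ⟨k1, g', k2, k3⟩ := hg
    exact ⟨h1.mul k1, _, h2.mul k2, (ih h3 hg').add (ih hf' k3)⟩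

theorem Smooth.star {j : ℕ} {f : Wiener (Coef E T)} (hf : Smooth j f) : Smooth j (star f) := by
  induction j generalizing f with
  | zero => exact RapidDecay.star hf
  | succ j ih =>
    obtain ⟨h1, f', h2, h3⟩ := hf
    exact ⟨h1.star, _, h2.star, ih h3⟩

theorem smooth_zero (j : ℕ) : Smooth j (0 : Wiener (Coef E T)) := by
  have h : RapidDecay (0 : Wiener (Coef E T)) := fun m => by simp
  induction j with
  | zero => exact h
  | succ j ih => exact ⟨h, 0, fun k => Coef.isDt_zero, ih⟩

theorem smooth_const {r : Coef E T} (h : Coef.IsDt r 0) (j : ℕ) : Smooth j (const r) := by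
  cases j with
  | zero => exact RapidDecay.single 0 r
  | succ j => exact ⟨RapidDecay.single 0 r, 0, isDt_const h, smooth_zero j⟩

/-- A multiplier of polynomial growth maps smooth elements to smooth elements. -/
theorem Smooth.exists_multiplier {s : ℤ → Coef E T} {C : ℝ} {p : ℕ}
    (hs : ∀ k, ‖s k‖ ≤ C * (1 + |(k : ℝ)|) ^ p) (hs' : ∀ k, Coef.IsDt (s k) 0) {j : ℕ}
    {f : Wiener (Coef E T)} (hf : Smooth j f) : ∃ g, Smooth j g ∧ ∀ k, g k = s k * f k := by
  have hb : ∀ f : Wiener (Coef E T), ∀ k, ‖s k * f k‖ ≤ C * (1 + |(k : ℝ)|) ^ p * ‖f k‖ :=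
    fun f k => (norm_mul_le _ _).trans (by gcongr; exact hs k)
  have hg : ∀ f : Wiener (Coef E T), RapidDecay f → ∃ g : Wiener (Coef E T), RapidDecay g ∧
      ∀ k, g k = s k * f k := fun f hf => by
    have h1 : Summable fun k => ‖s k * f k‖ := Summable.of_nonneg_of_le
      (fun _ => norm_nonneg _) (hb f) (by simpa only [mul_assoc] using (hf p).mul_left C)
    exact ⟨⟨fun k => s k * f k, h1⟩, RapidDecay.of_le hf (hb f), fun k => rfl⟩
  induction j generalizing f with
  | zero => exact hg f hf
  | succ j ih =>
    obtain ⟨h1, f', h2, h3⟩ := hf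
    obtain ⟨g, hg1, hg2⟩ := hg f h1
    obtain ⟨g', hg1', hg2'⟩ := ih h3
    refine ⟨g, ⟨hg1, g', fun k => ?_, hg1'⟩, hg2⟩
    rw [hg2, hg2']
    simpa using (hs' k).mul (h2 k)

end Wiener

/-! ### Polynomial nonlinearities and linear evolution equations. -/

namespace Wiener

open Coef

variable {E : Type*} [TopologicalSpace E] [DiscreteTopology E] {T : ℝ} [hT : Fact (0 < T)]

/-- The properties of polynomial maps in three variables and their conjugates, without
constant term, that are needed for the evolution equations. -/
structure PolyLike (F : Wiener (Coef E T) → Wiener (Coef E T) → Wiener (Coef E T) →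
    Wiener (Coef E T)) : Prop where
  bdd : ∀ M : ℝ, ∃ K : ℝ, 0 ≤ K ∧ ∀ h a b, ‖h‖ ≤ M → ‖a‖ ≤ M → ‖b‖ ≤ M → ‖F h a b‖ ≤ K
  lip : ∀ M : ℝ, ∃ K : ℝ, 0 ≤ K ∧ ∀ L : ℝ, ∀ h a b h' a' b', ‖h‖ ≤ M → ‖a‖ ≤ M →
    ‖b‖ ≤ M → ‖h'‖ ≤ M → ‖a'‖ ≤ M → ‖b'‖ ≤ M → lnorm L (F h a b - F h' a' b')
      ≤ K * (lnorm L (h - h') + lnorm L (a - a') + lnorm L (b - b'))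
  tame : ∀ M : ℝ, ∀ m : ℕ, ∃ K : ℝ, 0 ≤ K ∧ ∀ N : ℕ, ∀ L : ℝ, ∀ h a b, ‖h‖ ≤ M → ‖a‖ ≤ M →
    ‖b‖ ≤ M → lwnorm L m N (F h a b) ≤ K * (lwnorm L m N h + lwnorm L m N a + lwnorm L m N b)
  smooth : ∀ j, ∀ h a b, Smooth j h → Smooth j a → Smooth j b → Smooth j (F h a b)

namespace PolyLike

variable {F G : Wiener (Coef E T) → Wiener (Coef E T) → Wiener (Coef E T) → Wiener (Coef E T)}

theorem fst : PolyLike (fun h _ _ : Wiener (Coef E T) => h) where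
  bdd M := ⟨max M 0, le_max_right _ _, fun h a b h1 _ _ => h1.trans (le_max_left _ _)⟩
  lip M := ⟨1, zero_le_one, fun L h a b h' a' b' _ _ _ _ _ _ => by
    linarith [lnorm_nonneg L (a - a'), lnorm_nonneg L (b - b')]⟩
  tame M m := ⟨1, zero_le_one, fun N L h a b _ _ _ => by
    linarith [lwnorm_nonneg L m N a, lwnorm_nonneg L m N b]⟩
  smooth j h a b h1 _ _ := h1

theorem snd : PolyLike (fun _ a _ : Wiener (Coef E T) => a) where
  bdd M := ⟨max M 0, le_max_right _ _, fun h a b _ h1 _ => h1.trans (le_max_left _ _)⟩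
  lip M := ⟨1, zero_le_one, fun L h a b h' a' b' _ _ _ _ _ _ => by
    linarith [lnorm_nonneg L (h - h'), lnorm_nonneg L (b - b')]⟩
  tame M m := ⟨1, zero_le_one, fun N L h a b _ _ _ => by
    linarith [lwnorm_nonneg L m N h, lwnorm_nonneg L m N b]⟩
  smooth j h a b _ h1 _ := h1

theorem thd : PolyLike (fun _ _ b : Wiener (Coef E T) => b) where
  bdd M := ⟨max M 0, le_max_right _ _, fun h a b _ _ h1 => h1.trans (le_max_left _ _)⟩
  lip M := ⟨1, zero_le_one, fun L h a b h' a' b' _ _ _ _ _ _ => by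
    linarith [lnorm_nonneg L (h - h'), lnorm_nonneg L (a - a')]⟩
  tame M m := ⟨1, zero_le_one, fun N L h a b _ _ _ => by
    linarith [lwnorm_nonneg L m N h, lwnorm_nonneg L m N a]⟩
  smooth j h a b _ _ h1 := h1

theorem add (hF : PolyLike F) (hG : PolyLike G) : PolyLike (fun h a b => F h a b + G h a b) where
  bdd M := by
    obtain ⟨K, hK, h1⟩ := hF.bdd M
    obtain ⟨K', hK', h2⟩ := hG.bdd M
    exact ⟨K + K', by positivity, fun h a b x y z =>
      (norm_add_le _ _).trans (add_le_add (h1 h a b x y z) (h2 h a b x y z))⟩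
  lip M := by
    obtain ⟨K, hK, h1⟩ := hF.lip M
    obtain ⟨K', hK', h2⟩ := hG.lip M
    refine ⟨K + K', by positivity, fun L h a b h' a' b' x y z x' y' z' => ?_⟩
    rw [add_sub_add_comm, add_mul]
    exact (lnorm_add_le _ _ _).trans (add_le_add (h1 L h a b h' a' b' x y z x' y' z')
      (h2 L h a b h' a' b' x y z x' y' z'))
  tame M m := by
    obtain ⟨K, hK, h1⟩ := hF.tame M m
    obtain ⟨K', hK', h2⟩ := hG.tame M m
    refine ⟨K + K', by positivity, fun N L h a b x y z => ?_⟩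
    rw [add_mul]
    exact (lwnorm_add_le _ _ _ _ _).trans (add_le_add (h1 N L h a b x y z) (h2 N L h a b x y z))
  smooth j h a b x y z := (hF.smooth j h a b x y z).add (hG.smooth j h a b x y z)

/-- The plain bound of one factor multiplies the Lipschitz or tame bound of the other. The constants
are independent of `L` and `N`; later `L` is chosen in terms of them. -/
theorem mul (hF : PolyLike F) (hG : PolyLike G) : PolyLike (fun h a b => F h a b * G h a b) where
  bdd M := by
    obtain ⟨K, hK, h1⟩ := hF.bdd M
    obtain ⟨K', hK', h2⟩ := hG.bdd M
    exact ⟨K * K', by positivity, fun h a b x y z =>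
      (norm_mul_le _ _).trans (mul_le_mul (h1 h a b x y z) (h2 h a b x y z) (norm_nonneg _) hK)⟩
  lip M := by
    obtain ⟨B, hB, b1⟩ := hF.bdd M
    obtain ⟨B', hB', b2⟩ := hG.bdd M
    obtain ⟨K, hK, h1⟩ := hF.lip M
    obtain ⟨K', hK', h2⟩ := hG.lip M
    refine ⟨K * B' + K' * B, by positivity, fun L h a b h' a' b' x y z x' y' z' => ?_⟩
    have e : F h a b * G h a b - F h' a' b' * G h' a' b'
        = (F h a b - F h' a' b') * G h a b + (G h a b - G h' a' b') * F h' a' b' := by ring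
    rw [e, add_mul]
    refine (lnorm_add_le _ _ _).trans (add_le_add ?_ ?_) <;>
      refine (lnorm_mul_le _ _ _).trans ?_ <;> rw [mul_right_comm]
    · exact mul_le_mul (h1 L h a b h' a' b' x y z x' y' z') (b2 h a b x y z) (norm_nonneg _)
        ((lnorm_nonneg _ _).trans (h1 L h a b h' a' b' x y z x' y' z'))
    · exact mul_le_mul (h2 L h a b h' a' b' x y z x' y' z') (b1 h' a' b' x' y' z') (norm_nonneg _)
        ((lnorm_nonneg _ _).trans (h2 L h a b h' a' b' x y z x' y' z'))
  tame M m := by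
    obtain ⟨B, hB, b1⟩ := hF.bdd M
    obtain ⟨B', hB', b2⟩ := hG.bdd M
    obtain ⟨K, hK, h1⟩ := hF.tame M m
    obtain ⟨K', hK', h2⟩ := hG.tame M m
    refine ⟨2 ^ m * (K * B' + B * K'), by positivity, fun N L h a b x y z => ?_⟩
    refine (lwnorm_mul_le _ _ _ _ _).trans ?_
    set Q := lwnorm L m N h + lwnorm L m N a + lwnorm L m N b
    have i1 := h1 N L h a b x y z
    have i2 := h2 N L h a b x y z
    calc _ ≤ 2 ^ m * ((K * Q) * B' + B * (K' * Q)) := by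
          have := lwnorm_nonneg L m N (F h a b)
          have := lwnorm_nonneg L m N (G h a b)
          gcongr
          · linarith
          · exact b2 h a b x y z
          · exact b1 h a b x y z
      _ = _ := by ring
  smooth j h a b x y z := (hF.smooth j h a b x y z).mul (hG.smooth j h a b x y z)

theorem star (hF : PolyLike F) : PolyLike (fun h a b => star (F h a b)) where
  bdd M := by
    obtain ⟨K, hK, h1⟩ := hF.bdd M
    exact ⟨K, hK, fun h a b x y z => (norm_star_eq _).le.trans (h1 h a b x y z)⟩
  lip M := by
    obtain ⟨K, hK, h1⟩ := hF.lip M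
    refine ⟨K, hK, fun L h a b h' a' b' x y z x' y' z' => ?_⟩
    rw [← star_sub, lnorm_star]
    exact h1 L h a b h' a' b' x y z x' y' z'
  tame M m := by
    obtain ⟨K, hK, h1⟩ := hF.tame M m
    refine ⟨K, hK, fun N L h a b x y z => ?_⟩
    rw [lwnorm_star]
    exact h1 N L h a b x y z
  smooth j h a b x y z := (hF.smooth j h a b x y z).star

theorem const_mul (hF : PolyLike F) {r : Coef E T} (hr : Coef.IsDt r 0) :
    PolyLike (fun h a b => const r * F h a b) where
  bdd M := by
    obtain ⟨K, hK, h1⟩ := hF.bdd M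
    refine ⟨‖r‖ * K, by positivity, fun h a b x y z => (norm_mul_le _ _).trans ?_⟩
    rw [norm_const]
    gcongr
    exact h1 h a b x y z
  lip M := by
    obtain ⟨K, hK, h1⟩ := hF.lip M
    refine ⟨‖r‖ * K, by positivity, fun L h a b h' a' b' x y z x' y' z' => ?_⟩
    rw [← mul_sub, mul_assoc]
    refine (lnorm_const_mul_le _ _ _).trans ?_
    gcongr
    exact h1 L h a b h' a' b' x y z x' y' z'
  tame M m := by
    obtain ⟨K, hK, h1⟩ := hF.tame M m
    refine ⟨‖r‖ * K, by positivity, fun N L h a b x y z => ?_⟩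
    rw [mul_assoc]
    refine (lwnorm_const_mul_le _ _ _ _ _).trans ?_
    gcongr
    exact h1 N L h a b x y z
  smooth j h a b x y z := (smooth_const hr j).mul (hF.smooth j h a b x y z)

end PolyLike

/-- `f' + s f = g`. -/
def Evolves (s : ℤ → Coef E T) (f g : Wiener (Coef E T)) : Prop :=
  ∀ k, Coef.IsDt (f k) (g k - s k * f k)

/-- `s` represents `i σ`. -/
def Represents (s : ℤ → Coef E T) (σ : ℤ → E → ℝ) : Prop :=
  ∀ k e t, (s k).val e t = Complex.I * σ k e

theorem evolves_of_mild {s : ℤ → Coef E T} {σ : ℤ → E → ℝ} (hs : Represents s σ)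
    {f f₀ g : Wiener (Coef E T)} (h : f = prop σ f₀ + duh σ g) : Evolves s f g := by
  intro k
  have := isDt_duhamel (σ k) (s k) (hs k) (f₀ k) (g k)
  rw [h]
  exact this

theorem mild_of_evolves {s : ℤ → Coef E T} {σ : ℤ → E → ℝ} (hs : Represents s σ)
    {f f₀ g : Wiener (Coef E T)} (h : Evolves s f g) (h₀ : ∀ k, ini (f k) = ini (f₀ k)) :
    f = prop σ f₀ + duh σ g := by
  ext k : 1
  rw [add_apply, prop_apply, duh_apply, ← h₀]
  exact eq_duhamel (σ k) (s k) (hs k) (h k)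

theorem ini_of_mild {σ : ℤ → E → ℝ} {f f₀ g : Wiener (Coef E T)}
    (h : f = prop σ f₀ + duh σ g) (k : ℤ) : ini (f k) = ini (f₀ k) := by
  rw [h]; exact ini_duhamel _ _ _

/-- Rapidly decaying solutions of an evolution equation are smooth. -/
theorem smooth_of_evolves {ι : Type*} (s : ι → ℤ → Coef E T) {C : ℝ} {p : ℕ}
    (hs : ∀ i k, ‖s i k‖ ≤ C * (1 + |(k : ℝ)|) ^ p) (hs' : ∀ i k, Coef.IsDt (s i k) 0)
    {f g : ι → Wiener (Coef E T)} (h : ∀ i, Evolves (s i) (f i) (g i))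
    (hf : ∀ i, RapidDecay (f i))
    (hg : ∀ j, (∀ i, Smooth j (f i)) → ∀ i, Smooth j (g i)) (j : ℕ) (i : ι) :
    Smooth j (f i) := by
  induction j generalizing i with
  | zero => exact hf i
  | succ j ih =>
    -- The equation expresses the time derivative as `g - s f`. The symbol `s` has polynomial growth
    -- and is constant in time, so it preserves the number of smooth time derivatives already known.
    obtain ⟨q, hq, hq'⟩ := Smooth.exists_multiplier (s := fun k => -s i k)
      (fun k => by rw [norm_neg]; exact hs i k)
      (fun k => by
        have := hs' i k
        unfold Coef.IsDt at *
        rw [map_zero, add_zero] at *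
        rw [map_neg, ← this]) (ih i)
    refine ⟨hf i, g i + q, fun k => ?_, (hg j ih i).add hq⟩
    rw [add_apply, hq', neg_mul, ← sub_eq_add_neg]
    exact h i k

/-- The linear equation `f' + i σ f = V f` has a global mild solution. -/
theorem exists_mild_linear (σ : ℤ → E → ℝ) (f₀ V : Wiener (Coef E T)) :
    ∃ f, f = prop σ f₀ + duh σ (V * f) := by
  -- The map is affine and contracts globally for this `L`; hence `0` serves as approximate fixed
  -- point and the radius can be set to exactly what the lemma demands.
  set L : ℝ := 2 * ‖V‖ + 1
  have hL : 0 < L := by positivity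
  obtain ⟨f, hf, -⟩ := exists_fixedPoint_near (lnorm L) (Real.exp (L * T)) (by positivity)
    (fun x => norm_le_lnorm hL.le x)
    (fun x => by have := lnorm_le hL.le x; linarith [norm_nonneg x]) (lnorm_add_le L)
    (fun f => prop σ f₀ + duh σ (V * f)) 0 (ρ := Real.exp (L * T) * (2 * ‖prop σ f₀‖))
    (δ := ‖prop σ f₀‖) (fun x y _ _ => by
      rw [add_sub_add_left_eq_sub, ← map_sub, ← mul_sub]
      refine (lnorm_duh_le _ _ hL).trans ?_
      rw [mul_comm V]
      have h1 := lnorm_mul_le L (x - y) V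
      have h2 : L⁻¹ * ‖V‖ ≤ 1 / 2 := by
        rw [inv_mul_le_iff₀ hL]; simp only [L]; linarith
      calc _ ≤ L⁻¹ * (lnorm L (x - y) * ‖V‖) := by gcongr
        _ = L⁻¹ * ‖V‖ * lnorm L (x - y) := by ring
        _ ≤ _ := by gcongr; exact lnorm_nonneg _ _) (by
      simpa using lnorm_le hL.le (prop σ f₀)) (norm_nonneg _) le_rfl
  exact ⟨f, hf.symm⟩

/-- In the tame estimate for `V * f` the term with the weight on `V` is a fixed constant, because
`V` decays rapidly and the plain norm of `f` is given. -/
theorem rapidDecay_of_mild_linear {σ : ℤ → E → ℝ} {f f₀ V : Wiener (Coef E T)}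
    (h : f = prop σ f₀ + duh σ (V * f)) (h₀ : RapidDecay f₀) (hV : RapidDecay V) :
    RapidDecay f := by
  refine rapidDecay_of_mild (ι := Unit) (fun _ => σ) (fun _ => f) (fun _ => f₀)
    (fun _ => V * f) (fun _ => h) (fun _ => h₀) (fun m => ?_) ()
  set D := ∑' k : ℤ, (1 + |(k : ℝ)|) ^ m * ‖V k‖
  have hD : 0 ≤ D := tsum_nonneg fun k => by positivity
  refine ⟨2 ^ m * ‖V‖, 2 ^ m * (D * ‖f‖), by positivity, by positivity, fun N L hL _ => ?_⟩
  refine (lwnorm_mul_le _ _ _ _ _).trans ?_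
  have h1 : lwnorm L m N V ≤ D := (lwnorm_le hL m N V).trans (hV.wnorm_le m N)
  have h2 : ∑ _j : Unit, lwnorm L m N f = lwnorm L m N f := by simp
  rw [h2, mul_add, add_comm, ← mul_assoc]
  gcongr

end Wiener

/-! ### The modulation equations: limit system, existence, smoothness. -/

namespace Wiener

open Coef

/-- The symbol of `c ∂ₓ - (i η / 2) ∂ₓ²`, divided by `i`. -/
noncomputable def disp {E : Type*} (η : E → ℝ) (c : ℝ) (k : ℤ) (e : E) : ℝ := c * k + η e * k ^ 2 / 2

theorem norm_disp_le {E : Type*} {η : E → ℝ} (hη : ∀ e, |η e| ≤ 1) (c : ℝ) (k : ℤ) (e : E) :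
    ‖Complex.I * disp η c k e‖ ≤ (|c| + 1) * (1 + |(k : ℝ)|) ^ 2 := by
  rw [norm_mul, Complex.norm_I, one_mul, Complex.norm_real, Real.norm_eq_abs, disp]
  have h1 : |c * k + η e * k ^ 2 / 2| ≤ |c| * |(k : ℝ)| + 1 * |(k : ℝ)| ^ 2 / 2 := by
    refine (abs_add_le _ _).trans ?_
    rw [abs_mul, abs_div, abs_mul, abs_pow, abs_two]
    gcongr
    exact hη e
  have h2 := abs_nonneg (k : ℝ)
  have h3 := abs_nonneg c
  nlinarith [mul_nonneg h3 h2, mul_nonneg h3 (mul_nonneg h2 h2), mul_nonneg h2 h2]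

variable {E : Type*} [TopologicalSpace E] [DiscreteTopology E] {T : ℝ} [hT : Fact (0 < T)]

/-- The symbol of `c ∂ₓ - (i η / 2) ∂ₓ²`. -/
noncomputable def dispCoef (T : ℝ) [Fact (0 < T)] {η : E → ℝ} (hη : ∀ e, |η e| ≤ 1) (c : ℝ)
    (k : ℤ) : Coef E T :=
  cst T (fun e => Complex.I * disp η c k e) _ (norm_disp_le hη c k)

theorem represents_dispCoef {η : E → ℝ} (hη : ∀ e, |η e| ≤ 1) (c : ℝ) :
    Represents (dispCoef T hη c) (disp η c) := fun _ _ _ => rfl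

theorem norm_dispCoef_le {η : E → ℝ} (hη : ∀ e, |η e| ≤ 1) (c : ℝ) (k : ℤ) :
    ‖dispCoef T hη c k‖ ≤ (|c| + 1) * (1 + |(k : ℝ)|) ^ 2 :=
  norm_cst_le _ (by positivity) _

theorem isDt_dispCoef {η : E → ℝ} (hη : ∀ e, |η e| ≤ 1) (c : ℝ) (k : ℤ) :
    Coef.IsDt (dispCoef T hη c k) 0 := isDt_cst _ _ _

theorem isDt_num (z : ℂ) : Coef.IsDt (num E T z) 0 := isDt_cst _ _ _

/-- A complex number as an element of the algebra. -/
noncomputable abbrev scal (E : Type*) [TopologicalSpace E] [DiscreteTopology E] (T : ℝ)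
    [Fact (0 < T)] (z : ℂ) : Wiener (Coef E T) := const (num E T z)

/-- `z a b̄ a`. -/
noncomputable def cub (z : ℂ) (a b : Wiener (Coef E T)) : Wiener (Coef E T) :=
  scal E T z * (a * star b * a)

/-- `-i lam (|a|² + 2 |b|²) a`. -/
noncomputable def crossCubic (lam : ℂ) (a b : Wiener (Coef E T)) : Wiener (Coef E T) :=
  scal E T (-Complex.I * lam) * ((a * star a + (b * star b + b * star b)) * a)

/-- The quintic correction in the equations for the modulation functions. -/
noncomputable def quintic (lam z : ℂ) (a b : Wiener (Coef E T)) : Wiener (Coef E T) :=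
  scal E T (-Complex.I * lam) * (scal E T lam *
    ((b * star a * cub z a b + b * star a * cub z a b) + b * star (cub z b a) * b))

/-- The forcing in the equations for the modulation functions. -/
noncomputable def forcing (lam z : ℂ) (h a b : Wiener (Coef E T)) : Wiener (Coef E T) :=
  crossCubic lam a b + h * quintic lam z a b

open PolyLike in
theorem polyLike_cub (z : ℂ) : PolyLike (fun _ a b : Wiener (Coef E T) => cub z a b) :=
  ((snd.mul thd.star).mul snd).const_mul (isDt_num z)

open PolyLike in
theorem polyLike_cub' (z : ℂ) : PolyLike (fun _ a b : Wiener (Coef E T) => cub z b a) :=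
  ((thd.mul snd.star).mul thd).const_mul (isDt_num z)

open PolyLike in
theorem polyLike_crossCubic (lam : ℂ) :
    PolyLike (fun _ a b : Wiener (Coef E T) => crossCubic lam a b) :=
  (((snd.mul snd.star).add ((thd.mul thd.star).add (thd.mul thd.star))).mul snd).const_mul
    (isDt_num _)

open PolyLike in
theorem polyLike_quintic (lam z : ℂ) :
    PolyLike (fun _ a b : Wiener (Coef E T) => quintic lam z a b) :=
  (((((thd.mul snd.star).mul (polyLike_cub z)).add
    ((thd.mul snd.star).mul (polyLike_cub z))).add
    ((thd.mul (polyLike_cub' z).star).mul thd)).const_mul (isDt_num _)).const_mul (isDt_num _)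

open PolyLike in
theorem polyLike_forcing (lam z : ℂ) : PolyLike (forcing (E := E) (T := T) lam z) :=
  (polyLike_crossCubic lam).add (fst.mul (polyLike_quintic lam z))

/-- Multiplication of the `k`-th coefficient by `e ^ (i c k t)`: a translation with speed `c`. -/
noncomputable def translate (E : Type*) [TopologicalSpace E] [DiscreteTopology E] (T : ℝ)
    [Fact (0 < T)] (c : ℝ) : Wiener (Coef E T) →+* Wiener (Coef E T) :=
  twist (fun k => osc T (fun _ => c * k)) (fun _ => norm_osc_le _)
    (by rw [← osc_zero]; congr 1; ext; simp)
    fun j k => by rw [← osc_add]; congr 1; ext; push_cast; simp [mul_add]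

theorem translate_apply (c : ℝ) (f : Wiener (Coef E T)) (k : ℤ) :
    translate E T c f k = osc T (fun _ => c * k) * f k := rfl

theorem translate_star (c : ℝ) (f : Wiener (Coef E T)) :
    translate E T c (star f) = star (translate E T c f) := by
  ext k : 1
  rw [translate_apply, star_apply, star_apply, translate_apply, star_mul', star_osc]
  congr 2
  ext; simp

theorem translate_translate (c d : ℝ) (f : Wiener (Coef E T)) :
    translate E T c (translate E T d f) = translate E T (c + d) f := by
  ext k : 1
  rw [translate_apply, translate_apply, translate_apply, ← mul_assoc, ← osc_add]
  congr 2
  ext; simp [add_mul]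

theorem translate_const (c : ℝ) (r : Coef E T) : translate E T c (const r) = const r := by
  ext k : 1
  rw [translate_apply, const_def, single_apply]
  split_ifs with h
  · rw [h]
    have : (fun _ : E => c * ((0 : ℤ) : ℝ)) = 0 := by ext; simp
    rw [this, osc_zero, one_mul]
  · rw [mul_zero]

theorem RapidDecay.translate {f : Wiener (Coef E T)} (hf : RapidDecay f) (c : ℝ) :
    RapidDecay (translate E T c f) :=
  hf.of_le (C := 1) (p := 0) fun k => by
    rw [translate_apply, pow_zero, mul_one]
    exact (norm_mul_le _ _).trans (by gcongr; exact norm_osc_le _)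

/-- The initial value, as a ring homomorphism. -/
noncomputable def iniRing (E : Type*) [TopologicalSpace E] [DiscreteTopology E] (T : ℝ)
    [Fact (0 < T)] : Wiener (Coef E T) →+* Wiener (Coef E T) :=
  mapRing ⟨⟨⟨ini, ext_val fun e t _ => by simp⟩, ini_mul⟩, map_zero ini, map_add ini⟩ norm_ini_le

theorem iniRing_apply (f : Wiener (Coef E T)) (k : ℤ) : iniRing E T f k = ini (f k) := rfl

theorem ini_star (c : Coef E T) : ini (star c) = star (ini c) := ext_val fun e t _ => by simp

theorem iniRing_star (f : Wiener (Coef E T)) : iniRing E T (star f) = star (iniRing E T f) := by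
  ext k : 1
  rw [iniRing_apply, star_apply, star_apply, iniRing_apply, ini_star]

/-- Skew-adjoint linear equations conserve the modulus. -/
theorem star_mul_self_of_mild {σ : ℤ → E → ℝ} (hσ : Represents (fun _ => (0 : Coef E T)) σ)
    {f A v : Wiener (Coef E T)} (h : f = prop σ A + duh σ (v * f)) (hv : star v = -v)
    (hA : iniRing E T A = A) : f * star f = A * star A := by
  have h1 : IsDt f (v * f) := fun k => by
    simpa using evolves_of_mild hσ h k
  have h2 : IsDt (f * star f) 0 := by
    have := h1.mul h1.star
    rw [star_mul, hv] at this
    convert this using 1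
    ring
  have h3 : iniRing E T f = A := by
    rw [← hA]; ext k : 1; exact ini_of_mild h k
  have h4 : f * star f = iniRing E T (f * star f) := by
    ext k : 1
    have := h2 k
    unfold Coef.IsDt at this
    rw [zero_apply, map_zero, add_zero] at this
    exact this
  rw [h4, map_mul, iniRing_star, h3]

theorem star_num (z : ℂ) : star (num E T z) = num E T (conj z) := ext_val fun e t _ => by simp

theorem num_neg (z : ℂ) : num E T (-z) = -num E T z := ext_val fun e t _ => by simp

/-- One of the two equations of the limit system, for a given modulus of the other function. -/
theorem exists_limit (lam : ℝ) (c : ℝ) (A B : Wiener (Coef E T)) (hA : iniRing E T A = A)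
    (hA' : RapidDecay A) (hB' : RapidDecay B) :
    ∃ α, RapidDecay α ∧ α * star α = translate E T (-c) (A * star A) ∧
      α = prop (disp 0 c) A + duh (disp 0 c) (scal E T (-Complex.I * lam) *
        ((α * star α + (translate E T c (B * star B) + translate E T c (B * star B))) * α)) := by
  -- In the frame moving with velocity `c` the function's own modulus is stationary, and the other
  -- one, moving with velocity `-c`, appears translated by `2 * c`. So `V` is known in advance and
  -- the equation for `f` is linear, with neither advection nor dispersion.
  set V := A * star A + (translate E T (2 * c) (B * star B) + translate E T (2 * c) (B * star B))
    with hV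
  have hVs : star V = V := by
    rw [hV, star_add, star_add, star_mul, star_star, ← translate_star, star_mul, star_star]
  have hVr : RapidDecay V := by
    have := (hB'.mul hB'.star).translate (2 * c)
    exact (hA'.mul hA'.star).add (this.add this)
  set v := scal E T (-Complex.I * lam) * V with hv
  have hvr : RapidDecay v := (RapidDecay.single _ _).mul hVr
  have hvs : star v = -v := by
    rw [hv, star_mul, hVs, star_const, star_num, mul_comm, ← neg_mul, ← map_neg, ← num_neg]
    simp
  obtain ⟨f, hf⟩ := exists_mild_linear (0 : ℤ → E → ℝ) A v
  have hz : Represents (fun _ => (0 : Coef E T)) (0 : ℤ → E → ℝ) := fun k e t => by simp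
  have hff := star_mul_self_of_mild hz hf hvs hA
  have hr : RapidDecay f := rapidDecay_of_mild_linear hf hA' hvr
  refine ⟨translate E T (-c) f, hr.translate _, ?_, ?_⟩
  · rw [← translate_star, ← map_mul, hff]
  · have hg : scal E T (-Complex.I * lam) * ((translate E T (-c) f * star (translate E T (-c) f)
        + (translate E T c (B * star B) + translate E T c (B * star B))) * translate E T (-c) f)
        = translate E T (-c) (v * f) := by
      have e0 : translate E T (-c) V = translate E T (-c) (A * star A)
          + (translate E T c (B * star B) + translate E T c (B * star B)) := by
        rw [hV, map_add, map_add, translate_translate, show -c + 2 * c = c by ring]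
      rw [← translate_star, ← map_mul, hff, ← e0, hv, mul_assoc, map_mul _ (scal _ _ _),
        translate_const, map_mul _ V]
    rw [hg]
    ext k : 1
    have e1 : disp (0 : E → ℝ) c k = fun _ => c * k := by ext e; simp [disp]
    have e2 : (fun _ : E => -c * (k : ℝ)) = -(fun _ => c * k) := by ext; simp
    have hfk : f k = osc T (-(0 : E → ℝ)) * ini (A k) + duhamel 0 ((v * f) k) := by
      conv_lhs => rw [hf]
      rfl
    rw [add_apply, prop_apply, duh_apply, duhamel_apply, translate_apply, translate_apply, e1,
      e2, ← mul_assoc (osc T _) (osc T _), osc_mul_osc_neg, one_mul, hfk, duhamel_apply]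
    have e3 : (-(0 : E → ℝ)) = 0 := neg_zero
    rw [e3, osc_zero]
    ring_nf

theorem iniRing_eq_self_of_dt {A : Wiener (Coef E T)} (hA : IsDt A 0) : iniRing E T A = A := by
  ext k : 1
  have := hA k
  unfold Coef.IsDt at this
  rw [zero_apply, map_zero, add_zero] at this
  exact this.symm

/-- The modulation equations for `a₁, a₋₁` have mild solutions, uniformly in the parameter, if
the dispersion is small enough. -/
theorem exists_mild_modulation (lam κ : ℝ) (z : ℂ) (A B : Wiener (Coef E T))
    (hA : iniRing E T A = A) (hB : iniRing E T B = B) (hA' : RapidDecay A) (hB' : RapidDecay B) :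
    ∃ ε₀ : ℝ, 0 < ε₀ ∧ ε₀ ≤ 1 ∧ ∀ (η : E → ℝ) (H : Coef E T), (∀ e, |η e| ≤ ε₀) → ‖H‖ ≤ ε₀ →
      ∃ a b : Wiener (Coef E T),
        a = prop (disp η κ) A + duh (disp η κ) (forcing lam z (const H) a b) ∧
        b = prop (disp η (-κ)) B + duh (disp η (-κ)) (forcing lam z (const H) b a) := by
  obtain ⟨α, hα, hα2, hα3⟩ := exists_limit lam κ A B hA hA' hB'
  obtain ⟨β, hβ, hβ2, hβ3⟩ := exists_limit lam (-κ) B A hB hB' hA'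
  -- Each equation was solved with the other modulus prescribed by transport. Replacing the
  -- prescribed moduli by the moduli of the solutions found couples the two equations.
  rw [neg_neg] at hβ2
  rw [← hβ2] at hα3
  rw [← hα2] at hβ3
  set M := ‖α‖ + ‖β‖ + 2
  obtain ⟨K, hK, hlip⟩ := (polyLike_forcing (E := E) (T := T) lam z).lip M
  set L := 4 * K + 1
  have hL : 0 < L := by positivity
  set P := ‖quintic lam z α β‖ + ‖quintic lam z β α‖
  -- The dispersion neglected in the limit, `i η k² / 2` on the `k`-th coefficient, is of size `ε₀`
  -- on rapidly decaying elements.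
  have hsq : ∀ f : Wiener (Coef E T), RapidDecay f → ∃ C : ℝ, 0 ≤ C ∧ ∀ ε₀ : ℝ, 0 ≤ ε₀ →
      ∀ η : E → ℝ, (∀ e, |η e| ≤ ε₀) → ∃ d : Wiener (Coef E T), ‖d‖ ≤ ε₀ * C ∧
        ∀ k e t, (d k).val e t = Complex.I * (η e * k ^ 2 / 2) * (f k).val e t := by
    intro f hf
    refine ⟨∑' k : ℤ, (1 + |(k : ℝ)|) ^ 2 * ‖f k‖, tsum_nonneg fun k => by positivity,
      fun ε₀ hε₀ η hη => ?_⟩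
    have hb : ∀ (k : ℤ) (e : E), ‖Complex.I * (η e * k ^ 2 / 2)‖ ≤ ε₀ * (1 + |(k : ℝ)|) ^ 2 := by
      intro k e
      have : (Complex.I * (η e * k ^ 2 / 2) : ℂ) = Complex.I * ((η e * k ^ 2 / 2 : ℝ) : ℂ) := by
        push_cast; ring
      rw [this, norm_mul, Complex.norm_I, one_mul, Complex.norm_real, Real.norm_eq_abs, abs_div,
        abs_mul, abs_pow, abs_two]
      have h2 := abs_nonneg (k : ℝ)
      calc |η e| * |(k : ℝ)| ^ 2 / 2 ≤ ε₀ * |(k : ℝ)| ^ 2 / 2 := by gcongr; exact hη e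
        _ ≤ ε₀ * (1 + |(k : ℝ)|) ^ 2 := by
          nlinarith [mul_nonneg hε₀ h2, mul_nonneg hε₀ (mul_nonneg h2 h2)]
    have hb' : ∀ k : ℤ, ‖cst T (fun e => Complex.I * (η e * (k : ℂ) ^ 2 / 2)) _ (hb k) * f k‖
        ≤ ε₀ * ((1 + |(k : ℝ)|) ^ 2 * ‖f k‖) := fun k => by
      rw [← mul_assoc]
      exact (norm_mul_le _ _).trans (by gcongr; exact norm_cst_le _ (by positivity) _)
    have hs : Summable fun k : ℤ => ‖cst T (fun e => Complex.I * (η e * (k : ℂ) ^ 2 / 2)) _ (hb k)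
        * f k‖ := Summable.of_nonneg_of_le (fun _ => norm_nonneg _) hb' ((hf 2).mul_left ε₀)
    refine ⟨⟨_, hs⟩, ?_, fun k e t => rfl⟩
    rw [norm_def, ← tsum_mul_left]
    exact hs.tsum_le_tsum hb' ((hf 2).mul_left ε₀)
  obtain ⟨Cα, hCα, hdα⟩ := hsq α hα
  obtain ⟨Cβ, hCβ, hdβ⟩ := hsq β hβ
  -- The limit solution misses the full equations by at most `ε₀ * Q`, and `X` is the resulting
  -- displacement per unit of `ε₀`. The choice `1 / (X + 1)` keeps this displacement within the unit
  -- ball on which `M` and `K` control the nonlinearity.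
  set Q := T * (P + Cα + Cβ)
  have hQ : 0 ≤ Q := by have := hT.out; positivity
  set X := Real.exp (L * T) * (2 * Q)
  have hX : 0 ≤ X := by positivity
  refine ⟨1 / (X + 1), by positivity, by rw [div_le_one (by positivity)]; linarith,
    fun η H hη hH => ?_⟩
  set ε₀ := 1 / (X + 1)
  have hε₀ : 0 < ε₀ := by positivity
  have hε₁ : ε₀ ≤ 1 := by rw [div_le_one (by positivity)]; linarith
  have hη1 : ∀ e, |η e| ≤ 1 := fun e => (hη e).trans hε₁
  -- The limit solution solves the dispersive equation exactly with the extra forcing `d`; the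
  -- defect is the Duhamel integral of the correction `const H * q` minus `d`.
  have hres : ∀ (c : ℝ) (f f₀ g : Wiener (Coef E T)) (q : Wiener (Coef E T)) (C : ℝ),
      f = prop (disp 0 c) f₀ + duh (disp 0 c) g →
      (∀ ε₀ : ℝ, 0 ≤ ε₀ → ∀ η : E → ℝ, (∀ e, |η e| ≤ ε₀) →
        ∃ d : Wiener (Coef E T), ‖d‖ ≤ ε₀ * C ∧
        ∀ k e t, (d k).val e t = Complex.I * (η e * k ^ 2 / 2) * (f k).val e t) →
      ‖prop (disp η c) f₀ + duh (disp η c) (g + const H * q) - f‖ ≤ ε₀ * (T * (‖q‖ + C)) := by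
    intro c f f₀ g q C hf hd
    obtain ⟨d, hd1, hd2⟩ := hd ε₀ hε₀.le η hη
    have h0 : Evolves (dispCoef T (η := (0 : E → ℝ)) (by simp) c) f g :=
      evolves_of_mild (represents_dispCoef _ c) hf
    have h1 : Evolves (dispCoef T hη1 c) f (g + d) := fun k => by
      convert h0 k using 1
      refine ext_val fun e t _ => ?_
      simp only [dispCoef, disp, add_apply, val_sub, val_add, val_mul, val_cst, hd2]
      push_cast
      simp only [Pi.zero_apply]
      push_cast
      ring
    have h2 := mild_of_evolves (represents_dispCoef hη1 c) h1 (ini_of_mild hf)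
    have h3 : prop (disp η c) f₀ + duh (disp η c) (g + const H * q) - f
        = duh (disp η c) (const H * q - d) := by
      conv_lhs => rw [h2]
      rw [add_sub_add_left_eq_sub, ← map_sub]
      congr 1; abel
    rw [h3]
    refine (norm_duh_le _ _).trans ?_
    have h4 : ‖const H * q - d‖ ≤ ε₀ * ‖q‖ + ε₀ * C := by
      refine (norm_sub_le _ _).trans (add_le_add ((norm_mul_le _ _).trans ?_) hd1)
      rw [norm_const]
      gcongr
    have := hT.out.le
    calc _ ≤ T * (ε₀ * ‖q‖ + ε₀ * C) := by gcongr
      _ = _ := by ring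
  have hrα := hres κ α A (crossCubic lam α β) (quintic lam z α β) Cα hα3 hdα
  have hrβ := hres (-κ) β B (crossCubic lam β α) (quintic lam z β α) Cβ hβ3 hdβ
  obtain ⟨⟨a, b⟩, hab, -⟩ := exists_fixedPoint_near
    (X := Wiener (Coef E T) × Wiener (Coef E T))
    (fun x => lnorm L x.1 + lnorm L x.2) (Real.exp (L * T)) (by positivity)
    (fun x => by
      rw [Prod.norm_def, mul_add]
      have h1 := norm_le_lnorm hL.le x.1
      have h2 := norm_le_lnorm hL.le x.2
      have := mul_nonneg (Real.exp_pos (L * T)).le (lnorm_nonneg L x.1)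
      have := mul_nonneg (Real.exp_pos (L * T)).le (lnorm_nonneg L x.2)
      exact max_le (by linarith) (by linarith))
    (fun x => by
      have h1 := (lnorm_le hL.le x.1).trans (norm_fst_le x)
      have h2 := (lnorm_le hL.le x.2).trans (norm_snd_le x)
      linarith)
    (fun x y => by
      have h1 := lnorm_add_le L x.1 y.1
      have h2 := lnorm_add_le L x.2 y.2
      simp only [Prod.fst_add, Prod.snd_add]
      linarith)
    (fun x => (prop (disp η κ) A + duh (disp η κ) (forcing lam z (const H) x.1 x.2),
      prop (disp η (-κ)) B + duh (disp η (-κ)) (forcing lam z (const H) x.2 x.1)))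
    (α, β) (ρ := 1) (δ := ε₀ * Q) (fun x y hx hy => by
      have bd : ∀ x : Wiener (Coef E T) × Wiener (Coef E T), ‖x - (α, β)‖ ≤ 1 →
          ‖x.1‖ ≤ M ∧ ‖x.2‖ ≤ M := fun x hx => by
        have h1 := (norm_fst_le (x - (α, β))).trans hx
        have h2 := (norm_snd_le (x - (α, β))).trans hx
        have h3 := norm_le_norm_add_norm_sub' x.1 α
        have h4 := norm_le_norm_add_norm_sub' x.2 β
        simp only [Prod.fst_sub, Prod.snd_sub] at h1 h2
        have := norm_nonneg α
        have := norm_nonneg β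
        exact ⟨by simp only [M]; linarith, by simp only [M]; linarith⟩
      have hHM : ‖(const H : Wiener (Coef E T))‖ ≤ M := by
        rw [norm_const]
        have := norm_nonneg α
        have := norm_nonneg β
        simp only [M]; linarith
      have l1 := hlip L _ _ _ _ _ _ hHM (bd x hx).1 (bd x hx).2 hHM (bd y hy).1 (bd y hy).2
      have l2 := hlip L _ _ _ _ _ _ hHM (bd x hx).2 (bd x hx).1 hHM (bd y hy).2 (bd y hy).1
      have hz : lnorm L (const H - const H : Wiener (Coef E T)) = 0 := by simp [lnorm]
      rw [hz, zero_add] at l1 l2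
      simp only [Prod.fst_sub, Prod.snd_sub, add_sub_add_left_eq_sub, ← map_sub]
      have m1 := lnorm_duh_le (disp η κ)
        (forcing lam z (const H) x.1 x.2 - forcing lam z (const H) y.1 y.2) hL
      have m2 := lnorm_duh_le (disp η (-κ))
        (forcing lam z (const H) x.2 x.1 - forcing lam z (const H) y.2 y.1) hL
      have h2 : L⁻¹ * (2 * K) ≤ 1 / 2 := by
        rw [inv_mul_le_iff₀ hL]; simp only [L]; linarith
      have h3 := lnorm_nonneg L (x.1 - y.1)
      have h4 := lnorm_nonneg L (x.2 - y.2)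
      have hLi : 0 ≤ L⁻¹ := by positivity
      have m3 := mul_le_mul_of_nonneg_left l1 hLi
      have m4 := mul_le_mul_of_nonneg_left l2 hLi
      have m5 := mul_le_mul_of_nonneg_right h2 (add_nonneg h3 h4)
      linarith)
    (by
      have h1 := lnorm_le hL.le (prop (disp η κ) A
        + duh (disp η κ) (forcing lam z (const H) α β) - α)
      have h2 := lnorm_le hL.le (prop (disp η (-κ)) B
        + duh (disp η (-κ)) (forcing lam z (const H) β α) - β)
      have h3 := h1.trans hrα
      have h4 := h2.trans hrβ
      simp only [Prod.fst_sub, Prod.snd_sub]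
      simp only [Q, P]
      linarith)
    (by positivity) (by
      have h1 : ε₀ * X ≤ 1 := by
        rw [div_mul_eq_mul_div, one_mul, div_le_one (by positivity)]; linarith
      calc _ = ε₀ * X := by simp only [X]; ring
        _ ≤ 1 := h1)
  rw [Prod.mk.injEq] at hab
  exact ⟨a, b, hab.1.symm, hab.2.symm⟩

/-- Smoothness of mild solutions of the modulation equations. -/
theorem smooth_of_mild_modulation {lam κ : ℝ} {z : ℂ} {A B a b : Wiener (Coef E T)} {η : E → ℝ}
    (hη : ∀ e, |η e| ≤ 1) {H : Coef E T} (hH : Coef.IsDt H 0) (hA : RapidDecay A)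
    (hB : RapidDecay B)
    (ha : a = prop (disp η κ) A + duh (disp η κ) (forcing lam z (const H) a b))
    (hb : b = prop (disp η (-κ)) B + duh (disp η (-κ)) (forcing lam z (const H) b a)) (j : ℕ) :
    Smooth j a ∧ Smooth j b := by
  have hF := polyLike_forcing (E := E) (T := T) lam z
  have hr : ∀ i : Fin 2, RapidDecay (![a, b] i) := rapidDecay_of_mild
    ![disp η κ, disp η (-κ)] ![a, b] ![A, B]
    ![forcing lam z (const H) a b, forcing lam z (const H) b a]
    (by intro i; fin_cases i; exacts [ha, hb]) (by intro i; fin_cases i; exacts [hA, hB])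
    (fun m => by
      obtain ⟨K, hK, h⟩ := hF.tame (max ‖H‖ (max ‖a‖ ‖b‖)) m
      have h1 : ‖(const H : Wiener (Coef E T))‖ ≤ max ‖H‖ (max ‖a‖ ‖b‖) := by
        rw [norm_const]; exact le_max_left _ _
      have h2 : ‖a‖ ≤ max ‖H‖ (max ‖a‖ ‖b‖) := (le_max_left _ _).trans (le_max_right _ _)
      have h3 : ‖b‖ ≤ max ‖H‖ (max ‖a‖ ‖b‖) := (le_max_right _ _).trans (le_max_right _ _)
      -- The variable `const H` is supported at index `0`, where all weights are `1`; it contributes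
      -- only a constant.
      refine ⟨K, K * ‖H‖, hK, by positivity, fun N L hL i => ?_⟩
      have h4 : lwnorm L m N (const H : Wiener (Coef E T)) ≤ ‖H‖ :=
        (lwnorm_le hL m N _).trans (wnorm_const m N H).le
      have h5 := mul_le_mul_of_nonneg_left h4 hK
      rw [Fin.sum_univ_two]
      fin_cases i
      · have := h N L _ _ _ h1 h2 h3
        simp only [Fin.zero_eta, Fin.isValue, Matrix.cons_val_zero, Matrix.cons_val_one]
        linarith
      · have := h N L _ _ _ h1 h3 h2
        simp only [Fin.mk_one, Fin.isValue, Matrix.cons_val_zero, Matrix.cons_val_one]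
        linarith)
  have hs : ∀ i : Fin 2, Smooth j (![a, b] i) := smooth_of_evolves
    ![dispCoef T hη κ, dispCoef T hη (-κ)] (C := |κ| + 1) (p := 2)
    (by
      intro i k
      fin_cases i
      · exact norm_dispCoef_le hη κ k
      · simpa using norm_dispCoef_le (T := T) hη (-κ) k)
    (by intro i k; fin_cases i; exacts [isDt_dispCoef hη κ k, isDt_dispCoef hη (-κ) k])
    (g := ![forcing lam z (const H) a b, forcing lam z (const H) b a])
    (by
      intro i
      fin_cases i
      exacts [evolves_of_mild (represents_dispCoef hη κ) ha,
        evolves_of_mild (represents_dispCoef hη (-κ)) hb]) hr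
    (by
      intro j h i
      have h1 := smooth_const hH j
      fin_cases i
      exacts [hF.smooth j _ _ _ h1 (h 0) (h 1), hF.smooth j _ _ _ h1 (h 1) (h 0)]) j
  exact ⟨hs 0, hs 1⟩

/-- Linear equations with smooth coefficients have smooth solutions. -/
theorem exists_smooth_linear {η : E → ℝ} (hη : ∀ e, |η e| ≤ 1) (c : ℝ)
    {f₀ V : Wiener (Coef E T)} (h₀ : RapidDecay f₀) (hV : ∀ j, Smooth j V) :
    ∃ f, (∀ j, Smooth j f) ∧ f = prop (disp η c) f₀ + duh (disp η c) (V * f) := by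
  obtain ⟨f, hf⟩ := exists_mild_linear (disp η c) f₀ V
  have hr := rapidDecay_of_mild_linear hf h₀ (hV 0)
  refine ⟨f, fun j => ?_, hf⟩
  exact smooth_of_evolves (ι := Unit) (fun _ => dispCoef T hη c)
    (fun _ => norm_dispCoef_le hη c) (fun _ => isDt_dispCoef hη c) (f := fun _ => f)
    (g := fun _ => V * f) (fun _ => evolves_of_mild (represents_dispCoef hη c) hf) (fun _ => hr)
    (fun j h _ => (hV j).mul (h ())) j ()

end Wiener

/-! ### From the algebra to functions of `t` and `x`. -/

namespace Wiener

open Coef TwoPhaseMFE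

variable {E : Type*} [TopologicalSpace E] {T : ℝ} [hT : Fact (0 < T)]

/-- The point evaluation `Coef E T → ℂ`. -/
noncomputable def valHom (e : E) (t : ℝ) : Coef E T →+* ℂ where
  toFun c := c.val e t
  map_one' := val_one e t
  map_mul' c d := val_mul c d e t
  map_zero' := val_zero e t
  map_add' c d := val_add c d e t

theorem val_tsum {f : ℤ → Coef E T} (hf : Summable f) (e : E) (t : ℝ) :
    (∑' k, f k).val e t = ∑' k, (f k).val e t :=
  hf.map_tsum (valHom e t) (AddMonoidHomClass.continuous_of_bound (valHom e t) 1 fun c => by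
    rw [one_mul]; exact c.norm_val_le e t)

/-- The character `e ^ (i k x)`. -/
noncomputable def char (k : ℤ) (x : ℝ) : ℂ := Complex.exp ((k * x : ℝ) * Complex.I)

theorem norm_char (k : ℤ) (x : ℝ) : ‖char k x‖ = 1 := Complex.norm_exp_ofReal_mul_I _

theorem char_add (j k : ℤ) (x : ℝ) : char (j + k) x = char j x * char k x := by
  rw [char, char, char, ← Complex.exp_add]
  push_cast
  ring_nf

theorem char_zero (x : ℝ) : char 0 x = 1 := by simp [char]

theorem conj_char (k : ℤ) (x : ℝ) : conj (char k x) = char (-k) x := by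
  rw [char, char, ← Complex.exp_conj]; simp

theorem hasDerivAt_char (k : ℤ) (x : ℝ) : HasDerivAt (char k) (Complex.I * k * char k x) x := by
  have h2 : HasDerivAt (fun x : ℝ => ((k * x : ℝ) : ℂ) * Complex.I) (k * Complex.I) x := by
    have := (((hasDerivAt_id x).const_mul (k : ℝ)).ofReal_comp).mul_const Complex.I
    simpa using this
  refine (h2.cexp).congr_deriv ?_
  rw [char]
  ring

theorem continuous_char (k : ℤ) : Continuous (char k) := by
  unfold char; fun_prop

theorem periodic_char (k : ℤ) : Function.Periodic (char k) (2 * Real.pi) := by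
  intro x
  have : ((k * (x + 2 * Real.pi) : ℝ) : ℂ) * Complex.I
      = ((k * x : ℝ) : ℂ) * Complex.I + k * (2 * Real.pi * Complex.I) := by
    push_cast; ring
  rw [char, this, Complex.exp_add, Complex.exp_int_mul_two_pi_mul_I, mul_one, char]

/-- The function `∑ f_k(t) e ^ (i k x)` defined by `f` at the parameter `e`. -/
noncomputable def ev (f : Wiener (Coef E T)) (e : E) (t x : ℝ) : ℂ :=
  ∑' k, (f k).val e t * char k x

theorem norm_ev_term_le (f : Wiener (Coef E T)) (e : E) (t x : ℝ) (k : ℤ) :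
    ‖(f k).val e t * char k x‖ ≤ ‖f k‖ := by
  rw [norm_mul, norm_char, mul_one]; exact (f k).norm_val_le e t

theorem summable_norm_ev (f : Wiener (Coef E T)) (e : E) (t x : ℝ) :
    Summable fun k => ‖(f k).val e t * char k x‖ :=
  Summable.of_nonneg_of_le (fun _ => norm_nonneg _) (norm_ev_term_le f e t x) f.summable_norm

theorem summable_ev (f : Wiener (Coef E T)) (e : E) (t x : ℝ) :
    Summable fun k => (f k).val e t * char k x := (summable_norm_ev f e t x).of_norm

theorem norm_ev_le (f : Wiener (Coef E T)) (e : E) (t x : ℝ) : ‖ev f e t x‖ ≤ ‖f‖ := by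
  rw [norm_def]
  exact (norm_tsum_le_tsum_norm (summable_norm_ev f e t x)).trans
    ((summable_norm_ev f e t x).tsum_le_tsum (norm_ev_term_le f e t x) f.summable_norm)

theorem ev_add (f g : Wiener (Coef E T)) (e : E) (t x : ℝ) :
    ev (f + g) e t x = ev f e t x + ev g e t x := by
  unfold ev
  rw [← (summable_ev f e t x).tsum_add (summable_ev g e t x)]
  simp only [add_apply, val_add, add_mul]

theorem ev_sub (f g : Wiener (Coef E T)) (e : E) (t x : ℝ) :
    ev (f - g) e t x = ev f e t x - ev g e t x := by
  unfold ev
  rw [← (summable_ev f e t x).tsum_sub (summable_ev g e t x)]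
  simp only [sub_apply, val_sub, sub_mul]

theorem ev_neg (f : Wiener (Coef E T)) (e : E) (t x : ℝ) : ev (-f) e t x = -ev f e t x := by
  unfold ev
  rw [← tsum_neg]
  simp only [neg_apply, val_neg, neg_mul]

theorem ev_star (f : Wiener (Coef E T)) (e : E) (t x : ℝ) :
    ev (star f) e t x = conj (ev f e t x) := by
  unfold ev
  rw [Complex.conj_tsum, ← (Equiv.neg ℤ).tsum_eq]
  simp [conj_char]

theorem ev_single (n : ℤ) (r : Coef E T) (e : E) (t x : ℝ) :
    ev (single n r) e t x = r.val e t * char n x := by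
  unfold ev
  rw [tsum_eq_single n]
  · simp [single_apply]
  · intro m hm; simp [single_apply, hm]

theorem ev_const (r : Coef E T) (e : E) (t x : ℝ) : ev (const r) e t x = r.val e t := by
  rw [const_def, ev_single, char_zero, mul_one]

/-- Absolute convergence allows the product of the two series to be summed along the lines of
constant total index, where the characters multiply. -/
theorem ev_mul (f g : Wiener (Coef E T)) (e : E) (t x : ℝ) :
    ev (f * g) e t x = ev f e t x * ev g e t x := by
  have hf := summable_norm_ev f e t x
  have hg := summable_norm_ev g e t x
  set u := fun k => (f k).val e t * char k x with hu
  set v := fun k => (g k).val e t * char k x with hv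
  have hs : Summable fun p : ℤ × ℤ => u p.1 * v (p.2 - p.1) :=
    Summable.of_norm_bounded (summable_shear hf hg (fun _ => norm_nonneg _)
      (fun _ => norm_nonneg _)) fun p => norm_mul_le _ _
  unfold ev
  change _ = (∑' k, u k) * ∑' k, v k
  rw [tsum_mul_tsum_of_summable_norm hf hg, ← shear.tsum_eq, ← (Equiv.prodComm ℤ ℤ).tsum_eq]
  refine Eq.trans ?_ ((hs.prod_symm).tsum_prod' fun n => hs.prod_symm.prod_factor n).symm
  congr 1; ext1 n
  rw [mul_apply, val_tsum (summable_mul_apply f g n), ← tsum_mul_right]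
  congr 1; ext1 m
  simp only [Prod.swap_prod_mk, hu, hv, val_mul]
  rw [show char n x = char m x * char (n - m) x by rw [← char_add]; congr 1; ring]
  ring

theorem periodic_ev (f : Wiener (Coef E T)) (e : E) (t : ℝ) :
    Function.Periodic (ev f e t) (2 * Real.pi) := by
  intro x
  unfold ev
  congr 1; ext1 k
  rw [periodic_char k x]

theorem continuous_ev (f : Wiener (Coef E T)) (e : E) :
    Continuous fun p : ℝ × ℝ => ev f e p.1 p.2 :=
  continuous_tsum (fun k => (((f k).continuous_val e).comp continuous_fst).mul
    ((continuous_char k).comp continuous_snd)) f.summable_norm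
    fun k p => norm_ev_term_le f e p.1 p.2 k

variable [DiscreteTopology E]

/-- The derivative with respect to `x`: `h_k = i k f_k`. -/
def IsDx (f h : Wiener (Coef E T)) : Prop := ∀ k : ℤ, h k = num E T (Complex.I * k) * f k

theorem Smooth.exists_isDx {j : ℕ} {f : Wiener (Coef E T)} (hf : Smooth j f) :
    ∃ h, Smooth j h ∧ IsDx f h :=
  hf.exists_multiplier (s := fun k => num E T (Complex.I * k)) (C := 1) (p := 1)
    (fun k => (norm_num_le _).trans (by simp)) fun _ => isDt_num _

/-- The linear map `(t, x) ↦ c t`. -/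
noncomputable def fstL : ℂ →L[ℝ] (ℝ × ℝ →L[ℝ] ℂ) :=
  ContinuousLinearMap.smulRightL ℝ (ℝ × ℝ) ℂ (ContinuousLinearMap.fst ℝ ℝ ℝ)

/-- The linear map `(t, x) ↦ c x`. -/
noncomputable def sndL : ℂ →L[ℝ] (ℝ × ℝ →L[ℝ] ℂ) :=
  ContinuousLinearMap.smulRightL ℝ (ℝ × ℝ) ℂ (ContinuousLinearMap.snd ℝ ℝ ℝ)

@[simp] theorem fstL_apply (c : ℂ) (p : ℝ × ℝ) : fstL c p = p.1 • c := rfl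
@[simp] theorem sndL_apply (c : ℂ) (p : ℝ × ℝ) : sndL c p = p.2 • c := rfl

theorem norm_fstL_apply_le (c : ℂ) : ‖fstL c‖ ≤ ‖c‖ :=
  ContinuousLinearMap.opNorm_le_bound _ (norm_nonneg _) fun p => by
    rw [fstL_apply, norm_smul, mul_comm]; gcongr; exact norm_fst_le p

theorem norm_sndL_apply_le (c : ℂ) : ‖sndL c‖ ≤ ‖c‖ :=
  ContinuousLinearMap.opNorm_le_bound _ (norm_nonneg _) fun p => by
    rw [sndL_apply, norm_smul, mul_comm]; gcongr; exact norm_snd_le p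

omit [DiscreteTopology E] in
theorem uniqueDiffOn_strip : UniqueDiffOn ℝ (strip T) :=
  (uniqueDiffOn_Icc hT.out).prod uniqueDiffOn_univ

theorem hasFDerivWithinAt_ev {f g h : Wiener (Coef E T)} (hg : IsDt f g) (hh : IsDx f h)
    (hgr : RapidDecay g) (e : E) {p : ℝ × ℝ} (hp : p ∈ strip T) :
    HasFDerivWithinAt (fun p : ℝ × ℝ => ev f e p.1 p.2)
      (fstL (ev g e p.1 p.2) + sndL (ev h e p.1 p.2)) (strip T) p := by
  -- Termwise differentiation is available on open sets, whereas `val` is constant outside `[0, T]`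
  -- and may have corners at the end points. The primitives `φ k` extend the coefficients
  -- differentiably to a neighbourhood of the strip. The decay of `g` controls their growth there
  -- against the factor `k` from the space derivative.
  set φ : ℤ → ℝ → ℂ := fun k t => (f k).val e 0 + ∫ s in (0 : ℝ)..t, (g k).val e s with hφ
  have hφd : ∀ k t, HasDerivAt (φ k) ((g k).val e t) t := fun k t =>
    (intervalIntegral.integral_hasDerivAt_right (((g k).continuous_val e).intervalIntegrable _ _)
      (((g k).continuous_val e).stronglyMeasurableAtFilter _ _)
      ((g k).continuous_val e).continuousAt).const_add _
  have hφe : ∀ k, ∀ t ∈ Icc 0 T, (f k).val e t = φ k t := fun k t ht => by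
    conv_lhs => rw [show f k = ini (f k) + intg (g k) from hg k]
    rw [val_add, val_ini, val_intg _ e ht]
  set s : Set (ℝ × ℝ) := Ioo (-1) (T + 1) ×ˢ univ
  have hs : strip T ⊆ s := fun p hp => ⟨⟨by linarith [hp.1.1], by linarith [hp.1.2]⟩, trivial⟩
  set F' : ℤ → ℝ × ℝ → (ℝ × ℝ →L[ℝ] ℂ) := fun k p =>
    fstL ((g k).val e p.1 * char k p.2) + sndL (φ k p.1 * (Complex.I * k * char k p.2))
  have hF : ∀ k p, HasFDerivAt (fun p : ℝ × ℝ => φ k p.1 * char k p.2) (F' k p) p := by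
    intro k p
    have h1 : HasFDerivAt (fun p : ℝ × ℝ => φ k p.1) (fstL ((g k).val e p.1)) p := by
      refine ((hφd k p.1).hasFDerivAt.comp p hasFDerivAt_fst).congr_fderiv ?_
      ext <;> simp
    have h2 : HasFDerivAt (fun p : ℝ × ℝ => char k p.2)
        (sndL (Complex.I * k * char k p.2)) p := by
      refine ((hasDerivAt_char k p.2).hasFDerivAt.comp p hasFDerivAt_snd).congr_fderiv ?_
      ext <;> simp
    refine (h1.mul h2).congr_fderiv ?_
    ext <;> simp [F', mul_comm]
  have hu : Summable fun k : ℤ => ‖g k‖ + (‖h k‖ + (T + 1) * (|(k : ℝ)| * ‖g k‖)) := by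
    refine g.summable_norm.add (h.summable_norm.add ?_)
    refine Summable.mul_left _ (Summable.of_nonneg_of_le (fun _ => by positivity) (fun k => ?_)
      (hgr 1))
    rw [pow_one]
    gcongr
    linarith
  have hF' : ∀ k, ∀ p ∈ s, ‖F' k p‖ ≤ ‖g k‖ + (‖h k‖ + (T + 1) * (|(k : ℝ)| * ‖g k‖)) := by
    intro k p hp
    refine (norm_add_le _ _).trans (add_le_add ((norm_fstL_apply_le _).trans
      (norm_ev_term_le g e _ _ k)) ((norm_sndL_apply_le _).trans ?_))
    have hk : |(k : ℝ)| * ‖(f k).val e 0‖ ≤ ‖h k‖ := by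
      have := (h k).norm_val_le e 0
      rw [hh k, val_mul, val_num, norm_mul, norm_mul, Complex.norm_I, one_mul] at this
      rw [hh k]
      simpa using this
    have hi : ‖∫ s in (0 : ℝ)..p.1, (g k).val e s‖ ≤ (T + 1) * ‖g k‖ := by
      have := intervalIntegral.norm_integral_le_of_norm_le_const (a := 0) (b := p.1)
        (f := (g k).val e) (C := ‖g k‖) fun s _ => (g k).norm_val_le e s
      rw [sub_zero] at this
      refine this.trans ?_
      rw [mul_comm]
      gcongr
      rw [abs_le]
      exact ⟨by linarith [hp.1.1, hT.out], hp.1.2.le⟩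
    have hc : ‖Complex.I * k * char k p.2‖ = |(k : ℝ)| := by
      rw [norm_mul, norm_char, norm_mul, Complex.norm_I]; simp
    rw [norm_mul, hc]
    have h3 : ‖φ k p.1‖ ≤ ‖(f k).val e 0‖ + (T + 1) * ‖g k‖ :=
      (norm_add_le _ _).trans (by gcongr)
    calc _ ≤ (‖(f k).val e 0‖ + (T + 1) * ‖g k‖) * |(k : ℝ)| := by gcongr
      _ = |(k : ℝ)| * ‖(f k).val e 0‖ + (T + 1) * (|(k : ℝ)| * ‖g k‖) := by ring
      _ ≤ _ := by gcongr
  have hev : ∀ p ∈ strip T, ev f e p.1 p.2 = ∑' k, φ k p.1 * char k p.2 := fun p hp => by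
    unfold ev
    congr 1; ext1 k
    rw [hφe k p.1 hp.1]
  have hsum : Summable fun k => φ k p.1 * char k p.2 := by
    have := summable_ev f e p.1 p.2
    simpa only [hφe _ p.1 hp.1] using this
  have key := hasFDerivAt_tsum_of_isPreconnected hu (isOpen_Ioo.prod isOpen_univ)
    ((convex_Ioo (-1) (T + 1)).prod convex_univ).isPreconnected (fun k p _ => hF k p) hF' (hs hp)
    hsum (hs hp)
  have hder : ∑' k, F' k p = fstL (ev g e p.1 p.2) + sndL (ev h e p.1 p.2) := by
    have e1 := summable_ev g e p.1 p.2
    have e2 := summable_ev h e p.1 p.2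
    unfold ev
    rw [fstL.map_tsum e1, sndL.map_tsum e2]
    refine Eq.trans ?_ ((e1.map fstL fstL.continuous).tsum_add (e2.map sndL sndL.continuous))
    congr 1; ext1 k
    simp only [F', Function.comp_apply]
    congr 2
    rw [hh k, val_mul, val_num, ← hφe k p.1 hp.1]
    ring
  rw [hder] at key
  exact key.hasFDerivWithinAt.congr hev (hev p hp)

/-- Smooth elements of the algebra define smooth functions, with bounds uniform in the
parameter. -/
theorem contDiffOn_ev (n : ℕ) {f : Wiener (Coef E T)} (hf : Smooth n f) :
    ∃ B : ℝ, ∀ e, ContDiffOn ℝ n (fun p : ℝ × ℝ => ev f e p.1 p.2) (strip T) ∧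
      ∀ p ∈ strip T,
        ‖iteratedFDerivWithin ℝ n (fun p : ℝ × ℝ => ev f e p.1 p.2) (strip T) p‖ ≤ B := by
  have hu : UniqueDiffOn ℝ (strip T) := uniqueDiffOn_strip
  induction n generalizing f with
  | zero =>
    refine ⟨‖f‖, fun e => ⟨?_, fun p hp => ?_⟩⟩
    · exact contDiffOn_zero.mpr (continuous_ev f e).continuousOn
    · rw [norm_iteratedFDerivWithin_zero]; exact norm_ev_le f e _ _
  | succ n ih =>
    -- The order of `Smooth` counts time derivatives only: the space derivative `h` keeps order `n`,
    -- and so does the time derivative `g` of an element of order `n + 1`.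
    obtain ⟨h, hh, hx⟩ := hf.of_succ.exists_isDx
    obtain ⟨-, g, hg, hg'⟩ := hf
    obtain ⟨B₁, h₁⟩ := ih hg'
    obtain ⟨B₂, h₂⟩ := ih hh
    refine ⟨‖fstL‖ * B₁ + ‖sndL‖ * B₂, fun e => ?_⟩
    have hd := fun p (hp : p ∈ strip T) => hasFDerivWithinAt_ev hg hx hg'.rapidDecay e hp
    have c1 := fstL.contDiff.comp_contDiffOn (h₁ e).1
    have c2 := sndL.contDiff.comp_contDiffOn (h₂ e).1
    constructor
    · push_cast
      rw [contDiffOn_succ_iff_hasFDerivWithinAt_of_uniqueDiffOn hu]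
      exact ⟨fun h => by simp at h, _, c1.add c2, hd⟩
    · intro p hp
      rw [← norm_iteratedFDerivWithin_fderivWithin hu hp,
        iteratedFDerivWithin_congr (f := (fstL ∘ fun p : ℝ × ℝ => ev g e p.1 p.2)
          + (sndL ∘ fun p : ℝ × ℝ => ev h e p.1 p.2))
          (fun p hp => (hd p hp).fderivWithin (hu p hp)) hp,
        iteratedFDerivWithin_add_apply (c1 p hp) (c2 p hp) hu hp]
      refine (norm_add_le _ _).trans (add_le_add ?_ ?_)
      · refine (ContinuousLinearMap.norm_iteratedFDerivWithin_comp_left fstL ((h₁ e).1 p hp) hu hp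
          le_rfl).trans ?_
        gcongr
        exact (h₁ e).2 p hp
      · refine (ContinuousLinearMap.norm_iteratedFDerivWithin_comp_left sndL ((h₂ e).1 p hp) hu hp
          le_rfl).trans ?_
        gcongr
        exact (h₂ e).2 p hp

theorem exists_smoothWithBounds {f : Wiener (Coef E T)} (hf : ∀ j, Smooth j f) :
    ∃ B : ℕ → ℝ, ∀ e, SmoothWithBounds T B (ev f e) := by
  choose B hB using fun n => contDiffOn_ev n (hf n)
  exact ⟨B, fun e => ⟨contDiffOn_infty.mpr fun n => (hB n e).1, fun n => (hB n e).2⟩⟩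

theorem hasDerivWithinAt_ev_time {f g : Wiener (Coef E T)} (hg : IsDt f g) (hfr : RapidDecay f)
    (hgr : RapidDecay g) (e : E) {t : ℝ} (ht : t ∈ Icc 0 T) (x : ℝ) :
    HasDerivWithinAt (fun s => ev f e s x) (ev g e t x) (Icc 0 T) t := by
  obtain ⟨h, -, hx⟩ := Smooth.exists_isDx (j := 0) hfr
  have h1 := hasFDerivWithinAt_ev hg hx hgr e (p := (t, x)) ⟨ht, trivial⟩
  have h2 := h1.comp_hasDerivWithinAt t (f := fun s => (s, x)) (s := Icc 0 T)
    (((hasDerivAt_id t).prodMk (hasDerivAt_const t x)).hasDerivWithinAt)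
    (fun s hs => ⟨hs, trivial⟩)
  simpa [Function.comp_def] using h2

theorem hasDerivAt_ev_space {f h : Wiener (Coef E T)} (hx : IsDx f h) (e : E) (t x : ℝ) :
    HasDerivAt (ev f e t) (ev h e t x) x := by
  refine (hasDerivAt_tsum h.summable_norm (g := fun k x => (f k).val e t * char k x)
    (fun k y => (hasDerivAt_char k y).const_mul ((f k).val e t)) (fun k y => ?_)
    (summable_ev f e t 0) x).congr_deriv ?_
  · have := norm_ev_term_le h e t y k
    rw [hx k, val_mul, val_num] at this
    rw [hx k]
    calc _ = ‖Complex.I * k * (f k).val e t * char k y‖ := by congr 1; ring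
      _ ≤ _ := this
  · unfold ev
    congr 1; ext1 k
    rw [hx k, val_mul, val_num]
    ring

theorem dt_ev {f g : Wiener (Coef E T)} (hg : IsDt f g) (hfr : RapidDecay f)
    (hgr : RapidDecay g) (e : E) {t : ℝ} (ht : t ∈ Icc 0 T) (x : ℝ) :
    dt T (ev f e) t x = ev g e t x :=
  (hasDerivWithinAt_ev_time hg hfr hgr e ht x).derivWithin (uniqueDiffOn_Icc hT.out t ht)

theorem dx_ev {f h : Wiener (Coef E T)} (hx : IsDx f h) (e : E) (t x : ℝ) :
    dx (ev f e) t x = ev h e t x := (hasDerivAt_ev_space hx e t x).deriv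

theorem dxx_ev {f h q : Wiener (Coef E T)} (hx : IsDx f h) (hq : IsDx h q) (e : E) (t x : ℝ) :
    dxx (ev f e) t x = ev q e t x := by
  have h1 : deriv (ev f e t) = ev h e t := funext fun y => dx_ev hx e t y
  rw [dxx, iteratedDeriv_succ, iteratedDeriv_one, h1]
  exact dx_ev hq e t x

theorem isClassical_ev {f : Wiener (Coef E T)} (hf : ∀ j, Smooth j f) (e : E) :
    IsClassical T (ev f e) := by
  obtain ⟨h, hh, hx⟩ := (hf 0).exists_isDx
  obtain ⟨q, -, hq⟩ := hh.exists_isDx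
  obtain ⟨hfr, g, hg, hgr⟩ := hf 1
  exact {
    periodic := fun t _ => periodic_ev f e t
    differentiable_time := fun t ht x =>
      (hasDerivWithinAt_ev_time hg hfr hgr e ht x).differentiableWithinAt
    contDiff_space := fun t _ => by
      have h1 : ∀ {f h : Wiener (Coef E T)}, IsDx f h → ∀ n : ℕ, ContDiff ℝ n (ev h e t) →
          ContDiff ℝ (n + 1) (ev f e t) := fun {f h} hx n hn => by
        have : deriv (ev f e t) = ev h e t := funext fun y => dx_ev hx e t y
        rw [contDiff_succ_iff_deriv, this]
        exact ⟨fun y => (hasDerivAt_ev_space hx e t y).differentiableAt, by simp, hn⟩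
      have h2 : ContDiff ℝ ((1 : ℕ) + 1) (ev f e t) := h1 hx 1 (by
        have := h1 hq 0 (contDiff_zero.mpr ((continuous_ev q e).comp (Continuous.prodMk_right t)))
        simpa using this)
      norm_num at h2
      exact h2
    continuousOn := (continuous_ev f e).continuousOn
    continuousOn_dt := (continuous_ev g e).continuousOn.congr fun p hp =>
      dt_ev hg hfr hgr e hp.1 p.2
    continuousOn_dx := (continuous_ev h e).continuousOn.congr fun p _ => dx_ev hx e p.1 p.2
    continuousOn_dxx := (continuous_ev q e).continuousOn.congr fun p _ => dxx_ev hx hq e p.1 p.2 }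

theorem solvesAdvected_ev {η : E → ℝ} (hη : ∀ e, |η e| ≤ 1) {c : ℝ} {f g : Wiener (Coef E T)}
    (hf : ∀ j, Smooth j f) (h : Evolves (dispCoef T hη c) f g) (e : E) {F : ℝ → ℝ → ℂ}
    (hF : ∀ t x, F t x = ev g e t x) {f₀ : ℝ → ℂ} (hf₀ : ∀ x, ev f e 0 x = f₀ x) :
    SolvesAdvected (η e) c T F f₀ (ev f e) where
  classical := isClassical_ev hf e
  initial := hf₀
  equation t ht x := by
    obtain ⟨d, hd, hx⟩ := (hf 0).exists_isDx
    obtain ⟨q, -, hq⟩ := hd.exists_isDx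
    obtain ⟨hfr, f', hft, hf'⟩ := hf 1
    have hb : ∀ e, ‖Complex.I * η e / 2‖ ≤ 1 := fun e => by
      have := hη e
      rw [norm_div, norm_mul, Complex.norm_I, Complex.norm_real, Real.norm_eq_abs]
      simp only [one_mul, Complex.norm_ofNat]
      linarith
    have hder : ∀ k, ∀ t ∈ Icc 0 T, (f' k).val e t = (g k).val e t
        - c * (d k).val e t + Complex.I * η e / 2 * (q k).val e t := by
      intro k t ht
      have h1 := isDt_iff.mp (hft k) e t ht
      have h2 := isDt_iff.mp (h k) e t ht
      have h3 := (uniqueDiffOn_Icc hT.out t ht).eq_deriv _ h1 h2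
      rw [h3, val_sub, val_mul, hq k, hx k]
      simp only [dispCoef, val_cst, val_mul, val_num, disp]
      push_cast
      linear_combination (-Complex.I * η e * k ^ 2 / 2 * (f k).val e t) * Complex.I_sq
    rw [dt_ev hft hfr hf' e ht, dx_ev hx, dxx_ev hx hq, hF]
    -- The equation holds for each coefficient on `[0, T]`; summing it against the characters gives
    -- the partial differential equation.
    have h4 : ev f' e t x = ev (g - const (num E T c) * d + const (cst T _ 1 hb) * q) e t x := by
      unfold ev
      congr 1; ext1 k
      rw [hder k t ht, add_apply, sub_apply, const_mul_apply, const_mul_apply]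
      simp
    rw [h4, ev_add, ev_sub, ev_mul, ev_mul, ev_const, ev_const, val_num, val_cst]
    ring

end Wiener

/-! ### Fourier coefficients of uniformly smooth families. -/

namespace Wiener

open Coef TwoPhaseMFE

/-- The Fourier coefficient of a `2π`-periodic function. -/
noncomputable def fcoeff (f : ℝ → ℂ) (n : ℤ) : ℂ :=
  (1 / (2 * Real.pi) : ℝ) • ∫ x in (0 : ℝ)..2 * Real.pi, char (-n) x * f x

theorem norm_fcoeff_le {f : ℝ → ℂ} {B : ℝ} (hB : ∀ x, ‖f x‖ ≤ B) (n : ℤ) : ‖fcoeff f n‖ ≤ B := by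
  have h := intervalIntegral.norm_integral_le_of_norm_le_const (a := 0) (b := 2 * Real.pi)
    (f := fun x => char (-n) x * f x) (C := B) fun x _ => by
      rw [norm_mul, norm_char, one_mul]; exact hB x
  have hp := Real.pi_pos
  rw [sub_zero, abs_of_pos (by positivity)] at h
  rw [fcoeff, norm_smul, Real.norm_eq_abs, abs_of_pos (by positivity)]
  calc _ ≤ 1 / (2 * Real.pi) * (B * (2 * Real.pi)) := by gcongr
    _ = B := by field_simp

theorem fcoeff_deriv {f : ℝ → ℂ} (hf : ContDiff ℝ 1 f) (hp : Function.Periodic f (2 * Real.pi))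
    (n : ℤ) : fcoeff (deriv f) n = Complex.I * n * fcoeff f n := by
  have hd : ∀ x, HasDerivAt (fun x => char (-n) x * f x)
      (char (-n) x * deriv f x - Complex.I * n * (char (-n) x * f x)) x := fun x => by
    refine ((hasDerivAt_char (-n) x).mul
      ((hf.differentiable one_ne_zero) x).hasDerivAt).congr_deriv ?_
    push_cast
    ring
  have hc : Continuous (deriv f) := hf.continuous_deriv le_rfl
  have hcf := hf.continuous
  have hch := continuous_char (-n)
  have h1 : Continuous fun x => char (-n) x * deriv f x := by fun_prop
  have h2 : Continuous fun x => Complex.I * n * (char (-n) x * f x) := by fun_prop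
  have h := intervalIntegral.integral_eq_sub_of_hasDerivAt (a := 0) (b := 2 * Real.pi)
    (fun x _ => hd x) ((h1.sub h2).intervalIntegrable _ _)
  have e1 : char (-n) (2 * Real.pi) = char (-n) 0 := by
    simpa using periodic_char (-n) 0
  have e2 : f (2 * Real.pi) = f 0 := by simpa using hp 0
  rw [intervalIntegral.integral_sub (h1.intervalIntegrable _ _) (h2.intervalIntegrable _ _), e1,
    e2, sub_self, intervalIntegral.integral_const_mul, sub_eq_zero] at h
  rw [fcoeff, fcoeff, h, mul_smul_comm]

theorem periodic_iteratedDeriv {f : ℝ → ℂ} {c : ℝ} (hp : Function.Periodic f c) (m : ℕ) :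
    Function.Periodic (iteratedDeriv m f) c := by
  intro x
  have := iteratedDeriv_comp_add_const m f c
  have h2 : (fun z => f (z + c)) = f := funext hp
  rw [h2] at this
  exact (congrFun this x).symm

theorem fcoeff_iteratedDeriv {f : ℝ → ℂ} (hf : ContDiff ℝ ∞ f)
    (hp : Function.Periodic f (2 * Real.pi)) (m : ℕ) (n : ℤ) :
    fcoeff (iteratedDeriv m f) n = (Complex.I * n) ^ m * fcoeff f n := by
  induction m with
  | zero => simp
  | succ m ih =>
    have h1 : ContDiff ℝ 1 (iteratedDeriv m f) := by
      rw [iteratedDeriv_eq_iterate]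
      exact ContDiff.iterate_deriv' 1 m (contDiff_infty.mp hf (1 + m))
    rw [iteratedDeriv_succ, fcoeff_deriv h1 (periodic_iteratedDeriv hp m), ih]
    ring

theorem norm_fcoeff_decay {f : ℝ → ℂ} (hf : ContDiff ℝ ∞ f)
    (hp : Function.Periodic f (2 * Real.pi)) {B : ℕ → ℝ}
    (hB : ∀ n x, ‖iteratedDeriv n f x‖ ≤ B n) (m : ℕ) (n : ℤ) :
    (1 + |(n : ℝ)|) ^ m * ‖fcoeff f n‖ ≤ 2 ^ m * (B 0 + B m) := by
  have h0 : ‖fcoeff f n‖ ≤ B 0 := norm_fcoeff_le (by simpa using hB 0) n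
  have hm : |(n : ℝ)| ^ m * ‖fcoeff f n‖ ≤ B m := by
    have h := norm_fcoeff_le (hB m) n
    rw [fcoeff_iteratedDeriv hf hp, norm_mul, norm_pow, norm_mul, Complex.norm_I, one_mul] at h
    simpa using h
  have h2 : (1 + |(n : ℝ)|) ^ m ≤ 2 ^ m * (1 + |(n : ℝ)| ^ m) := by
    have hn := abs_nonneg (n : ℝ)
    rcases le_total 1 |(n : ℝ)| with h | h
    · calc (1 + |(n : ℝ)|) ^ m ≤ (2 * |(n : ℝ)|) ^ m := by gcongr; linarith
        _ = 2 ^ m * |(n : ℝ)| ^ m := mul_pow _ _ _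
        _ ≤ _ := by gcongr; linarith
    · calc (1 + |(n : ℝ)|) ^ m ≤ (2 : ℝ) ^ m := by gcongr; linarith
        _ = 2 ^ m * 1 := (mul_one _).symm
        _ ≤ _ := by gcongr; linarith [pow_nonneg hn m]
  calc _ ≤ 2 ^ m * (1 + |(n : ℝ)| ^ m) * ‖fcoeff f n‖ := by gcongr
    _ = 2 ^ m * (‖fcoeff f n‖ + |(n : ℝ)| ^ m * ‖fcoeff f n‖) := by ring
    _ ≤ _ := by gcongr

theorem summable_inv_sq : Summable fun n : ℤ => ((1 + |(n : ℝ)|) ^ 2)⁻¹ := by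
  refine Summable.of_norm_bounded_eventually
    ((Real.summable_one_div_int_pow (p := 2)).mpr one_lt_two) ?_
  filter_upwards [(Set.finite_singleton (0 : ℤ)).compl_mem_cofinite] with n hn
  have hn' : 0 < |(n : ℝ)| := abs_pos.mpr (by exact_mod_cast hn)
  rw [Real.norm_eq_abs, abs_of_pos (by positivity), one_div, ← sq_abs (n : ℝ)]
  gcongr
  linarith

theorem hasSum_fourier {f : ℝ → ℂ} (hf : Continuous f) (hp : Function.Periodic f (2 * Real.pi))
    (hs : Summable fun n => ‖fcoeff f n‖) (x : ℝ) :
    HasSum (fun n => fcoeff f n * char n x) (f x) := by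
  have : Fact (0 < 2 * Real.pi) := ⟨Real.two_pi_pos⟩
  let g : C(AddCircle (2 * Real.pi), ℂ) :=
    ⟨hp.lift, continuous_coinduced_dom.mpr hf⟩
  have hg : ∀ x : ℝ, g x = f x := fun x => hp.lift_coe x
  have hchar : ∀ (n : ℤ) (x : ℝ), fourier n (x : AddCircle (2 * Real.pi)) = char n x := by
    intro n x
    rw [fourier_coe_apply, char]
    congr 1
    have : (Real.pi : ℂ) ≠ 0 := by exact_mod_cast Real.pi_ne_zero
    push_cast
    field_simp
  have hc : ∀ n, fourierCoeff g n = fcoeff f n := by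
    intro n
    rw [fourierCoeff_eq_intervalIntegral g n 0, fcoeff, zero_add]
    congr 1
    refine intervalIntegral.integral_congr fun x _ => ?_
    simp only [smul_eq_mul]
    rw [hchar, hg]
  have hsum : Summable (fourierCoeff g) := by
    refine Summable.of_norm ?_
    simpa only [hc] using hs
  have := has_pointwise_sum_fourier_series_of_summable hsum (x : AddCircle (2 * Real.pi))
  simpa only [hc, hchar, hg, smul_eq_mul] using this

variable {E : Type*} [TopologicalSpace E] [DiscreteTopology E] {T : ℝ} [hT : Fact (0 < T)]

/-- Uniformly smooth families of periodic functions belong to the Wiener algebra. -/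
theorem exists_wiener_of_profile (f : E → ℝ → ℂ) (hf : ∀ e, ContDiff ℝ ∞ (f e))
    (hp : ∀ e, Function.Periodic (f e) (2 * Real.pi)) {B : ℕ → ℝ}
    (hB : ∀ n e x, ‖iteratedDeriv n (f e) x‖ ≤ B n) :
    ∃ A : Wiener (Coef E T), RapidDecay A ∧ IsDt A 0 ∧ ∀ e t x, ev A e t x = f e x := by
  have hB0 : ∀ k e, ‖fcoeff (f e) k‖ ≤ |B 0| := fun k e =>
    (norm_fcoeff_le (by simpa using hB 0 e) k).trans (le_abs_self _)
  set c : ℤ → Coef E T := fun k => cst T (fun e => fcoeff (f e) k) _ (hB0 k) with hc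
  -- Two derivatives beyond the weight are spent on the summable factor `(1 + |k|) ^ (-2)`. The
  -- bounds on derivatives do not depend on `e`, so the supremum over the parameter inside `‖c k‖`
  -- is harmless.
  have hdec : ∀ (m : ℕ) (k : ℤ), (1 + |(k : ℝ)|) ^ m * ‖c k‖
      ≤ (2 ^ (m + 2) * |B 0 + B (m + 2)|) * ((1 + |(k : ℝ)|) ^ 2)⁻¹ := by
    intro m k
    have hpos : (0 : ℝ) < (1 + |(k : ℝ)|) ^ (m + 2) := by positivity
    have h1 : ‖c k‖ ≤ (2 ^ (m + 2) * |B 0 + B (m + 2)|) / (1 + |(k : ℝ)|) ^ (m + 2) := by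
      refine Coef.norm_le (by positivity) fun e t _ => ?_
      rw [hc, val_cst, le_div_iff₀ hpos, mul_comm]
      refine (norm_fcoeff_decay (hf e) (hp e) (fun n x => hB n e x) (m + 2) k).trans ?_
      gcongr
      exact le_abs_self _
    calc _ ≤ (1 + |(k : ℝ)|) ^ m
          * ((2 ^ (m + 2) * |B 0 + B (m + 2)|) / (1 + |(k : ℝ)|) ^ (m + 2)) := by gcongr
      _ = _ := by rw [pow_add _ m 2]; field_simp; ring
  have hs : ∀ m, Summable fun k : ℤ => (1 + |(k : ℝ)|) ^ m * ‖c k‖ := fun m =>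
    Summable.of_nonneg_of_le (fun k => by positivity) (hdec m) (summable_inv_sq.mul_left _)
  have hs0 : Summable fun k : ℤ => ‖c k‖ := by simpa using hs 0
  refine ⟨⟨c, hs0⟩, hs, fun k => isDt_cst _ _ (hB0 k), fun e t x => ?_⟩
  refine (hasSum_fourier (hf e).continuous (hp e) ?_ x).tsum_eq
  exact Summable.of_nonneg_of_le (fun _ => norm_nonneg _)
    (fun k => (show ‖fcoeff (f e) k‖ ≤ ‖c k‖ from (c k).norm_val_le e 0)) hs0

end Wiener

/-! ### Uniqueness of classical solutions by the energy method. -/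

namespace TwoPhaseMFE
open MeasureTheory

theorem IsClassical.sub {T : ℝ} {f g : ℝ → ℝ → ℂ} (hf : IsClassical T f)
    (hg : IsClassical T g) :
    IsClassical T (fun t x => f t x - g t x) ∧
    (∀ t ∈ Icc 0 T, ∀ x, dt T (fun t x => f t x - g t x) t x = dt T f t x - dt T g t x) ∧
    (∀ t ∈ Icc 0 T, ∀ x, dx (fun t x => f t x - g t x) t x = dx f t x - dx g t x) ∧
    (∀ t ∈ Icc 0 T, ∀ x, dxx (fun t x => f t x - g t x) t x = dxx f t x - dxx g t x) := by
  have h1 : ∀ t ∈ Icc 0 T, ∀ x,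
      dt T (fun t x => f t x - g t x) t x = dt T f t x - dt T g t x := fun t ht x =>
    derivWithin_fun_sub (hf.differentiable_time t ht x) (hg.differentiable_time t ht x)
  have h2 : ∀ t ∈ Icc 0 T, ∀ x,
      dx (fun t x => f t x - g t x) t x = dx f t x - dx g t x := fun t ht x =>
    deriv_fun_sub ((hf.contDiff_space t ht).differentiable (by norm_num) x)
      ((hg.contDiff_space t ht).differentiable (by norm_num) x)
  have h3 : ∀ t ∈ Icc 0 T, ∀ x,
      dxx (fun t x => f t x - g t x) t x = dxx f t x - dxx g t x := fun t ht x =>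
    iteratedDeriv_fun_sub (hf.contDiff_space t ht).contDiffAt (hg.contDiff_space t ht).contDiffAt
  refine ⟨⟨fun t ht => (hf.periodic t ht).sub (hg.periodic t ht),
    fun t ht x => (hf.differentiable_time t ht x).sub (hg.differentiable_time t ht x),
    fun t ht => (hf.contDiff_space t ht).sub (hg.contDiff_space t ht),
    hf.continuousOn.sub hg.continuousOn,
    (hf.continuousOn_dt.sub hg.continuousOn_dt).congr fun p hp => h1 p.1 hp.1 p.2,
    (hf.continuousOn_dx.sub hg.continuousOn_dx).congr fun p hp => h2 p.1 hp.1 p.2,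
    (hf.continuousOn_dxx.sub hg.continuousOn_dxx).congr fun p hp => h3 p.1 hp.1 p.2⟩, h1, h2, h3⟩

/-- Truncation of times to the interval `[0, T]`. -/
noncomputable def clamp (T s : ℝ) : ℝ := max 0 (min s T)

theorem clamp_mem {T : ℝ} (hT : 0 < T) (s : ℝ) : clamp T s ∈ Icc 0 T :=
  ⟨le_max_left _ _, max_le hT.le (min_le_right _ _)⟩

theorem clamp_of_mem {T s : ℝ} (hs : s ∈ Icc 0 T) : clamp T s = s := by
  unfold clamp
  rw [min_eq_left hs.2, max_eq_right hs.1]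

theorem continuous_comp_clamp {T : ℝ} (hT : 0 < T) {α : Type*} [TopologicalSpace α]
    {F : ℝ → ℝ → α} (hF : ContinuousOn (fun p : ℝ × ℝ => F p.1 p.2) (strip T)) :
    Continuous (fun p : ℝ × ℝ => F (clamp T p.1) p.2) := by
  have hc : Continuous (fun p : ℝ × ℝ => ((clamp T p.1, p.2) : ℝ × ℝ)) := by
    unfold clamp; fun_prop
  exact hF.comp_continuous hc fun p => ⟨clamp_mem hT _, mem_univ _⟩

theorem IsClassical.continuous_slice {T : ℝ} {f : ℝ → ℝ → ℂ} (hf : IsClassical T f) {t : ℝ}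
    (ht : t ∈ Icc 0 T) : Continuous (f t) := (hf.contDiff_space t ht).continuous

theorem IsClassical.exists_bound {T : ℝ} {f : ℝ → ℝ → ℂ} (hf : IsClassical T f) :
    ∃ M, ∀ t ∈ Icc 0 T, ∀ x, ‖f t x‖ ≤ M := by
  have hc : IsCompact (Icc (0 : ℝ) T ×ˢ Icc (0 : ℝ) (2 * Real.pi)) := isCompact_Icc.prod isCompact_Icc
  obtain ⟨M, hM⟩ := hc.exists_bound_of_continuousOn
    (hf.continuousOn.mono (prod_mono_right (subset_univ _)))
  refine ⟨M, fun t ht x => ?_⟩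
  obtain ⟨y, hy, hxy⟩ := (hf.periodic t ht).exists_mem_Ico₀ Real.two_pi_pos x
  rw [hxy]
  exact hM (t, y) ⟨ht, Ico_subset_Icc_self hy⟩

/-- The advection and the dispersion do not contribute to the energy balance. -/
theorem integral_advection_dispersion_eq_zero {g : ℝ → ℂ} (hg : ContDiff ℝ 2 g)
    (hp : Function.Periodic g (2 * Real.pi)) (c ε : ℝ) :
    ∫ x in (0 : ℝ)..(2 * Real.pi),
      2 * (conj (g x) * (-(c * deriv g x) + Complex.I * ε / 2 * iteratedDeriv 2 g x)).re = 0 := by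
  have hg1 : ContDiff ℝ 1 (deriv g) := ((contDiff_succ_iff_deriv (n := 1)).1 hg).2.2
  have hd0 : ∀ x, HasDerivAt g (deriv g x) x := fun x =>
    (hg.differentiable (by norm_num) x).hasDerivAt
  have hd1 : ∀ x, HasDerivAt (deriv g) (iteratedDeriv 2 g x) x := fun x => by
    rw [iteratedDeriv_succ, iteratedDeriv_one]
    exact (hg1.differentiable (by norm_num) x).hasDerivAt
  have hc2 : Continuous (iteratedDeriv 2 g) := hg.continuous_iteratedDeriv 2 le_rfl
  have hpd : deriv g (2 * Real.pi) = deriv g 0 := by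
    have h : (fun x => g (x + 2 * Real.pi)) = g := funext hp
    have := deriv_comp_add_const g (2 * Real.pi) 0
    rw [h, zero_add] at this
    exact this.symm
  have hp0 : g (2 * Real.pi) = g 0 := by simpa using hp 0
  -- The integrand is the derivative of the real part of this periodic function; the term with
  -- `|g'|²` is purely imaginary and drops out.
  set H : ℝ → ℂ := fun x => -(c * (conj (g x) * g x)) + Complex.I * ε * (conj (g x) * deriv g x)
    with hH
  have hHd : ∀ x, HasDerivAt (fun y => (H y).re)
      (2 * (conj (g x) * (-(c * deriv g x) + Complex.I * ε / 2 * iteratedDeriv 2 g x)).re) x := by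
    intro x
    have hs : HasDerivAt (fun y => conj (g y)) (conj (deriv g x)) x := (hd0 x).star
    have h := ((hs.mul (hd0 x)).const_mul (c : ℂ)).neg.add
      ((hs.mul (hd1 x)).const_mul (Complex.I * ε))
    have h' := Complex.reCLM.hasFDerivAt.comp_hasDerivAt x h
    refine HasDerivAt.congr_deriv h' ?_
    simp only [Complex.reCLM_apply, Complex.add_re, Complex.neg_re, Complex.mul_re, Complex.mul_im,
      Complex.I_re, Complex.I_im, Complex.ofReal_re, Complex.ofReal_im, Complex.conj_re,
      Complex.conj_im, Complex.add_im, Complex.neg_im, Complex.div_ofNat_re, Complex.div_ofNat_im]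
    ring
  rw [intervalIntegral.integral_eq_sub_of_hasDerivAt (fun x _ => hHd x)]
  · simp only [hH, hpd, hp0, sub_self]
  · apply Continuous.intervalIntegrable
    have := hg.continuous
    have := hg1.continuous
    fun_prop

theorem IsClassical.continuous_energy_density {T : ℝ} (hT : 0 < T) {w : ℝ → ℝ → ℂ}
    (hw : IsClassical T w) : Continuous (fun p : ℝ × ℝ =>
      2 * (conj (w (clamp T p.1) p.2) * dt T w (clamp T p.1) p.2).re) :=
  continuous_const.mul (Complex.continuous_re.comp
    ((Complex.continuous_conj.comp (continuous_comp_clamp hT hw.continuousOn)).mul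
      (continuous_comp_clamp hT hw.continuousOn_dt)))

/-- The fundamental theorem in `t` at each fixed `x`, followed by Fubini; no differentiation under
the integral is needed. The truncation `clamp` makes the integrand continuous on the whole plane. -/
theorem IsClassical.integral_sq_eq {T : ℝ} (hT : 0 < T) {w : ℝ → ℝ → ℂ} (hw : IsClassical T w)
    (h0 : ∀ x, w 0 x = 0) {t : ℝ} (ht : t ∈ Icc 0 T) :
    ∫ x in (0 : ℝ)..(2 * Real.pi), ‖w t x‖ ^ 2 = ∫ s in (0 : ℝ)..t,
      ∫ x in (0 : ℝ)..(2 * Real.pi),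
        2 * (conj (w (clamp T s) x) * dt T w (clamp T s) x).re := by
  have hF := hw.continuous_energy_density hT
  rw [intervalIntegral_intervalIntegral_swap (F := fun s x =>
    2 * (conj (w (clamp T s) x) * dt T w (clamp T s) x).re)
    ((hF.continuousOn.integrableOn_compact (isCompact_uIcc.prod isCompact_uIcc)).mono_set
      (prod_mono uIoc_subset_uIcc uIoc_subset_uIcc))]
  · refine intervalIntegral.integral_congr fun x _ => ?_
    have hd : ∀ s ∈ Ioo 0 t, HasDerivAt (fun s => ‖w s x‖ ^ 2)
        (2 * (conj (w (clamp T s) x) * dt T w (clamp T s) x).re) s := by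
      intro s hs
      have hs' : s ∈ Ioo 0 T := ⟨hs.1, hs.2.trans_le ht.2⟩
      rw [clamp_of_mem (Ioo_subset_Icc_self hs')]
      have h1 : HasDerivAt (fun s => w s x) (dt T w s x) s :=
        (hw.differentiable_time s (Ioo_subset_Icc_self hs') x).hasDerivWithinAt.hasDerivAt
          (Icc_mem_nhds hs'.1 hs'.2)
      refine (h1.norm_sq).congr_deriv ?_
      rw [Complex.inner, mul_comm (conj _)]
    have hw' : ContinuousOn (fun s => w s x) (Icc 0 t) := fun s hs =>
      (hw.differentiable_time s ⟨hs.1, hs.2.trans ht.2⟩ x).continuousWithinAt.mono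
        (Icc_subset_Icc_right ht.2)
    have hc : ContinuousOn (fun s => ‖w s x‖ ^ 2) (Icc 0 t) := hw'.norm.pow 2
    have := intervalIntegral.integral_eq_sub_of_hasDerivAt_of_le ht.1 hc hd
      ((hF.comp (Continuous.prodMk_left x)).intervalIntegrable _ _)
    rw [this, h0]
    simp

theorem eq_zero_of_integral_sq_eq_zero {g : ℝ → ℂ} (hg : Continuous g)
    (hp : Function.Periodic g (2 * Real.pi))
    (h : ∫ x in (0 : ℝ)..(2 * Real.pi), ‖g x‖ ^ 2 = 0) (x : ℝ) : g x = 0 := by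
  obtain ⟨y, hy, hxy⟩ := hp.exists_mem_Ico₀ Real.two_pi_pos x
  rw [hxy]
  by_contra hne
  have := intervalIntegral.integral_pos (f := fun x => ‖g x‖ ^ 2) Real.two_pi_pos
    (hg.norm.pow 2).continuousOn (fun x _ => by positivity)
    ⟨y, Ico_subset_Icc_self hy, by positivity⟩
  exact this.ne' h

/-- The energy method for a system of advected Schrödinger equations. -/
theorem eq_zero_of_energy {ι : Type*} [Fintype ι] {T : ℝ} (hT : 0 < T) {w : ι → ℝ → ℝ → ℂ}
    (hw : ∀ i, IsClassical T (w i)) (h0 : ∀ i x, w i 0 x = 0) (c : ι → ℝ) (ε : ℝ) {K : ℝ}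
    (hK : 0 ≤ K)
    (hR : ∀ i, ∀ t ∈ Icc 0 T, ∀ x, ‖dt T (w i) t x + c i * dx (w i) t x
      - Complex.I * ε / 2 * dxx (w i) t x‖ ≤ K * ∑ j, ‖w j t x‖) (i : ι) {t : ℝ}
    (ht : t ∈ Icc 0 T) (x : ℝ) : w i t x = 0 := by
  set D : ι → ℝ → ℝ := fun i s => ∫ x in (0 : ℝ)..(2 * Real.pi),
    2 * (conj (w i (clamp T s) x) * dt T (w i) (clamp T s) x).re with hD
  have hDc : ∀ i, Continuous (D i) := fun i =>
    intervalIntegral.continuous_parametric_intervalIntegral_of_continuous'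
      ((hw i).continuous_energy_density hT) _ _
  set En : ℝ → ℝ := fun t => ∑ i, ∫ x in (0 : ℝ)..(2 * Real.pi), ‖w i t x‖ ^ 2 with hEn
  have hEn_eq : ∀ t ∈ Icc 0 T, ∫ s in (0 : ℝ)..t, ∑ i, D i s = En t := by
    intro t ht
    rw [intervalIntegral.integral_finsetSum fun i _ => (hDc i).intervalIntegrable _ _]
    exact Finset.sum_congr rfl fun i _ => ((hw i).integral_sq_eq hT (h0 i) ht).symm
  have hEn0 : ∀ t, 0 ≤ En t := fun t => Finset.sum_nonneg fun i _ =>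
    intervalIntegral.integral_nonneg Real.two_pi_pos.le fun x _ => by positivity
  have hbound : ∀ t ∈ Icc 0 T, |∑ i, D i t| ≤ 2 * K * Fintype.card ι * En t := by
    intro t ht
    have hc : ∀ j, Continuous (w j t) := fun j => (hw j).continuous_slice ht
    -- Adding the advection and the dispersion does not change the integral, and the sum is what the
    -- hypothesis on the residual controls.
    have hDi : ∀ i, D i t = ∫ x in (0 : ℝ)..(2 * Real.pi), 2 * (conj (w i t x) *
        (dt T (w i) t x + c i * dx (w i) t x - Complex.I * ε / 2 * dxx (w i) t x)).re := by
      intro i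
      have hz := integral_advection_dispersion_eq_zero ((hw i).contDiff_space t ht)
        ((hw i).periodic t ht) (c i) ε
      have c1 : Continuous (dt T (w i) t) := (hw i).continuousOn_dt.comp_continuous
        (Continuous.prodMk_right t) fun x => ⟨ht, mem_univ _⟩
      have c2 : Continuous (deriv (w i t)) :=
        ((hw i).contDiff_space t ht).continuous_deriv (by norm_num)
      have c3 : Continuous (iteratedDeriv 2 (w i t)) :=
        ((hw i).contDiff_space t ht).continuous_iteratedDeriv 2 le_rfl
      have c0 := hc i
      rw [hD]
      simp only [clamp_of_mem ht]
      refine (sub_eq_self.2 hz).symm.trans ?_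
      rw [← intervalIntegral.integral_sub]
      · refine intervalIntegral.integral_congr fun x _ => ?_
        simp only [dx, dxx]
        rw [← mul_sub, ← Complex.sub_re, ← mul_sub]
        congr 3
        ring
      · apply Continuous.intervalIntegrable
        fun_prop
      · apply Continuous.intervalIntegrable
        fun_prop
    have hsum : ∑ i, ∫ x in (0 : ℝ)..(2 * Real.pi), 2 * (‖w i t x‖ * (K * ∑ j, ‖w j t x‖))
        ≤ 2 * K * Fintype.card ι * En t := by
      simp only [hEn]
      rw [← intervalIntegral.integral_finsetSum, ← intervalIntegral.integral_finsetSum,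
        ← intervalIntegral.integral_const_mul]
      · refine intervalIntegral.integral_mono_on Real.two_pi_pos.le ?_ ?_ fun x _ => ?_
        · apply Continuous.intervalIntegrable
          fun_prop
        · apply Continuous.intervalIntegrable
          fun_prop
        · have := sq_sum_le_card_mul_sum_sq (s := Finset.univ) (f := fun j => ‖w j t x‖)
          rw [Finset.card_univ] at this
          calc ∑ i, 2 * (‖w i t x‖ * (K * ∑ j, ‖w j t x‖))
              = 2 * K * (∑ j, ‖w j t x‖) ^ 2 := by
                rw [← Finset.mul_sum, ← Finset.sum_mul]; ring
            _ ≤ 2 * K * (Fintype.card ι * ∑ j, ‖w j t x‖ ^ 2) := by gcongr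
            _ = _ := by ring
      · exact fun i _ => Continuous.intervalIntegrable (by fun_prop) _ _
      · exact fun i _ => Continuous.intervalIntegrable (by fun_prop) _ _
    refine (Finset.abs_sum_le_sum_abs _ _).trans (le_trans ?_ hsum)
    refine Finset.sum_le_sum fun i _ => ?_
    rw [hDi i, ← Real.norm_eq_abs]
    refine intervalIntegral.norm_integral_le_of_norm_le Real.two_pi_pos.le
      (MeasureTheory.ae_of_all _ fun x _ => ?_) (Continuous.intervalIntegrable (by fun_prop) _ _)
    rw [norm_mul, Real.norm_ofNat, Real.norm_eq_abs]
    refine mul_le_mul_of_nonneg_left ((Complex.abs_re_le_norm _).trans ?_) two_pos.le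
    rw [norm_mul, RCLike.norm_conj]
    exact mul_le_mul_of_nonneg_left (hR i t ht x) (norm_nonneg _)
  have hcont : Continuous fun s => ∑ i, D i s := continuous_finsetSum _ fun i _ => hDc i
  have hder : ∀ s, HasDerivAt (fun t => ∫ s in (0 : ℝ)..t, ∑ i, D i s) (∑ i, D i s) s := fun s =>
    intervalIntegral.integral_hasDerivAt_right (hcont.intervalIntegrable _ _)
      (hcont.stronglyMeasurableAtFilter _ _) hcont.continuousAt
  -- Grönwall's inequality, applied to the primitive of `∑ i, D i`, which agrees with the energy on
  -- `[0, T]`.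
  have hzero := eq_zero_of_abs_deriv_le_mul_abs_self_of_eq_zero_right (a := 0) (b := T)
    (K := 2 * K * Fintype.card ι)
    (fun s _ => (hder s).continuousAt.continuousWithinAt)
    (fun s _ => (hder s).hasDerivWithinAt) intervalIntegral.integral_same
    (fun s hs => by
      have hs' := Ico_subset_Icc_self hs
      rw [hEn_eq s hs', Real.norm_eq_abs, Real.norm_of_nonneg (hEn0 s)]
      exact hbound s hs') t ht
  rw [hEn_eq t ht, hEn, Finset.sum_eq_zero_iff_of_nonneg fun i _ =>
    intervalIntegral.integral_nonneg Real.two_pi_pos.le fun x _ => by positivity] at hzero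
  exact eq_zero_of_integral_sq_eq_zero ((hw i).continuous_slice ht) ((hw i).periodic t ht)
    (hzero i (Finset.mem_univ i)) x

/-- Classical solutions of a system of advected Schrödinger equations with a continuously
differentiable nonlinearity are determined by their initial values. -/
theorem eq_of_system {ι : Type*} [Fintype ι] {T : ℝ} (hT : 0 < T) {f g : ι → ℝ → ℝ → ℂ}
    (hf : ∀ i, IsClassical T (f i)) (hg : ∀ i, IsClassical T (g i))
    (h0 : ∀ i x, f i 0 x = g i 0 x) (c : ι → ℝ) (ε : ℝ) {Φ : (ι → ℂ) → ι → ℂ}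
    (hΦ : ContDiff ℝ 1 Φ)
    (hfe : ∀ i, ∀ t ∈ Icc 0 T, ∀ x, dt T (f i) t x + c i * dx (f i) t x
      - Complex.I * ε / 2 * dxx (f i) t x = Φ (fun j => f j t x) i)
    (hge : ∀ i, ∀ t ∈ Icc 0 T, ∀ x, dt T (g i) t x + c i * dx (g i) t x
      - Complex.I * ε / 2 * dxx (g i) t x = Φ (fun j => g j t x) i) (i : ι) {t : ℝ}
    (ht : t ∈ Icc 0 T) (x : ℝ) : f i t x = g i t x := by
  choose Mf hMf using fun i => (hf i).exists_bound
  choose Mg hMg using fun i => (hg i).exists_bound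
  set M : ℝ := ∑ i, (|Mf i| + |Mg i|) with hM
  have hle : ∀ i, |Mf i| + |Mg i| ≤ M := fun i =>
    Finset.single_le_sum (f := fun i => |Mf i| + |Mg i|) (fun j _ => by positivity)
      (Finset.mem_univ i)
  have hM0 : 0 ≤ M := Finset.sum_nonneg fun j _ => by positivity
  have hfm : ∀ t ∈ Icc 0 T, ∀ x, (fun j => f j t x) ∈ Metric.closedBall (0 : ι → ℂ) M := by
    intro t ht x
    rw [mem_closedBall_zero_iff, pi_norm_le_iff_of_nonneg hM0]
    exact fun j => ((hMf j t ht x).trans (le_abs_self _)).trans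
      ((le_add_of_nonneg_right (abs_nonneg _)).trans (hle j))
  have hgm : ∀ t ∈ Icc 0 T, ∀ x, (fun j => g j t x) ∈ Metric.closedBall (0 : ι → ℂ) M := by
    intro t ht x
    rw [mem_closedBall_zero_iff, pi_norm_le_iff_of_nonneg hM0]
    exact fun j => ((hMg j t ht x).trans (le_abs_self _)).trans
      ((le_add_of_nonneg_left (abs_nonneg _)).trans (hle j))
  -- Both solutions take values in one closed ball, which is compact and convex, so the continuously
  -- differentiable nonlinearity is Lipschitz there.
  obtain ⟨K, hK⟩ := hΦ.contDiffOn.exists_lipschitzOnWith (s := Metric.closedBall (0 : ι → ℂ) M)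
    (by norm_num) (convex_closedBall 0 M) (isCompact_closedBall 0 M)
  have hd := fun i => (hf i).sub (hg i)
  refine sub_eq_zero.1 (eq_zero_of_energy hT (fun i => (hd i).1)
    (fun i x => by simp [h0 i x]) c ε K.2 (fun i t ht x => ?_) i ht x)
  rw [(hd i).2.1 t ht, (hd i).2.2.1 t ht, (hd i).2.2.2 t ht]
  have : dt T (f i) t x - dt T (g i) t x + c i * (dx (f i) t x - dx (g i) t x)
      - Complex.I * ε / 2 * (dxx (f i) t x - dxx (g i) t x)
      = Φ (fun j => f j t x) i - Φ (fun j => g j t x) i := by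
    rw [← hfe i t ht x, ← hge i t ht x]; ring
  rw [this]
  have h1 := hK.norm_sub_le (hfm t ht x) (hgm t ht x)
  refine ((norm_le_pi_norm (Φ (fun j => f j t x) - Φ (fun j => g j t x)) i).trans h1).trans ?_
  refine mul_le_mul_of_nonneg_left ?_ K.2
  rw [pi_norm_le_iff_of_nonneg (Finset.sum_nonneg fun j _ => norm_nonneg _)]
  exact fun j => Finset.single_le_sum (f := fun j => ‖f j t x - g j t x‖)
    (fun j _ => norm_nonneg _) (Finset.mem_univ j)

/-- Divided by `i ε`, the equation is an advected Schrödinger equation with velocity zero. -/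
theorem SolvesNLS.unique {ε lam T : ℝ} (hT : 0 < T) (hε : ε ≠ 0) {u0 : ℝ → ℂ} {u v : ℝ → ℝ → ℂ}
    (hu : SolvesNLS ε lam T u0 u) (hv : SolvesNLS ε lam T u0 v) {t : ℝ} (ht : t ∈ Icc 0 T)
    (x : ℝ) : u t x = v t x := by
  have key : ∀ {f : ℝ → ℝ → ℂ}, SolvesNLS ε lam T u0 f → ∀ t ∈ Icc 0 T, ∀ x,
      dt T f t x + (0 : ℝ) * dx f t x - Complex.I * ε / 2 * dxx f t x
        = -Complex.I * lam * (f t x * conj (f t x) * f t x) := by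
    intro f hf t ht x
    have h := hf.equation t ht x
    have hε' : (ε : ℂ) ≠ 0 := by exact_mod_cast hε
    rw [Complex.mul_conj']
    refine mul_left_cancel₀ (mul_ne_zero Complex.I_ne_zero hε') ?_
    push_cast
    linear_combination h + (-(ε : ℂ) ^ 2 / 2 * dxx f t x
      + lam * ε * ‖f t x‖ ^ 2 * f t x) * Complex.I_sq
  refine eq_of_system (ι := Unit) (f := fun _ => u) (g := fun _ => v) hT (fun _ => hu.classical)
    (fun _ => hv.classical) (fun _ x => (hu.initial x).trans (hv.initial x).symm) (fun _ => 0) ε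
    (Φ := fun y i => -Complex.I * lam * (y i * conj (y i) * y i)) ?_ (fun _ => key hu)
    (fun _ => key hv) () ht x
  have hconj : ContDiff ℝ 1 (fun z : ℂ => conj z) := Complex.conjCLE.contDiff
  rw [contDiff_pi]
  intro i
  have hp : ContDiff ℝ 1 (fun y : Unit → ℂ => y i) := contDiff_apply ℝ ℂ i
  exact contDiff_const.mul ((hp.mul (hconj.comp hp)).mul hp)

/-- The four equations form one system whose nonlinearity is a polynomial in the unknowns and their
conjugates. The initial values of `b⋆` agree because they are functions of those of `a₁, a₋₁`. -/
theorem SolvesModulation.unique {ε lam κ T : ℝ} (hT : 0 < T) {ap0 am0 : ℝ → ℂ}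
    {ap am sp sm ap' am' sp' sm' : ℝ → ℝ → ℂ}
    (h : SolvesModulation ε lam κ T ap0 am0 ap am sp sm)
    (h' : SolvesModulation ε lam κ T ap0 am0 ap' am' sp' sm') {t : ℝ} (ht : t ∈ Icc 0 T)
    (x : ℝ) : ap t x = ap' t x ∧ am t x = am' t x ∧ sp t x = sp' t x ∧ sm t x = sm' t x := by
  set aF : ℂ → ℂ → ℂ := fun p m => aForcing ε lam κ (fun _ _ => p) (fun _ _ => m) 0 0 with haF
  set bF : ℂ → ℂ → ℂ → ℂ := fun p m s =>
    bForcing lam (fun _ _ => p) (fun _ _ => m) (fun _ _ => s) 0 0 with hbF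
  have h0p : ∀ x, ap 0 x = ap' 0 x := fun x => (h.a_pos.initial x).trans (h'.a_pos.initial x).symm
  have h0m : ∀ x, am 0 x = am' 0 x := fun x => (h.a_neg.initial x).trans (h'.a_neg.initial x).symm
  have hsys := eq_of_system (ι := Fin 4) (f := ![ap, am, sp, sm]) (g := ![ap', am', sp', sm']) hT
    (by
      intro i; fin_cases i
      exacts [h.a_pos.classical, h.a_neg.classical, h.b_pos.classical, h.b_neg.classical])
    (by
      intro i; fin_cases i
      exacts [h'.a_pos.classical, h'.a_neg.classical, h'.b_pos.classical, h'.b_neg.classical])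
    (by
      intro i; fin_cases i
      · exact h0p
      · exact h0m
      · exact fun x => ((h.b_pos.initial x).trans (by simp [bCoeff, h0p, h0m])).trans
          (h'.b_pos.initial x).symm
      · exact fun x => ((h.b_neg.initial x).trans (by simp [bCoeff, h0p, h0m])).trans
          (h'.b_neg.initial x).symm)
    ![κ, -κ, 3 * κ, -(3 * κ)] ε
    (Φ := fun y => ![aF (y 0) (y 1), aF (y 1) (y 0), bF (y 0) (y 1) (y 2), bF (y 0) (y 1) (y 3)])
    (by
      have hconj : ContDiff ℝ 1 (fun z : ℂ => conj z) := Complex.conjCLE.contDiff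
      have hp : ∀ i, ContDiff ℝ 1 (fun y : Fin 4 → ℂ => y i) := fun i => contDiff_apply ℝ ℂ i
      have hpc : ∀ i, ContDiff ℝ 1 (fun y : Fin 4 → ℂ => conj (y i)) := fun i => hconj.comp (hp i)
      have p0 := hp 0
      have p1 := hp 1
      have p2 := hp 2
      have p3 := hp 3
      have q0 := hpc 0
      have q1 := hpc 1
      rw [contDiff_pi]
      intro i
      fin_cases i <;>
        simp only [haF, hbF, aForcing, bForcing, bCoeff, ← Complex.mul_conj', map_mul, map_div₀,
          map_one, Complex.conj_conj, Fin.zero_eta, Fin.mk_one, Fin.reduceFinMk, Matrix.cons_val] <;>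
        fun_prop)
    (by
      intro i; fin_cases i
      exacts [h.a_pos.equation, h.a_neg.equation, h.b_pos.equation, h.b_neg.equation])
    (by
      intro i; fin_cases i
      exacts [h'.a_pos.equation, h'.a_neg.equation, h'.b_pos.equation, h'.b_neg.equation])
  exact ⟨hsys 0 ht x, hsys 1 ht x, hsys 2 ht x, hsys 3 ht x⟩

end TwoPhaseMFE

/-! ### Restriction to one value of the parameter, plane waves, nonresonance. -/

namespace Wiener

open Coef TwoPhaseMFE

section Pull

variable {E E' : Type*} [TopologicalSpace E] [DiscreteTopology E] [TopologicalSpace E']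
  [DiscreteTopology E'] {T : ℝ} [hT : Fact (0 < T)]

/-- Change of the parameter of the coefficients. -/
noncomputable def pullCoef (T : ℝ) [Fact (0 < T)] (φ : E' → E) : Coef E T →+* Coef E' T where
  toFun c := ofFun (fun e => c.val (φ e)) (fun e => c.continuous_val (φ e)) ‖c‖
    fun e t _ => c.norm_val_le (φ e) t
  map_one' := ext_val fun e t ht => by rw [val_ofFun _ ht, val_one, val_one]
  map_zero' := ext_val fun e t ht => by rw [val_ofFun _ ht, val_zero, val_zero]
  map_add' c d := ext_val fun e t ht => by
    rw [val_add, val_ofFun _ ht, val_ofFun _ ht, val_ofFun _ ht, val_add]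
  map_mul' c d := ext_val fun e t ht => by
    rw [val_mul, val_ofFun _ ht, val_ofFun _ ht, val_ofFun _ ht, val_mul]

theorem val_pullCoef (φ : E' → E) (c : Coef E T) (e : E') {t : ℝ} (ht : t ∈ Icc 0 T) :
    (pullCoef T φ c).val e t = c.val (φ e) t :=
  val_ofFun (f := fun e => c.val (φ e)) (hf := fun e => c.continuous_val (φ e))
    (h := fun e t _ => c.norm_val_le (φ e) t) e ht

theorem norm_pullCoef_le (φ : E' → E) (c : Coef E T) : ‖pullCoef T φ c‖ ≤ 1 * ‖c‖ := by
  rw [one_mul]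
  refine Coef.norm_le (norm_nonneg _) fun e t ht => ?_
  rw [val_pullCoef φ c e ht]
  exact c.norm_val_le _ _

theorem isDt_pullCoef (φ : E' → E) {c h : Coef E T} (H : Coef.IsDt c h) :
    Coef.IsDt (pullCoef T φ c) (pullCoef T φ h) := by
  rw [Coef.isDt_iff] at *
  intro e t ht
  rw [val_pullCoef φ h e ht]
  exact (H (φ e) t ht).congr (fun s hs => val_pullCoef φ c e hs) (val_pullCoef φ c e ht)

/-- Change of the parameter. -/
noncomputable def pull (T : ℝ) [Fact (0 < T)] (φ : E' → E) :
    Wiener (Coef E T) →+* Wiener (Coef E' T) :=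
  mapRing (pullCoef T φ) (norm_pullCoef_le φ)

theorem pull_apply (φ : E' → E) (f : Wiener (Coef E T)) (k : ℤ) :
    pull T φ f k = pullCoef T φ (f k) := rfl

theorem norm_pull_le (φ : E' → E) (f : Wiener (Coef E T)) : ‖pull T φ f‖ ≤ ‖f‖ := by
  rw [← one_mul ‖f‖]
  exact norm_le_of_forall fun k => norm_pullCoef_le φ (f k)

theorem pull_star (φ : E' → E) (f : Wiener (Coef E T)) :
    pull T φ (star f) = star (pull T φ f) := by
  ext k : 1
  refine ext_val fun e t ht => ?_
  rw [star_apply, pull_apply, pull_apply, star_apply, val_pullCoef φ _ e ht, val_star, val_star,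
    val_pullCoef φ _ e ht]

theorem pull_const (φ : E' → E) (r : Coef E T) :
    pull T φ (const r) = const (pullCoef T φ r) := by
  ext k : 1
  rw [pull_apply, const_def, const_def, single_apply, single_apply]
  split_ifs <;> simp

theorem pull_scal (φ : E' → E) (z : ℂ) : pull T φ (scal E T z) = scal E' T z := by
  rw [pull_const]
  exact congrArg const (ext_val fun e t ht => by rw [val_pullCoef φ _ e ht, val_num, val_num])

theorem RapidDecay.pull {f : Wiener (Coef E T)} (hf : RapidDecay f) (φ : E' → E) :
    RapidDecay (pull T φ f) :=
  hf.of_le (C := 1) (p := 0) fun k => by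
    rw [pow_zero, mul_one]
    exact norm_pullCoef_le φ (f k)

theorem Evolves.pull {η : E → ℝ} {hη : ∀ e, |η e| ≤ 1} {c : ℝ} {f g : Wiener (Coef E T)}
    (h : Evolves (dispCoef T hη c) f g) (φ : E' → E) :
    Evolves (dispCoef T (η := fun e => η (φ e)) (fun e => hη (φ e)) c) (pull T φ f)
      (pull T φ g) := by
  intro k
  refine (congrArg _ (ext_val fun e t ht => ?_)).mp (isDt_pullCoef φ (h k))
  simp only [val_pullCoef φ _ e ht, pull_apply, val_sub, val_mul]
  rfl

theorem ev_pull (φ : E' → E) (f : Wiener (Coef E T)) (e : E') {t : ℝ} (ht : t ∈ Icc 0 T)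
    (x : ℝ) : ev (pull T φ f) e t x = ev f (φ e) t x := by
  unfold ev
  congr 1; ext1 k
  rw [pull_apply, val_pullCoef φ _ e ht]

theorem pull_cub (φ : E' → E) (z : ℂ) (a b : Wiener (Coef E T)) :
    pull T φ (cub z a b) = cub z (pull T φ a) (pull T φ b) := by
  simp only [cub, map_mul, pull_scal, pull_star]

theorem pull_forcing (φ : E' → E) (lam z : ℂ) (h a b : Wiener (Coef E T)) :
    pull T φ (forcing lam z h a b)
      = forcing lam z (pull T φ h) (pull T φ a) (pull T φ b) := by
  simp only [forcing, crossCubic, quintic, map_mul, map_add, pull_scal, pull_star, pull_cub]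

end Pull

section Waves

variable {E : Type*} [TopologicalSpace E] [DiscreteTopology E] {T : ℝ} [hT : Fact (0 < T)]

theorem scal_mul (z w : ℂ) : scal E T (z * w) = scal E T z * scal E T w := by
  rw [← map_mul]
  exact congrArg const (ext_val fun e t _ => by simp)

theorem scal_add (z w : ℂ) : scal E T (z + w) = scal E T z + scal E T w := by
  rw [← map_add]
  exact congrArg const (ext_val fun e t _ => by simp)

theorem scal_neg (z : ℂ) : scal E T (-z) = -scal E T z := by
  rw [← map_neg]
  exact congrArg const (ext_val fun e t _ => by simp)

theorem scal_one : scal E T 1 = 1 := by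
  rw [← map_one const]
  exact congrArg const (ext_val fun e t _ => by simp)

theorem star_scal (z : ℂ) : star (scal E T z) = scal E T (conj z) := by
  rw [star_const, star_num]

theorem norm_scal_mul_le (z : ℂ) (f : Wiener (Coef E T)) : ‖scal E T z * f‖ ≤ ‖z‖ * ‖f‖ := by
  refine (norm_mul_le _ _).trans ?_
  rw [norm_const]
  gcongr
  exact norm_num_le z

/-- The wave `e ^ (i (k κ x - w (κ² / 2) t) / ε)` if `κ = ε n`. -/
noncomputable def pw (E : Type*) [TopologicalSpace E] [DiscreteTopology E] (T : ℝ)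
    [Fact (0 < T)] (ε κ : ℝ) (n k w : ℤ) : Wiener (Coef E T) :=
  single (k * n) (osc T fun _ => -(w * (κ ^ 2 / 2) / ε))

theorem pw_mul (ε κ : ℝ) (n k w k' w' : ℤ) :
    pw E T ε κ n k w * pw E T ε κ n k' w' = pw E T ε κ n (k + k') (w + w') := by
  rw [pw, pw, pw, single_mul_single, ← osc_add, add_mul]
  congr 2
  ext e
  simp only [Pi.add_apply]
  push_cast
  ring

theorem pw_zero (ε κ : ℝ) (n : ℤ) : pw E T ε κ n 0 0 = 1 := by
  rw [pw, one_def, zero_mul, ← osc_zero]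
  congr 2
  ext e
  simp

theorem star_pw (ε κ : ℝ) (n k w : ℤ) : star (pw E T ε κ n k w) = pw E T ε κ n (-k) (-w) := by
  rw [pw, pw, star_single, star_osc, neg_mul]
  congr 2
  ext e
  simp only [Pi.neg_apply]
  push_cast
  ring

/-- A plane wave is a shift of the Fourier index with a unimodular coefficient, so its norm is
bounded independently of `ε`. -/
theorem norm_pw_le (ε κ : ℝ) (n k w : ℤ) : ‖pw E T ε κ n k w‖ ≤ 1 := by
  rw [pw, norm_single]; exact norm_osc_le _

theorem norm_mul_pw_le (f : Wiener (Coef E T)) (ε κ : ℝ) (n k w : ℤ) :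
    ‖f * pw E T ε κ n k w‖ ≤ ‖f‖ :=
  (norm_mul_le _ _).trans (mul_le_of_le_one_right (norm_nonneg _) (norm_pw_le ..))

theorem ev_pw {ε κ : ℝ} (hε : ε ≠ 0) {n : ℤ} (hn : κ = ε * n) (k w : ℤ) (e : E) {t : ℝ}
    (ht : t ∈ Icc 0 T) (x : ℝ) :
    ev (pw E T ε κ n k w) e t x = wave ε (k * κ) (w * (κ ^ 2 / 2)) t x := by
  rw [pw, ev_single, val_osc _ e ht, char, wave, ← Complex.exp_add]
  congr 1
  have hε' : (ε : ℂ) ≠ 0 := by exact_mod_cast hε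
  rw [hn]
  push_cast
  field_simp
  ring

/-- The equation for a modulated wave, in terms of the equation for the modulation function in
the frame moving with the group velocity. -/
theorem Evolves.mul_pw {ε κ : ℝ} (hε : ε ≠ 0) {hη : ∀ _ : E, |ε| ≤ 1} {n : ℤ} (hn : κ = ε * n)
    {k : ℤ} (w : ℤ) {a g : Wiener (Coef E T)}
    (h : Evolves (dispCoef T (η := fun _ => ε) hη (k * κ)) a g) :
    Evolves (dispCoef T (η := fun _ => ε) hη 0) (a * pw E T ε κ n k w)
      ((g - scal E T (Complex.I * ((w - k ^ 2) * (κ ^ 2 / 2) / ε)) * a) * pw E T ε κ n k w) := by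
  intro j
  rw [mul_comm a, mul_comm (g - _), pw, single_mul_apply, single_mul_apply]
  -- Writing the index as `(j - k n) + k n` and using `ε n = κ`, the square in the free symbol `ε j²
  -- / 2` yields the dispersion of `a`, the advection with velocity `k κ` and the constant `k² κ² /
  -- (2 ε)`, which is offset against the frequency of the wave.
  have h1 := (Coef.isDt_osc (T := T) (fun _ : E => -(w * (κ ^ 2 / 2) / ε))
    (num E T (Complex.I * (-(w * (κ ^ 2 / 2) / ε) : ℝ))) fun e t => by simp).mul (h (j - k * n))
  convert h1 using 1
  refine ext_val fun e t ht => ?_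
  simp only [val_sub, val_add, val_mul, val_num, sub_apply, const_mul_apply, dispCoef, val_cst,
    disp]
  have hε' : (ε : ℂ) ≠ 0 := by exact_mod_cast hε
  have hn' : (κ : ℂ) = ε * n := by exact_mod_cast hn
  push_cast
  rw [hn']
  field_simp
  ring

/-- Nonresonant forcing is not felt at leading order. -/
theorem norm_duh_mul_pw_le {ε κ : ℝ} (hε : 0 < ε) {hη : ∀ _ : E, |ε| ≤ 1} {n : ℤ}
    (hn : κ = ε * n) (hκ : κ ≠ 0) {k w : ℤ} (hkw : w ≠ k ^ 2) {a g : Wiener (Coef E T)}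
    (h : Evolves (dispCoef T (η := fun _ => ε) hη (k * κ)) a g) :
    ‖duh (disp (fun _ => ε) 0) (a * pw E T ε κ n k w)‖
      ≤ ε * ((2 * ‖a‖ + T * ‖g‖) / |(w - k ^ 2) * (κ ^ 2 / 2)|) := by
  set δ : ℝ := (w - k ^ 2) * (κ ^ 2 / 2) with hδ
  have hδ0 : δ ≠ 0 := by
    refine mul_ne_zero (sub_ne_zero.2 (by exact_mod_cast hkw)) (by positivity)
  -- Integration by parts: `m` is minus the inverse of `i δ / ε`, so the detuning of `m a` times the
  -- wave produces exactly `a` times the wave, and the remaining terms all carry the factor `m =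
  -- O(ε)`.
  set m : ℂ := Complex.I * ε / δ with hm
  have hδ' : (δ : ℂ) ≠ 0 := by exact_mod_cast hδ0
  have hε' : (ε : ℂ) ≠ 0 := by exact_mod_cast hε.ne'
  have hmn : ‖m‖ = ε / |δ| := by
    rw [hm, norm_div, norm_mul, Complex.norm_I, one_mul, Complex.norm_real, Complex.norm_real,
      Real.norm_of_nonneg hε.le, Real.norm_eq_abs]
  have h1 : Evolves (dispCoef T (η := fun _ => ε) hη (k * κ)) (scal E T m * a)
      (scal E T m * g) := fun j => by
    have := (isDt_num (E := E) (T := T) m).mul (h j)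
    rw [const_mul_apply, const_mul_apply]
    convert this using 1
    ring
  have h2 := h1.mul_pw hε.ne' hn w
  have h3 : (scal E T m * g - scal E T (Complex.I * ((w - k ^ 2) * (κ ^ 2 / 2) / ε))
      * (scal E T m * a)) * pw E T ε κ n k w
      = scal E T m * g * pw E T ε κ n k w + a * pw E T ε κ n k w := by
    rw [← mul_assoc (scal E T _) (scal E T _), ← scal_mul]
    have : (Complex.I * ((w - k ^ 2) * (κ ^ 2 / 2) / ε)) * m = -1 := by
      have : ((w - k ^ 2) * (κ ^ 2 / 2) : ℂ) = δ := by rw [hδ]; push_cast; rfl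
      rw [this, hm]
      field_simp
      exact Complex.I_sq
    rw [this, scal_neg, scal_one]
    ring
  rw [h3] at h2
  have h4 := mild_of_evolves (represents_dispCoef hη 0) h2 (f₀ := scal E T m * a * pw E T ε κ n k w)
    (fun _ => rfl)
  rw [map_add, ← add_assoc] at h4
  have h5 := (eq_sub_of_add_eq' h4.symm)
  rw [h5]
  have e1 : ‖scal E T m * a * pw E T ε κ n k w‖ ≤ ‖m‖ * ‖a‖ :=
    (norm_mul_pw_le ..).trans (norm_scal_mul_le m a)
  have e2 : ‖scal E T m * g * pw E T ε κ n k w‖ ≤ ‖m‖ * ‖g‖ :=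
    (norm_mul_pw_le ..).trans (norm_scal_mul_le m g)
  have e3 : ‖prop (disp (fun _ : E => ε) 0) (scal E T m * a * pw E T ε κ n k w)‖ ≤ ‖m‖ * ‖a‖ :=
    (norm_prop_le _ _).trans (by rw [one_mul]; exact e1)
  have e4 := (norm_duh_le (disp (fun _ : E => ε) 0) (scal E T m * g * pw E T ε κ n k w)).trans
    (mul_le_mul_of_nonneg_left e2 hT.out.le)
  refine (norm_sub_le _ _).trans ((add_le_add e1 ((norm_add_le _ _).trans
    (add_le_add e3 e4))).trans (le_of_eq ?_))
  rw [hmn]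
  ring

/-- The Duhamel operator commutes with multiplication by numbers. -/
theorem duh_scal_mul (σ : ℤ → E → ℝ) (z : ℂ) (f : Wiener (Coef E T)) :
    duh σ (scal E T z * f) = scal E T z * duh σ f := by
  ext k : 1
  rw [const_mul_apply, duh_apply, duh_apply, const_mul_apply, duhamel_apply, duhamel_apply]
  have : ∀ c : Coef E T, intg (num E T z * c) = num E T z * intg c := fun c =>
    ext_val fun e t ht => by
      rw [val_mul, val_intg _ e ht, val_intg _ e ht, val_num, ← intervalIntegral.integral_const_mul]
      simp
  rw [mul_left_comm, this, mul_left_comm]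

end Waves

end Wiener

/-! ### The residual of the expansion. -/

namespace Wiener

open Coef TwoPhaseMFE

variable {E : Type*} [TopologicalSpace E] [DiscreteTopology E] {T : ℝ} [hT : Fact (0 < T)]

theorem Evolves.add {s : ℤ → Coef E T} {f g f' g' : Wiener (Coef E T)} (h : Evolves s f g)
    (h' : Evolves s f' g') : Evolves s (f + f') (g + g') := fun k => by
  have := (h k).add (h' k)
  rwa [show g k - s k * f k + (g' k - s k * f' k) = (g + g') k - s k * (f + f') k by
    simp only [add_apply]; ring] at this

theorem Evolves.scalMul {s : ℤ → Coef E T} {f g : Wiener (Coef E T)} (h : Evolves s f g) (z : ℂ) :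
    Evolves s (scal E T z * f) (scal E T z * g) := fun k => by
  have := (isDt_num (E := E) (T := T) z).mul (h k)
  rw [const_mul_apply, const_mul_apply]
  convert this using 1
  ring

/-- Any smooth element satisfies an advected equation with some forcing, at the price of one time
derivative. This supplies the forcing of an amplitude that `norm_duh_mul_pw_le` requires. -/
theorem Smooth.exists_evolves {η : E → ℝ} (hη : ∀ e, |η e| ≤ 1) (c : ℝ) {j : ℕ}
    {f : Wiener (Coef E T)} (hf : Smooth (j + 1) f) :
    ∃ g, Smooth j g ∧ Evolves (dispCoef T hη c) f g := by
  obtain ⟨q, hq, hq'⟩ := hf.of_succ.exists_multiplier (norm_dispCoef_le hη c) (isDt_dispCoef hη c)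
  obtain ⟨-, g, hg, hg'⟩ := hf
  refine ⟨g + q, hg'.add hq, fun k => ?_⟩
  rw [add_apply, hq', add_sub_cancel_right]
  exact hg k

/-- The truncated modulated Fourier expansion. -/
noncomputable def expansion (lam : ℂ) (z : ℂ) (ε κ : ℝ) (n : ℤ) (a b s q : Wiener (Coef E T)) :
    Wiener (Coef E T) :=
  (a * pw E T ε κ n 1 1 + b * pw E T ε κ n (-1) 1)
    + scal E T ε * (scal E T lam * ((s * pw E T ε κ n 3 9 + q * pw E T ε κ n (-3) 9)
      + (cub z a b * pw E T ε κ n 3 1 + cub z b a * pw E T ε κ n (-3) 1)))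

/-- The amplitudes of the nonresonant terms of order `ε` in the residual. -/
noncomputable def nonres (lam z : ℂ) (a b s g : Wiener (Coef E T)) : Fin 7 → Wiener (Coef E T) :=
  ![scal E T lam * g + scal E T (Complex.I * lam * lam)
      * (((a * star a + b * star b) * cub z a b + (a * star a + b * star b) * cub z a b)
        + (a * b * star (cub z b a) + a * b * star (cub z b a))),
    scal E T (Complex.I * lam * lam) * ((a * star b * cub z a b + a * star b * cub z a b)
      + a * a * star (cub z b a)),
    scal E T (Complex.I * lam * lam) * (a * star b * s + a * star b * s),
    scal E T (Complex.I * lam * lam) * (star a * b * s + star a * b * s),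
    scal E T (Complex.I * lam * lam) * (a * a * star s),
    scal E T (Complex.I * lam * lam) * (a * b * star s + a * b * star s),
    scal E T (Complex.I * lam * lam) * (b * b * star s)]

/-- The wave numbers of the nonresonant terms, in multiples of `κ`. -/
def nonresWave : Fin 7 → ℤ := ![3, 5, 5, 1, -1, -3, -5]

/-- The frequencies of the nonresonant terms, in multiples of `κ ^ 2 / 2`. -/
def nonresFreq : Fin 7 → ℤ := ![1, 1, 9, 9, -7, -7, -7]

/-- None of the remaining waves lies on the dispersion parabola `w = k²`; this finite check is the
nonresonance on which the order `ε²` rests. -/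
theorem nonresFreq_ne (i : Fin 7) : nonresFreq i ≠ nonresWave i ^ 2 := by
  fin_cases i <;> simp [nonresFreq, nonresWave]

theorem nonresFreq_ne' (i : Fin 7) : nonresFreq i ≠ (-nonresWave i) ^ 2 := by
  rw [neg_sq]; exact nonresFreq_ne i

theorem pull_nonres {E' : Type*} [TopologicalSpace E'] [DiscreteTopology E'] (φ : E' → E)
    (lam z : ℂ) (a b s g : Wiener (Coef E T)) (i : Fin 7) :
    pull T φ (nonres lam z a b s g i)
      = nonres lam z (pull T φ a) (pull T φ b) (pull T φ s) (pull T φ g) i := by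
  fin_cases i <;> simp [nonres, pull_cub, pull_star, pull_scal]

theorem smooth_cub {j : ℕ} {a b : Wiener (Coef E T)} (z : ℂ) (ha : Smooth j a) (hb : Smooth j b) :
    Smooth j (cub z a b) :=
  (polyLike_cub z).smooth j a a b ha ha hb

theorem smooth_nonres {j : ℕ} {a b s g : Wiener (Coef E T)} (lam z : ℂ) (ha : Smooth j a)
    (hb : Smooth j b) (hs : Smooth j s) (hg : Smooth j g) (i : Fin 7) :
    Smooth j (nonres lam z a b s g i) := by
  have hm : Smooth j (scal E T (Complex.I * lam * lam)) := smooth_const (isDt_num _) j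
  have hl : Smooth j (scal E T lam) := smooth_const (isDt_num _) j
  have hc := smooth_cub z ha hb
  have hd := (smooth_cub z hb ha).star
  have h0 := ((ha.mul ha.star).add (hb.mul hb.star)).mul hc
  have h1 := (ha.mul hb).mul hd
  have h2 := (ha.mul hb.star).mul hc
  have h3 := (ha.mul hb.star).mul hs
  have h4 := (ha.star.mul hb).mul hs
  have h5 := (ha.mul hb).mul hs.star
  fin_cases i
  exacts [(hl.mul hg).add (hm.mul ((h0.add h0).add (h1.add h1))),
    hm.mul ((h2.add h2).add ((ha.mul ha).mul hd)), hm.mul (h3.add h3), hm.mul (h4.add h4),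
    hm.mul ((ha.mul ha).mul hs.star), hm.mul (h5.add h5), hm.mul ((hb.mul hb).mul hs.star)]

/-- The bookkeeping of all interactions as a polynomial identity, with `h = ε`, `Λ = -i lam`,
conjugates as independent variables, `E, G` the waves at `(±1, 1)` and `P, Q` those at `(±3, 9)`.
The waves at `(±3, 1)` are `E² Ḡ` and `G² Ē`. Terms of order one and the resonant terms of order `h`
match on both sides; the terms linear in the correction that are left over are the nonresonant ones,
and those at least quadratic in it carry `h²`. Only the inverses of `E` and `G` are used, since
products of `P` or `Q` with conjugates occur just at that last order. -/
theorem expansion_identity {R : Type*} [CommRing R]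
    (a ab b bb s sb q qb g gm z l h Λ E Eb G Gb P Pb Q Qb : R) (hE : E * Eb = 1) (hG : G * Gb = 1) :
    (Λ * ((a * ab + (b * bb + b * bb)) * a)
        + h * (Λ * (l * ((b * ab * (z * (a * bb * a)) + b * ab * (z * (a * bb * a)))
          + b * (z * (bb * a * bb)) * b)))) * E
      + (Λ * ((b * bb + (a * ab + a * ab)) * b)
        + h * (Λ * (l * ((a * bb * (z * (b * ab * b)) + a * bb * (z * (b * ab * b)))
          + a * (z * (ab * b * ab)) * a)))) * G
      + h * (l * ((Λ + Λ) * (a * ab + b * bb) * s * P + (Λ + Λ) * (a * ab + b * bb) * q * Q))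
      + (h * (l * (g * (E * E * Gb) + gm * (G * G * Eb)))
        + Λ * (a * bb * a * (E * E * Gb) + b * ab * b * (G * G * Eb)))
    = Λ * (((a * E + b * G) + h * (l * ((s * P + q * Q)
          + (z * (a * bb * a) * (E * E * Gb) + z * (b * ab * b) * (G * G * Eb)))))
        * ((ab * Eb + bb * Gb) + h * (l * ((sb * Pb + qb * Qb)
          + (z * (ab * b * ab) * (Eb * Eb * G) + z * (bb * a * bb) * (Gb * Gb * E)))))
        * ((a * E + b * G) + h * (l * ((s * P + q * Q)
          + (z * (a * bb * a) * (E * E * Gb) + z * (b * ab * b) * (G * G * Eb))))))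
      + h * (((l * g + -(Λ * l) * (((a * ab + b * bb) * (z * (a * bb * a))
            + (a * ab + b * bb) * (z * (a * bb * a)))
            + (a * b * (z * (bb * a * bb)) + a * b * (z * (bb * a * bb))))) * (E * E * Gb)
          + -(Λ * l) * ((a * bb * (z * (a * bb * a)) + a * bb * (z * (a * bb * a)))
            + a * a * (z * (bb * a * bb))) * (E * E * E * Gb * Gb)
          + -(Λ * l) * (a * bb * s + a * bb * s) * (E * Gb * P)
          + -(Λ * l) * (ab * b * s + ab * b * s) * (Eb * G * P)
          + -(Λ * l) * (a * a * sb) * (E * E * Pb)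
          + -(Λ * l) * (a * b * sb + a * b * sb) * (E * G * Pb)
          + -(Λ * l) * (b * b * sb) * (G * G * Pb))
        + ((l * gm + -(Λ * l) * (((b * bb + a * ab) * (z * (b * ab * b))
            + (b * bb + a * ab) * (z * (b * ab * b)))
            + (b * a * (z * (ab * b * ab)) + b * a * (z * (ab * b * ab))))) * (G * G * Eb)
          + -(Λ * l) * ((b * ab * (z * (b * ab * b)) + b * ab * (z * (b * ab * b)))
            + b * b * (z * (ab * b * ab))) * (G * G * G * Eb * Eb)
          + -(Λ * l) * (b * ab * q + b * ab * q) * (G * Eb * Q)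
          + -(Λ * l) * (bb * a * q + bb * a * q) * (Gb * E * Q)
          + -(Λ * l) * (b * b * qb) * (G * G * Qb)
          + -(Λ * l) * (b * a * qb + b * a * qb) * (G * E * Qb)
          + -(Λ * l) * (a * a * qb) * (E * E * Qb)))
      + h * (h * (-Λ * ((a * E + b * G) * (l * ((s * P + q * Q)
            + (z * (a * bb * a) * (E * E * Gb) + z * (b * ab * b) * (G * G * Eb))))
            * (l * ((sb * Pb + qb * Qb)
            + (z * (ab * b * ab) * (Eb * Eb * G) + z * (bb * a * bb) * (Gb * Gb * E))))
          + (a * E + b * G) * (l * ((s * P + q * Q)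
            + (z * (a * bb * a) * (E * E * Gb) + z * (b * ab * b) * (G * G * Eb))))
            * (l * ((sb * Pb + qb * Qb)
            + (z * (ab * b * ab) * (Eb * Eb * G) + z * (bb * a * bb) * (Gb * Gb * E))))
          + (ab * Eb + bb * Gb) * (l * ((s * P + q * Q)
            + (z * (a * bb * a) * (E * E * Gb) + z * (b * ab * b) * (G * G * Eb))))
            * (l * ((s * P + q * Q)
            + (z * (a * bb * a) * (E * E * Gb) + z * (b * ab * b) * (G * G * Eb))))
          + h * ((l * ((s * P + q * Q)
            + (z * (a * bb * a) * (E * E * Gb) + z * (b * ab * b) * (G * G * Eb))))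
            * (l * ((s * P + q * Q)
            + (z * (a * bb * a) * (E * E * Gb) + z * (b * ab * b) * (G * G * Eb))))
            * (l * ((sb * Pb + qb * Qb)
            + (z * (ab * b * ab) * (Eb * Eb * G) + z * (bb * a * bb) * (Gb * Gb * E)))))))) := by
  grind

/-- The cubic nonlinearity of the Schrödinger equation. -/
noncomputable def cubicNLS (lam : ℝ) (f : Wiener (Coef E T)) : Wiener (Coef E T) :=
  scal E T (-Complex.I * lam) * (f * star f * f)

/-- The leading term of the expansion. -/
noncomputable def leading (ε κ : ℝ) (n : ℤ) (a b : Wiener (Coef E T)) : Wiener (Coef E T) :=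
  a * pw E T ε κ n 1 1 + b * pw E T ε κ n (-1) 1

/-- The first correction in the expansion. -/
noncomputable def correction (lam : ℂ) (z : ℂ) (ε κ : ℝ) (n : ℤ) (a b s q : Wiener (Coef E T)) :
    Wiener (Coef E T) :=
  scal E T lam * ((s * pw E T ε κ n 3 9 + q * pw E T ε κ n (-3) 9)
      + (cub z a b * pw E T ε κ n 3 1 + cub z b a * pw E T ε κ n (-3) 1))

theorem expansion_eq (lam : ℂ) (z : ℂ) (ε κ : ℝ) (n : ℤ) (a b s q : Wiener (Coef E T)) :
    expansion lam z ε κ n a b s q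
      = leading ε κ n a b + scal E T ε * correction lam z ε κ n a b s q := rfl

/-- The terms of higher order in the residual. -/
noncomputable def highOrder (lam : ℝ) (ε : ℝ) (V X : Wiener (Coef E T)) : Wiener (Coef E T) :=
  -scal E T (-Complex.I * lam) * (V * X * star X + V * X * star X + star V * X * X
    + scal E T ε * (X * X * star X))

theorem norm_highOrder_le (lam ε : ℝ) (hε : |ε| ≤ 1) {V X : Wiener (Coef E T)} {K : ℝ}
    (hV : ‖V‖ ≤ K) (hX : ‖X‖ ≤ K) : ‖highOrder lam ε V X‖ ≤ |lam| * (4 * K ^ 3) := by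
  have hK : 0 ≤ K := (norm_nonneg _).trans hV
  have h3 : ∀ {x y w : Wiener (Coef E T)}, ‖x‖ ≤ K → ‖y‖ ≤ K → ‖w‖ ≤ K → ‖x * y * w‖ ≤ K ^ 3 := by
    intro x y w hx hy hw
    calc ‖x * y * w‖ ≤ ‖x‖ * ‖y‖ * ‖w‖ := norm_mul₃_le
      _ ≤ K * K * K := by gcongr
      _ = K ^ 3 := by ring
  have hV' : ‖star V‖ ≤ K := by rwa [norm_star_eq]
  have hX' : ‖star X‖ ≤ K := by rwa [norm_star_eq]
  rw [highOrder, ← scal_neg]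
  refine (norm_scal_mul_le _ _).trans ?_
  have e1 : ‖-(-Complex.I * (lam : ℂ))‖ = |lam| := by simp
  rw [e1]
  have e2 : ‖scal E T ε * (X * X * star X)‖ ≤ K ^ 3 := by
    refine (norm_scal_mul_le _ _).trans ?_
    rw [Complex.norm_real, Real.norm_eq_abs, ← one_mul (K ^ 3)]
    gcongr
    exact h3 hX hX hX'
  gcongr
  calc _ ≤ K ^ 3 + K ^ 3 + K ^ 3 + K ^ 3 :=
        norm_add₄_le.trans (by gcongr <;> [exact h3 hV hX hX'; exact h3 hV hX hX'; exact h3 hV' hX hX])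
    _ = 4 * K ^ 3 := by ring

/-- The residual of the truncated expansion consists of nonresonant terms and of terms of higher
order. -/
theorem forcing_eq (lam : ℝ) {z : ℝ} (ε κ : ℝ) (n : ℤ) (a b s q g gm : Wiener (Coef E T)) :
    forcing lam z (scal E T ε) a b * pw E T ε κ n 1 1
      + forcing lam z (scal E T ε) b a * pw E T ε κ n (-1) 1
      + scal E T ε * (scal E T lam *
        (scal E T (-2 * Complex.I * lam) * (a * star a + b * star b) * s * pw E T ε κ n 3 9
          + scal E T (-2 * Complex.I * lam) * (a * star a + b * star b) * q * pw E T ε κ n (-3) 9))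
      + (scal E T ε * (scal E T lam * (g * pw E T ε κ n 3 1 + gm * pw E T ε κ n (-3) 1))
        + scal E T (-Complex.I * lam) * (a * star b * a * pw E T ε κ n 3 1
          + b * star a * b * pw E T ε κ n (-3) 1))
    = cubicNLS lam (expansion lam z ε κ n a b s q)
      + scal E T ε * (∑ i, nonres lam z a b s g i * pw E T ε κ n (nonresWave i) (nonresFreq i)
        + ∑ i, nonres lam z b a q gm i * pw E T ε κ n (-nonresWave i) (nonresFreq i))
      + scal E T ε * (scal E T ε * highOrder lam ε (leading ε κ n a b)
        (correction lam z ε κ n a b s q)) := by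
  have hE : pw E T ε κ n 1 1 * pw E T ε κ n (-1) (-1) = 1 := by
    rw [pw_mul]; exact pw_zero ε κ n
  have hG : pw E T ε κ n (-1) 1 * pw E T ε κ n 1 (-1) = 1 := by
    rw [pw_mul]; exact pw_zero ε κ n
  have key := expansion_identity a (star a) b (star b) s (star s) q (star q) g gm (scal E T z)
    (scal E T lam) (scal E T ε) (scal E T (-Complex.I * lam)) _ _ _ _ (pw E T ε κ n 3 9)
    (pw E T ε κ n (-3) (-9)) (pw E T ε κ n (-3) 9) (pw E T ε κ n 3 (-9)) hE hG
  have h2 : scal E T (-2 * Complex.I * lam)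
      = scal E T (-Complex.I * lam) + scal E T (-Complex.I * lam) := by
    rw [← scal_add]; congr 2; ring
  have h3 : scal E T (Complex.I * lam * lam) = -(scal E T (-Complex.I * lam) * scal E T lam) := by
    rw [← scal_mul, ← scal_neg]; congr 2; ring
  simp only [pw_mul] at key
  simp only [cubicNLS, expansion, highOrder, leading, correction, Fin.sum_univ_seven, nonres,
    nonresWave, nonresFreq, forcing, crossCubic, quintic, cub, star_add, star_mul', star_star,
    star_scal, star_pw, Complex.conj_ofReal, h2, h3, Matrix.cons_val]
  norm_num at key ⊢
  exact key

end Wiener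

/-! ### The defect of the expansion and exact mild solutions. -/

namespace Wiener

open Coef TwoPhaseMFE

section Fixed

variable {E : Type*} [TopologicalSpace E] [DiscreteTopology E] {T : ℝ} [hT : Fact (0 < T)]

/-- On the dispersion parabola the detuning vanishes and the forcing is merely multiplied by the
wave. -/
theorem Evolves.mul_pw_of_resonant {ε κ : ℝ} (hε : ε ≠ 0) {hη : ∀ _ : E, |ε| ≤ 1} {n : ℤ}
    (hn : κ = ε * n) {k w : ℤ} (hw : w = k ^ 2) {c : ℝ} (hc : c = k * κ) {a g : Wiener (Coef E T)}
    (h : Evolves (dispCoef T (η := fun _ => ε) hη c) a g) :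
    Evolves (dispCoef T (η := fun _ => ε) hη 0) (a * pw E T ε κ n k w)
      (g * pw E T ε κ n k w) := by
  rw [hc] at h
  have := h.mul_pw hε hn w
  have h0 : (Complex.I * (((w : ℂ) - k ^ 2) * (κ ^ 2 / 2) / ε)) = 0 := by
    rw [hw]; push_cast; simp
  rw [h0, show scal E T 0 = 0 by simpa using scal_add (E := E) (T := T) 0 0] at this
  simpa using this

/-- Here `k = ±3` and `w = 1`, so the detuning is `δ₃ / ε`. The factor `1 / δ₃` in `b` is chosen so
that the detuning of `ε lam b` yields the forcing `-i lam a b̄ a`, which is the part of the cubic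
term at this wave: a term of order one is removed by a correction of order `ε`. -/
theorem Evolves.cub_mul_pw {lam ε κ : ℝ} (hκ : κ ≠ 0) (hε : ε ≠ 0) {hη : ∀ _ : E, |ε| ≤ 1} {n : ℤ}
    (hn : κ = ε * n) {k : ℤ} (hk : k ^ 2 = 9) {c : ℝ} (hc : c = k * κ) {a b g : Wiener (Coef E T)}
    (h : Evolves (dispCoef T (η := fun _ => ε) hη c) (cub ((1 / delta κ : ℝ) : ℂ) a b) g) :
    Evolves (dispCoef T (η := fun _ => ε) hη 0)
      (scal E T ε * (scal E T lam * (cub ((1 / delta κ : ℝ) : ℂ) a b * pw E T ε κ n k 1)))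
      (scal E T ε * (scal E T lam * (g * pw E T ε κ n k 1))
        + scal E T (-Complex.I * lam) * (a * star b * a * pw E T ε κ n k 1)) := by
  rw [hc] at h
  have := ((h.mul_pw hε hn 1).scalMul lam).scalMul ε
  convert this using 1
  have hε' : (ε : ℂ) ≠ 0 := by exact_mod_cast hε
  have hκ' : (κ : ℂ) ≠ 0 := by exact_mod_cast hκ
  have hk' : (k : ℂ) ^ 2 = 9 := by exact_mod_cast hk
  have e : scal E T (-Complex.I * lam) = -(scal E T ε * (scal E T lam
      * (scal E T (Complex.I * ((((1 : ℤ) : ℂ) - k ^ 2) * (κ ^ 2 / 2) / ε))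
        * scal E T ((1 / delta κ : ℝ) : ℂ)))) := by
    rw [← scal_mul, ← scal_mul, ← scal_mul, ← scal_neg, delta_eq, hk']
    congr 2
    push_cast
    field_simp
    ring
  rw [e, cub]
  ring

theorem evolves_expansion {lam ε κ : ℝ} (hκ : κ ≠ 0) (hε : ε ≠ 0) {hη : ∀ _ : E, |ε| ≤ 1} {n : ℤ}
    (hn : κ = ε * n) {a b s q g gm : Wiener (Coef E T)} {z : ℂ} (hz : z = ((1 / delta κ : ℝ) : ℂ))
    {fa fb fs fq : Wiener (Coef E T)}
    (ha : Evolves (dispCoef T (η := fun _ => ε) hη κ) a fa)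
    (hb : Evolves (dispCoef T (η := fun _ => ε) hη (-κ)) b fb)
    (hs : Evolves (dispCoef T (η := fun _ => ε) hη (3 * κ)) s fs)
    (hq : Evolves (dispCoef T (η := fun _ => ε) hη (-(3 * κ))) q fq)
    (hg : Evolves (dispCoef T (η := fun _ => ε) hη (3 * κ)) (cub z a b) g)
    (hgm : Evolves (dispCoef T (η := fun _ => ε) hη (-(3 * κ))) (cub z b a) gm) :
    Evolves (dispCoef T (η := fun _ => ε) hη 0) (expansion lam z ε κ n a b s q)
      (fa * pw E T ε κ n 1 1 + fb * pw E T ε κ n (-1) 1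
      + scal E T ε * (scal E T lam * (fs * pw E T ε κ n 3 9 + fq * pw E T ε κ n (-3) 9))
      + (scal E T ε * (scal E T lam * (g * pw E T ε κ n 3 1 + gm * pw E T ε κ n (-3) 1))
        + scal E T (-Complex.I * lam) * (a * star b * a * pw E T ε κ n 3 1
          + b * star a * b * pw E T ε κ n (-3) 1))) := by
  subst hz
  have h1 := ha.mul_pw_of_resonant hε hn (k := 1) (w := 1) (by norm_num) (by simp)
  have h2 := hb.mul_pw_of_resonant hε hn (k := -1) (w := 1) (by norm_num) (by simp)
  have h3 := hs.mul_pw_of_resonant hε hn (k := 3) (w := 9) (by norm_num) (by simp)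
  have h4 := hq.mul_pw_of_resonant hε hn (k := -3) (w := 9) (by norm_num) (by simp)
  have h5 := hg.cub_mul_pw (lam := lam) hκ hε hn (k := 3) (by norm_num) (by simp)
  have h6 := hgm.cub_mul_pw (lam := lam) hκ hε hn (k := -3) (by norm_num) (by simp)
  have := ((h1.add h2).add (((h3.add h4).scalMul lam).scalMul ε)).add (h5.add h6)
  convert this using 1
  · rw [expansion]; ring
  · ring

/-- The defect of the truncated expansion as a mild solution. -/
theorem norm_expansion_defect_le {lam ε κ : ℝ} (hκ : κ ≠ 0) (hε : 0 < ε) {hη : ∀ _ : E, |ε| ≤ 1}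
    {n : ℤ} (hn : κ = ε * n) {a b s q g gm : Wiener (Coef E T)} {z : ℝ} (hz : z = 1 / delta κ)
    (ha : Evolves (dispCoef T (η := fun _ => ε) hη κ) a (forcing lam z (scal E T ε) a b))
    (hb : Evolves (dispCoef T (η := fun _ => ε) hη (-κ)) b (forcing lam z (scal E T ε) b a))
    (hs : Evolves (dispCoef T (η := fun _ => ε) hη (3 * κ)) s
      (scal E T (-2 * Complex.I * lam) * (a * star a + b * star b) * s))
    (hq : Evolves (dispCoef T (η := fun _ => ε) hη (-(3 * κ))) q
      (scal E T (-2 * Complex.I * lam) * (a * star a + b * star b) * q))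
    (hg : Evolves (dispCoef T (η := fun _ => ε) hη (3 * κ)) (cub z a b) g)
    (hgm : Evolves (dispCoef T (η := fun _ => ε) hη (-(3 * κ))) (cub z b a) gm)
    {G Gm : Fin 7 → Wiener (Coef E T)}
    (hG : ∀ i, Evolves (dispCoef T (η := fun _ => ε) hη (nonresWave i * κ))
      (nonres lam z a b s g i) (G i))
    (hGm : ∀ i, Evolves (dispCoef T (η := fun _ => ε) hη ((-nonresWave i : ℤ) * κ))
      (nonres lam z b a q gm i) (Gm i)) {K D : ℝ}
    (hV : ‖leading ε κ n a b‖ ≤ K) (hX : ‖correction lam z ε κ n a b s q‖ ≤ K)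
    (hD : ∀ i, (2 * ‖nonres lam z a b s g i‖ + T * ‖G i‖)
      / |(nonresFreq i - nonresWave i ^ 2) * (κ ^ 2 / 2)| ≤ D)
    (hDm : ∀ i, (2 * ‖nonres lam z b a q gm i‖ + T * ‖Gm i‖)
      / |(nonresFreq i - (-nonresWave i : ℤ) ^ 2) * (κ ^ 2 / 2)| ≤ D) :
    ‖prop (disp (fun _ => ε) 0) (expansion lam z ε κ n a b s q)
      + duh (disp (fun _ => ε) 0) (cubicNLS lam (expansion lam z ε κ n a b s q))
      - expansion lam z ε κ n a b s q‖
      ≤ ε ^ 2 * (14 * D + T * (|lam| * (4 * K ^ 3))) := by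
  have h1 := evolves_expansion (lam := lam) hκ hε.ne' hn (by rw [hz]) ha hb hs hq hg hgm
  rw [forcing_eq] at h1
  have h2 := mild_of_evolves (represents_dispCoef hη 0) h1
    (f₀ := expansion lam z ε κ n a b s q) (fun _ => rfl)
  set U := expansion lam z ε κ n a b s q
  set N := ∑ i, nonres lam z a b s g i * pw E T ε κ n (nonresWave i) (nonresFreq i)
        + ∑ i, nonres lam z b a q gm i * pw E T ε κ n (-nonresWave i) (nonresFreq i) with hN
  set H := highOrder lam ε (leading ε κ n a b) (correction lam z ε κ n a b s q)
  have hεn : ‖(ε : ℂ)‖ = ε := by rw [Complex.norm_real, Real.norm_of_nonneg hε.le]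
  rw [map_add, map_add] at h2
  have h3 : prop (disp (fun _ => ε) 0) U + duh (disp (fun _ => ε) 0) (cubicNLS lam U) - U
      = -(scal E T ε * duh (disp (fun _ => ε) 0) N
        + scal E T ε * (scal E T ε * duh (disp (fun _ => ε) 0) H)) := by
    rw [← duh_scal_mul, ← duh_scal_mul, ← duh_scal_mul]
    nth_rewrite 3 [h2]
    abel
  rw [h3, norm_neg]
  have hNle : ‖duh (disp (fun _ => ε) 0) N‖ ≤ ε * (14 * D) := by
    rw [hN, map_add, map_sum, map_sum]
    have b1 : ∀ i, ‖duh (disp (fun _ => ε) 0)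
        (nonres lam z a b s g i * pw E T ε κ n (nonresWave i) (nonresFreq i))‖ ≤ ε * D := fun i =>
      (norm_duh_mul_pw_le hε hn hκ (nonresFreq_ne i) (hG i)).trans
        (mul_le_mul_of_nonneg_left (hD i) hε.le)
    have b2 : ∀ i, ‖duh (disp (fun _ => ε) 0)
        (nonres lam z b a q gm i * pw E T ε κ n (-nonresWave i) (nonresFreq i))‖ ≤ ε * D :=
      fun i => (norm_duh_mul_pw_le hε hn hκ (nonresFreq_ne' i) (hGm i)).trans
        (mul_le_mul_of_nonneg_left (hDm i) hε.le)
    refine (norm_add_le _ _).trans ((add_le_add (norm_sum_le_of_le _ fun i _ => b1 i)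
      (norm_sum_le_of_le _ fun i _ => b2 i)).trans (le_of_eq ?_))
    simp only [Finset.sum_const, Finset.card_univ, Fintype.card_fin, nsmul_eq_mul]
    push_cast
    ring
  have hHle : ‖duh (disp (fun _ => ε) 0) H‖ ≤ T * (|lam| * (4 * K ^ 3)) := by
    refine (norm_duh_le _ _).trans (mul_le_mul_of_nonneg_left ?_ hT.out.le)
    -- The bound `|ε| ≤ 1` is only available at a parameter; without parameters the ring is zero.
    obtain h | ⟨⟨e⟩⟩ := isEmpty_or_nonempty E
    · have : H = 0 := by
        ext k : 1
        exact ext_val fun e => (h.false e).elim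
      rw [this, norm_zero]
      have := (norm_nonneg _).trans hV
      positivity
    · exact norm_highOrder_le lam ε (hη e) hV hX
  have e1 := (norm_scal_mul_le (ε : ℂ) (duh (disp (fun _ => ε) 0) N)).trans
    (mul_le_mul_of_nonneg_left hNle (norm_nonneg _))
  have e2 := (norm_scal_mul_le (ε : ℂ) (scal E T ε * duh (disp (fun _ => ε) 0) H)).trans
    (mul_le_mul_of_nonneg_left ((norm_scal_mul_le (ε : ℂ) _).trans
    (mul_le_mul_of_nonneg_left hHle (norm_nonneg _))) (norm_nonneg _))
  rw [hεn] at e1 e2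
  refine (norm_add_le _ _).trans ((add_le_add e1 e2).trans (le_of_eq ?_))
  ring

theorem polyLike_cubicNLS (lam : ℝ) :
    PolyLike (fun _ a _ : Wiener (Coef E T) => cubicNLS lam a) :=
  ((PolyLike.snd.mul PolyLike.snd.star).mul PolyLike.snd).const_mul (isDt_num _)

/-- Smoothness of mild solutions of the cubic Schrödinger equation. -/
theorem smooth_of_mild_cubicNLS {lam : ℝ} {η : E → ℝ} (hη : ∀ e, |η e| ≤ 1)
    {A U : Wiener (Coef E T)} (hU : RapidDecay U)
    (hA : A = prop (disp η 0) U + duh (disp η 0) (cubicNLS lam A)) (j : ℕ) : Smooth j A := by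
  have hF := polyLike_cubicNLS (E := E) (T := T) lam
  have hr : RapidDecay A := rapidDecay_of_mild (ι := Unit) (fun _ => disp η 0) (fun _ => A)
    (fun _ => U) (fun _ => cubicNLS lam A) (fun _ => hA) (fun _ => hU) (fun m => by
      obtain ⟨K, hK, h⟩ := hF.tame ‖A‖ m
      refine ⟨3 * K, 0, by positivity, le_rfl, fun N L hL _ => ?_⟩
      have := h N L A A A le_rfl le_rfl le_rfl
      simp only [Finset.univ_unique, Finset.sum_singleton, add_zero]
      linarith) ()
  exact smooth_of_evolves (ι := Unit) (fun _ => dispCoef T hη 0) (fun _ => norm_dispCoef_le hη 0)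
    (fun _ => isDt_dispCoef hη 0) (f := fun _ => A) (g := fun _ => cubicNLS lam A)
    (fun _ => evolves_of_mild (represents_dispCoef hη 0) hA) (fun _ => hr)
    (fun j h _ => hF.smooth j A A A (h ()) (h ()) (h ())) j ()

/-- Close to approximate mild solutions of the cubic Schrödinger equation there are mild
solutions. -/
theorem exists_mild_cubicNLS (E : Type*) [TopologicalSpace E] [DiscreteTopology E] (T : ℝ)
    [hT : Fact (0 < T)] (lam M : ℝ) : ∃ C : ℝ, 0 ≤ C ∧ ∀ (σ : ℤ → E → ℝ) (U : Wiener (Coef E T)),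
      ‖U‖ ≤ M → ∀ δ : ℝ, 0 ≤ δ → C * δ ≤ 1 →
      ‖prop σ U + duh σ (cubicNLS lam U) - U‖ ≤ δ →
      ∃ A, A = prop σ U + duh σ (cubicNLS lam A) ∧ ‖A - U‖ ≤ C * δ := by
  obtain ⟨K, hK, hlip⟩ := (polyLike_cubicNLS (E := E) (T := T) lam).lip (M + 1)
  -- `K` is the Lipschitz constant on the ball of radius `M + 1`, so neither `L` nor the final
  -- constant depends on the dispersion `σ` or on `U`.
  set L : ℝ := 2 * K + 1
  have hL : 0 < L := by positivity
  refine ⟨Real.exp (L * T) * 2, by positivity, fun σ U hU δ hδ hC hdef => ?_⟩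
  rw [mul_assoc] at hC ⊢
  have bd : ∀ x : Wiener (Coef E T), ‖x - U‖ ≤ 1 → ‖x‖ ≤ M + 1 := fun x hx => by
    have := norm_le_norm_add_norm_sub' x U
    linarith
  have hM : ‖(0 : Wiener (Coef E T))‖ ≤ M + 1 := by
    rw [norm_zero]; linarith [norm_nonneg U]
  obtain ⟨A, hA, hA'⟩ := exists_fixedPoint_near (lnorm L) (Real.exp (L * T)) (by positivity)
    (fun x => norm_le_lnorm hL.le x)
    (fun x => by have := lnorm_le hL.le x; linarith [norm_nonneg x]) (lnorm_add_le L)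
    (fun f => prop σ U + duh σ (cubicNLS lam f)) U (ρ := 1) (δ := δ) (fun x y hx hy => by
      rw [add_sub_add_left_eq_sub, ← map_sub]
      refine (lnorm_duh_le _ _ hL).trans ?_
      have h1 := hlip L 0 x 0 0 y 0 hM (bd x hx) hM hM (bd y hy) hM
      have hz : lnorm L (0 - 0 : Wiener (Coef E T)) = 0 := by simp [lnorm]
      rw [hz, zero_add, add_zero] at h1
      have h2 : L⁻¹ * K ≤ 1 / 2 := by
        rw [inv_mul_le_iff₀ hL]; simp only [L]; linarith
      calc _ ≤ L⁻¹ * (K * lnorm L (x - y)) := by gcongr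
        _ = L⁻¹ * K * lnorm L (x - y) := by ring
        _ ≤ _ := by gcongr; exact lnorm_nonneg _ _) ((lnorm_le hL.le _).trans hdef) hδ hC
  exact ⟨A, hA.symm, hA'⟩

end Fixed

end Wiener

/-! ### The exact solution near the expansion, and evaluation of all equations. -/

namespace Wiener

open Coef TwoPhaseMFE

section Near

variable {E : Type*} [TopologicalSpace E] [DiscreteTopology E] {T : ℝ} [hT : Fact (0 < T)]

theorem norm_leading_le (ε κ : ℝ) (n : ℤ) (a b : Wiener (Coef E T)) :
    ‖leading ε κ n a b‖ ≤ ‖a‖ + ‖b‖ :=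
  (norm_add_le _ _).trans (add_le_add (norm_mul_pw_le ..) (norm_mul_pw_le ..))

theorem norm_correction_le (lam : ℝ) (z : ℂ) (ε κ : ℝ) (n : ℤ) (a b s q : Wiener (Coef E T)) :
    ‖correction lam z ε κ n a b s q‖
      ≤ |lam| * (‖s‖ + ‖q‖ + (‖cub z a b‖ + ‖cub z b a‖)) := by
  refine (norm_scal_mul_le _ _).trans ?_
  rw [Complex.norm_real, Real.norm_eq_abs]
  gcongr
  exact (norm_add_le _ _).trans (add_le_add
    ((norm_add_le _ _).trans (add_le_add (norm_mul_pw_le ..) (norm_mul_pw_le ..)))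
    ((norm_add_le _ _).trans (add_le_add (norm_mul_pw_le ..) (norm_mul_pw_le ..))))

theorem ev_zero_of_mild {σ : ℤ → E → ℝ} {f f₀ g : Wiener (Coef E T)}
    (h : f = prop σ f₀ + duh σ g) (e : E) (x : ℝ) : ev f e 0 x = ev f₀ e 0 x := by
  unfold ev
  congr 1; ext1 k
  rw [← val_ini (f k) e 0, ini_of_mild h, val_ini]

/-- Near the modulated Fourier expansion there is a solution of the cubic Schrödinger equation
with the same initial values. -/
theorem exists_nls_solution_near {lam κ : ℝ} (hκ : κ ≠ 0) {η : E → ℝ} (hη : ∀ e, |η e| ≤ 1)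
    {H : Coef E T} (hH : ∀ e t, H.val e t = η e) {z : ℝ} (hz : z = 1 / delta κ)
    {a b s q : Wiener (Coef E T)} (ha : ∀ j, Smooth j a) (hb : ∀ j, Smooth j b)
    (hs : ∀ j, Smooth j s) (hq : ∀ j, Smooth j q)
    (ha' : Evolves (dispCoef T hη κ) a (forcing lam z (const H) a b))
    (hb' : Evolves (dispCoef T hη (-κ)) b (forcing lam z (const H) b a))
    (hs' : Evolves (dispCoef T hη (3 * κ)) s
      (scal E T (-2 * Complex.I * lam) * (a * star a + b * star b) * s))
    (hq' : Evolves (dispCoef T hη (-(3 * κ))) q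
      (scal E T (-2 * Complex.I * lam) * (a * star a + b * star b) * q)) :
    ∃ C : ℝ, 0 ≤ C ∧ ∀ e, 0 < η e → C * η e ^ 2 ≤ 1 → ∀ n : ℤ, κ = η e * n →
      ∃ A : Wiener (Coef Unit T), (∀ j, Smooth j A) ∧
        Evolves (dispCoef T (η := fun _ => η e) (fun _ => hη e) 0) A (cubicNLS lam A) ∧
        (∀ x, ev A () 0 x = ev (expansion lam z (η e) κ n (pull T (fun _ => e) a)
          (pull T (fun _ => e) b) (pull T (fun _ => e) s) (pull T (fun _ => e) q)) () 0 x) ∧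
        ‖A - expansion lam z (η e) κ n (pull T (fun _ => e) a) (pull T (fun _ => e) b)
          (pull T (fun _ => e) s) (pull T (fun _ => e) q)‖ ≤ C * η e ^ 2 := by
  -- Two time derivatives are spent: one on the forcing `g` of `b`, which enters the first
  -- nonresonant amplitude, and one on the forcings `G` of these amplitudes.
  obtain ⟨g, hg, hg'⟩ := (smooth_cub z (ha 2) (hb 2)).exists_evolves hη (3 * κ)
  obtain ⟨gm, hgm, hgm'⟩ := (smooth_cub z (hb 2) (ha 2)).exists_evolves hη (-(3 * κ))
  choose G hG hG' using fun i => (smooth_nonres lam z (ha 1) (hb 1) (hs 1) hg i).exists_evolves hη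
    (nonresWave i * κ)
  choose Gm hGm hGm' using fun i =>
    (smooth_nonres lam z (hb 1) (ha 1) (hq 1) hgm i).exists_evolves hη ((-nonresWave i : ℤ) * κ)
  -- `K`, `D` and `R` are built from norms over the whole family of parameters, hence are uniform in
  -- `ε`.
  set K : ℝ := ‖a‖ + ‖b‖ + |lam| * (‖s‖ + ‖q‖ + (‖cub z a b‖ + ‖cub z b a‖))
  set D1 : Fin 7 → ℝ := fun i => (2 * ‖nonres lam z a b s g i‖ + T * ‖G i‖)
      / |(nonresFreq i - nonresWave i ^ 2) * (κ ^ 2 / 2)|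
  set D2 : Fin 7 → ℝ := fun i => (2 * ‖nonres lam z b a q gm i‖ + T * ‖Gm i‖)
      / |(nonresFreq i - (-nonresWave i : ℤ) ^ 2) * (κ ^ 2 / 2)|
  have hT0 := hT.out.le
  have hD1 : ∀ i, 0 ≤ D1 i := fun i => by positivity
  have hD2 : ∀ i, 0 ≤ D2 i := fun i => by positivity
  set D : ℝ := ∑ i, D1 i + ∑ i, D2 i
  have hD1' : ∀ i, D1 i ≤ D := fun i =>
    (Finset.single_le_sum (fun j _ => hD1 j) (Finset.mem_univ i)).trans
      (le_add_of_nonneg_right (Finset.sum_nonneg fun j _ => hD2 j))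
  have hD2' : ∀ i, D2 i ≤ D := fun i =>
    (Finset.single_le_sum (fun j _ => hD2 j) (Finset.mem_univ i)).trans
      (le_add_of_nonneg_left (Finset.sum_nonneg fun j _ => hD1 j))
  have hD : 0 ≤ D := (hD1 0).trans (hD1' 0)
  set R : ℝ := 14 * D + T * (|lam| * (4 * K ^ 3))
  have hR : 0 ≤ R := by positivity
  obtain ⟨C, hC, hmild⟩ := exists_mild_cubicNLS Unit T lam (K + K)
  refine ⟨C * R, by positivity, fun e he hsmall n hn => ?_⟩
  -- The waves shift the Fourier index by multiples of `κ / ε`, which varies with the parameter. The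
  -- construction of the solution is therefore done for one `ε` at a time, over a one-point
  -- parameter space; restriction does not increase norms, so the uniform constants survive.
  set φ : Unit → E := fun _ => e
  set ε := η e
  have hηu : ∀ _ : Unit, |ε| ≤ 1 := fun _ => hη e
  have hHe : pull T φ (const H) = scal Unit T ε := by
    rw [pull_const]
    exact congrArg const (ext_val fun u t ht => by rw [val_pullCoef φ _ u ht, hH, val_num])
  have p1 : ∀ f, ‖pull T φ f‖ ≤ ‖f‖ := norm_pull_le φ
  have hV : ‖leading ε κ n (pull T φ a) (pull T φ b)‖ ≤ K := by
    refine (norm_leading_le ..).trans ((add_le_add (p1 a) (p1 b)).trans ?_)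
    exact le_add_of_nonneg_right (by positivity)
  have hX : ‖correction lam z ε κ n (pull T φ a) (pull T φ b) (pull T φ s) (pull T φ q)‖ ≤ K := by
    refine (norm_correction_le ..).trans (le_trans ?_ (le_add_of_nonneg_left (by positivity)))
    rw [← pull_cub, ← pull_cub]
    gcongr <;> exact p1 _
  have hU : ‖expansion lam z ε κ n (pull T φ a) (pull T φ b) (pull T φ s) (pull T φ q)‖
      ≤ K + K := by
    rw [expansion_eq]
    refine (norm_add_le _ _).trans (add_le_add hV ((norm_scal_mul_le _ _).trans ?_))
    rw [Complex.norm_real, Real.norm_eq_abs, ← one_mul K]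
    gcongr
    exact hη e
  have hdef := norm_expansion_defect_le (lam := lam) (hη := hηu) hκ he hn hz
    (by have := ha'.pull φ; rwa [pull_forcing, hHe] at this)
    (by have := hb'.pull φ; rwa [pull_forcing, hHe] at this)
    (by have := hs'.pull φ; simpa only [map_mul, map_add, pull_scal, pull_star] using this)
    (by have := hq'.pull φ; simpa only [map_mul, map_add, pull_scal, pull_star] using this)
    (by have := hg'.pull φ; rwa [pull_cub] at this)
    (by have := hgm'.pull φ; rwa [pull_cub] at this)
    (G := fun i => pull T φ (G i)) (Gm := fun i => pull T φ (Gm i))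
    (fun i => by have := (hG' i).pull φ; rwa [pull_nonres] at this)
    (fun i => by have := (hGm' i).pull φ; rwa [pull_nonres] at this) hV hX (D := D)
    (fun i => by
      refine le_trans ?_ (hD1' i)
      rw [← pull_nonres]
      exact div_le_div_of_nonneg_right (add_le_add (mul_le_mul_of_nonneg_left (p1 _) two_pos.le)
        (mul_le_mul_of_nonneg_left (p1 _) hT0)) (abs_nonneg _))
    (fun i => by
      refine le_trans ?_ (hD2' i)
      rw [← pull_nonres]
      exact div_le_div_of_nonneg_right (add_le_add (mul_le_mul_of_nonneg_left (p1 _) two_pos.le)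
        (mul_le_mul_of_nonneg_left (p1 _) hT0)) (abs_nonneg _))
  obtain ⟨A, hA, hA'⟩ := hmild _ _ hU (ε ^ 2 * R) (by positivity) (by linarith) hdef
  have hrd : ∀ {f : Wiener (Coef E T)}, (∀ j, Smooth j f) → RapidDecay (pull T φ f) :=
    fun hf => (hf 0).rapidDecay.pull φ
  have hUr : RapidDecay (expansion lam z ε κ n (pull T φ a) (pull T φ b) (pull T φ s)
      (pull T φ q)) := by
    have hw : ∀ k w, RapidDecay (pw Unit T ε κ n k w) := fun k w => RapidDecay.single _ _
    have c1 := ((smooth_cub z (ha 0) (hb 0)).rapidDecay.pull φ)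
    have c2 := ((smooth_cub z (hb 0) (ha 0)).rapidDecay.pull φ)
    rw [pull_cub] at c1 c2
    exact (((hrd ha).mul (hw _ _)).add ((hrd hb).mul (hw _ _))).add
      ((RapidDecay.single _ _).mul ((RapidDecay.single _ _).mul
        ((((hrd hs).mul (hw _ _)).add ((hrd hq).mul (hw _ _))).add
        ((c1.mul (hw _ _)).add (c2.mul (hw _ _))))))
  exact ⟨A, smooth_of_mild_cubicNLS hηu hUr hA, evolves_of_mild (represents_dispCoef hηu 0) hA,
    ev_zero_of_mild hA (), hA'.trans (le_of_eq (by ring))⟩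

end Near

section Evaluation

variable {E : Type*} [TopologicalSpace E] [DiscreteTopology E] {T : ℝ} [hT : Fact (0 < T)]

theorem ev_scal (z : ℂ) (e : E) (t x : ℝ) : ev (scal E T z) e t x = z := by
  rw [ev_const, val_num]

theorem ev_cub {κ : ℝ} (a b : Wiener (Coef E T)) (e : E) (t x : ℝ) :
    ev (cub ((1 / delta κ : ℝ) : ℂ) a b) e t x = bCoeff κ (ev a e) (ev b e) t x := by
  simp only [cub, bCoeff, ev_mul, ev_scal, ev_star]
  push_cast
  ring

theorem ev_forcing {lam κ : ℝ} {η : E → ℝ} {H : Coef E T} (hH : ∀ e t, H.val e t = η e)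
    (a b : Wiener (Coef E T)) (e : E) (t x : ℝ) :
    ev (forcing lam ((1 / delta κ : ℝ) : ℂ) (const H) a b) e t x
      = aForcing (η e) lam κ (ev a e) (ev b e) t x := by
  simp only [forcing, crossCubic, quintic, aForcing, ev_add, ev_mul, ev_star, ev_cub,
    ev_const, val_num, hH, ← Complex.mul_conj']
  ring

theorem ev_linear_forcing {lam : ℝ} (a b s : Wiener (Coef E T)) (e : E) (t x : ℝ) :
    ev (scal E T (-2 * Complex.I * lam) * (a * star a + b * star b) * s) e t x
      = bForcing lam (ev a e) (ev b e) (ev s e) t x := by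
  simp only [bForcing, ev_add, ev_mul, ev_scal, ev_star, ← Complex.mul_conj']

theorem solvesModulation_ev {lam κ : ℝ} {η : E → ℝ} (hη : ∀ e, |η e| ≤ 1)
    {H : Coef E T} (hH : ∀ e t, H.val e t = η e) {z : ℝ} (hz : z = 1 / delta κ)
    {a b s q : Wiener (Coef E T)} (ha : ∀ j, Smooth j a) (hb : ∀ j, Smooth j b)
    (hs : ∀ j, Smooth j s) (hq : ∀ j, Smooth j q)
    (ha' : Evolves (dispCoef T hη κ) a (forcing lam z (const H) a b))
    (hb' : Evolves (dispCoef T hη (-κ)) b (forcing lam z (const H) b a))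
    (hs' : Evolves (dispCoef T hη (3 * κ)) s
      (scal E T (-2 * Complex.I * lam) * (a * star a + b * star b) * s))
    (hq' : Evolves (dispCoef T hη (-(3 * κ))) q
      (scal E T (-2 * Complex.I * lam) * (a * star a + b * star b) * q)) (e : E) {p0 m0 : ℝ → ℂ}
    (hp0 : ∀ x, ev a e 0 x = p0 x) (hm0 : ∀ x, ev b e 0 x = m0 x)
    (hs0 : ∀ x, ev s e 0 x = -bCoeff κ (ev a e) (ev b e) 0 x)
    (hq0 : ∀ x, ev q e 0 x = -bCoeff κ (ev b e) (ev a e) 0 x) :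
    SolvesModulation (η e) lam κ T p0 m0 (ev a e) (ev b e) (ev s e) (ev q e) := by
  subst hz
  exact ⟨solvesAdvected_ev hη ha ha' e (fun t x => (ev_forcing hH a b e t x).symm) hp0,
    solvesAdvected_ev hη hb hb' e (fun t x => (ev_forcing hH b a e t x).symm) hm0,
    solvesAdvected_ev hη hs hs' e (fun t x => (ev_linear_forcing a b s e t x).symm) hs0,
    solvesAdvected_ev hη hq hq' e (fun t x => (ev_linear_forcing a b q e t x).symm) hq0⟩

/-- Multiplication by `i ε` turns the equation with velocity zero back into the semiclassical form.
-/
theorem solvesNLS_ev {lam : ℝ} {η : E → ℝ} (hη : ∀ e, |η e| ≤ 1) {A : Wiener (Coef E T)}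
    (hA : ∀ j, Smooth j A) (hA' : Evolves (dispCoef T hη 0) A (cubicNLS lam A)) (e : E)
    {u0 : ℝ → ℂ} (h0 : ∀ x, ev A e 0 x = u0 x) : SolvesNLS (η e) lam T u0 (ev A e) := by
  have h := solvesAdvected_ev hη hA hA' e (fun _ _ => rfl) h0
  refine ⟨h.classical, fun t ht x => ?_, h0⟩
  have := h.equation t ht x
  simp only [cubicNLS, ev_mul, ev_scal, ev_star] at this
  rw [← Complex.mul_conj']
  push_cast at this
  linear_combination (Complex.I * η e) * this
    + ((η e : ℂ) ^ 2 / 2 * dxx (ev A e) t x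
      - η e * lam * (ev A e t x * conj (ev A e t x) * ev A e t x)) * Complex.I_sq

theorem ev_expansion {lam κ ε : ℝ} (hε : ε ≠ 0) {n : ℤ} (hn : κ = ε * n)
    (a b s q : Wiener (Coef E T)) (e : E) {t : ℝ} (ht : t ∈ Icc 0 T) (x : ℝ) :
    ev (expansion lam ((1 / delta κ : ℝ) : ℂ) ε κ n a b s q) e t x
      = uMFE ε lam κ (ev a e) (ev b e) (ev s e) (ev q e) t x := by
  simp only [expansion, uMFE, ev_add, ev_mul, ev_scal, ev_cub, ev_pw hε hn _ _ e ht]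
  have h1 : freq κ = κ ^ 2 / 2 := rfl
  have h2 : freq (3 * κ) = 9 * (κ ^ 2 / 2) := by rw [freq]; ring
  rw [h1, h2]
  push_cast
  simp only [one_mul, neg_mul]
  ring

end Evaluation

end Wiener

/-! ### Assembly of the theorem. -/

namespace TwoPhaseMFE

theorem SmoothWithBounds.congr {T : ℝ} {B B' : ℕ → ℝ} {f g : ℝ → ℝ → ℂ}
    (hf : SmoothWithBounds T B f) (hB : ∀ n, B n ≤ B' n)
    (h : ∀ t ∈ Icc 0 T, ∀ x, g t x = f t x) : SmoothWithBounds T B' g := by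
  have he : ∀ p ∈ strip T, g p.1 p.2 = f p.1 p.2 := fun p hp => h p.1 hp.1 p.2
  refine ⟨hf.1.congr he, fun n p hp => ?_⟩
  rw [iteratedFDerivWithin_congr he hp]
  exact (hf.2 n p hp).trans (hB n)

/-- At time zero the waves at `(±3, 9)` and `(±3, 1)` coincide, so the condition `b⋆ = -b` cancels
the corrections. -/
theorem uMFE_zero {ε lam κ : ℝ} {ap am sp sm : ℝ → ℝ → ℂ} {x : ℝ}
    (hp : sp 0 x = -bCoeff κ ap am 0 x) (hm : sm 0 x = -bCoeff κ am ap 0 x) :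
    uMFE ε lam κ ap am sp sm 0 x = initialData ε κ (ap 0) (am 0) x := by
  simp only [uMFE, initialData, wave, hp, hm, Complex.ofReal_zero, mul_zero, sub_zero]
  push_cast
  ring_nf

/-- The admissible values of `ε`, as a discrete space. -/
def Param (κ : ℝ) : Type := {ε : ℝ // ε ∈ Admissible κ}

instance (κ : ℝ) : TopologicalSpace (Param κ) := ⊥

instance (κ : ℝ) : DiscreteTopology (Param κ) := ⟨rfl⟩

end TwoPhaseMFE

open TwoPhaseMFE Wiener Coef in
theorem proposition6p1 (κ lam : ℝ) (hκ : κ ≠ 0) (hlam : lam ≠ 0)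
    (ap0 am0 : ℝ → ℝ → ℂ)
    (hap0 : TwoPhaseMFE.SmoothProfile κ ap0) (ham0 : TwoPhaseMFE.SmoothProfile κ am0)
    (T : ℝ) (hT : 0 < T) :
    ∃ ε₀ : ℝ, 0 < ε₀ ∧ ∃ (C : ℝ) (B : ℕ → ℝ),
      ∀ ε ∈ TwoPhaseMFE.Admissible κ, ε < ε₀ →
        (∃ u : ℝ → ℝ → ℂ, TwoPhaseMFE.SolvesNLS ε lam T
          (TwoPhaseMFE.initialData ε κ (ap0 ε) (am0 ε)) u) ∧
        (∃ ap am sp sm : ℝ → ℝ → ℂ,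
          TwoPhaseMFE.SolvesModulation ε lam κ T (ap0 ε) (am0 ε) ap am sp sm) ∧
        ∀ u ap am sp sm : ℝ → ℝ → ℂ,
          TwoPhaseMFE.SolvesNLS ε lam T
            (TwoPhaseMFE.initialData ε κ (ap0 ε) (am0 ε)) u →
          TwoPhaseMFE.SolvesModulation ε lam κ T (ap0 ε) (am0 ε) ap am sp sm →
          (TwoPhaseMFE.SmoothWithBounds T B ap ∧ TwoPhaseMFE.SmoothWithBounds T B am ∧
            TwoPhaseMFE.SmoothWithBounds T B sp ∧ TwoPhaseMFE.SmoothWithBounds T B sm ∧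
            TwoPhaseMFE.SmoothWithBounds T B (TwoPhaseMFE.bCoeff κ ap am) ∧
            TwoPhaseMFE.SmoothWithBounds T B (TwoPhaseMFE.bCoeff κ am ap)) ∧
          ∀ t ∈ Set.Icc 0 T, ∀ x : ℝ,
            ‖u t x - TwoPhaseMFE.uMFE ε lam κ ap am sp sm t x‖ ≤ C * ε ^ 2 := by
  have hTf : Fact (0 < T) := ⟨hT⟩
  have h0T : (0 : ℝ) ∈ Icc 0 T := ⟨le_rfl, hT.le⟩
  choose Bp hBp using hap0.bounded
  choose Bm hBm using ham0.bounded
  obtain ⟨A, hA, hA1, hA2⟩ := exists_wiener_of_profile (E := Param κ) (T := T)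
    (fun e => ap0 e.1) (fun e => hap0.smooth e.1 e.2) (fun e => hap0.periodic e.1 e.2)
    (fun n e x => hBp n e.1 e.2 x)
  obtain ⟨B, hB, hB1, hB2⟩ := exists_wiener_of_profile (E := Param κ) (T := T)
    (fun e => am0 e.1) (fun e => ham0.smooth e.1 e.2) (fun e => ham0.periodic e.1 e.2)
    (fun n e x => hBm n e.1 e.2 x)
  set z : ℝ := 1 / delta κ with hz
  obtain ⟨ε₀, hε₀, hε₀1, hmod⟩ := exists_mild_modulation lam κ z A B (iniRing_eq_self_of_dt hA1)
    (iniRing_eq_self_of_dt hB1) hA hB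
  -- The algebra was built over all admissible parameters before `ε₀` was known. For the large ones
  -- the dispersion is replaced by `0`, so that the smallness condition holds throughout; they play
  -- no role in the conclusion.
  set η : Param κ → ℝ := fun e => if e.1 < ε₀ then e.1 else 0
  have hηε : ∀ e : Param κ, e.1 < ε₀ → η e = e.1 := fun e he => if_pos he
  have hη₀ : ∀ e, |η e| ≤ ε₀ := fun e => by
    simp only [η]
    split_ifs with h
    · rw [abs_of_pos e.2.1]; exact h.le
    · simpa using hε₀.le
  have hη : ∀ e, |η e| ≤ 1 := fun e => (hη₀ e).trans hε₀1
  have hη' : ∀ e, ‖(η e : ℂ)‖ ≤ ε₀ := fun e => by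
    rw [Complex.norm_real, Real.norm_eq_abs]; exact hη₀ e
  set H : Coef (Param κ) T := cst T (fun e => (η e : ℂ)) ε₀ hη'
  have hH : ∀ e t, H.val e t = η e := fun e t => val_cst _ _ hη' e t
  have hHdt : Coef.IsDt H 0 := isDt_cst _ _ hη'
  obtain ⟨a, b, ha, hb⟩ := hmod η H hη₀ (norm_cst_le _ hε₀.le hη')
  have hab := smooth_of_mild_modulation hη hHdt hA hB ha hb
  have has : ∀ j, Smooth j a := fun j => (hab j).1
  have hbs : ∀ j, Smooth j b := fun j => (hab j).2
  set V : Wiener (Coef (Param κ) T) :=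
    scal (Param κ) T (-2 * Complex.I * lam) * (a * star a + b * star b)
  have hV : ∀ j, Smooth j V := fun j => (smooth_const (isDt_num _) j).mul
    (((has j).mul (has j).star).add ((hbs j).mul (hbs j).star))
  -- The initial value `-b` of `b⋆` is written as a cubic with coefficient `-z`.
  have hneg : ∀ f g : Wiener (Coef (Param κ) T), cub (-(z : ℂ)) f g = -cub z f g := fun f g => by
    rw [cub, cub, scal_neg, neg_mul]
  obtain ⟨s, hss, hs⟩ := exists_smooth_linear hη (3 * κ)
    (smooth_cub (-(z : ℂ)) (has 0) (hbs 0)).rapidDecay hV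
  obtain ⟨q, hqs, hq⟩ := exists_smooth_linear hη (-(3 * κ))
    (smooth_cub (-(z : ℂ)) (hbs 0) (has 0)).rapidDecay hV
  have ha' := evolves_of_mild (represents_dispCoef hη κ) ha
  have hb' := evolves_of_mild (represents_dispCoef hη (-κ)) hb
  have hs' := evolves_of_mild (represents_dispCoef hη (3 * κ)) hs
  have hq' := evolves_of_mild (represents_dispCoef hη (-(3 * κ))) hq
  have hp0 : ∀ e x, ev a e 0 x = ap0 e.1 x := fun e x => by rw [ev_zero_of_mild ha, hA2]
  have hm0 : ∀ e x, ev b e 0 x = am0 e.1 x := fun e x => by rw [ev_zero_of_mild hb, hB2]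
  have hs0 : ∀ e x, ev s e 0 x = -bCoeff κ (ev a e) (ev b e) 0 x := fun e x => by
    rw [ev_zero_of_mild hs, hneg, ev_neg, ev_cub]
  have hq0 : ∀ e x, ev q e 0 x = -bCoeff κ (ev b e) (ev a e) 0 x := fun e x => by
    rw [ev_zero_of_mild hq, hneg, ev_neg, ev_cub]
  obtain ⟨C, hC, hnls⟩ := exists_nls_solution_near hκ hη hH hz has hbs hss hqs ha' hb' hs' hq'
  obtain ⟨B1, hB1⟩ := exists_smoothWithBounds has
  obtain ⟨B2, hB2⟩ := exists_smoothWithBounds hbs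
  obtain ⟨B3, hB3⟩ := exists_smoothWithBounds hss
  obtain ⟨B4, hB4⟩ := exists_smoothWithBounds hqs
  obtain ⟨B5, hB5⟩ := exists_smoothWithBounds fun j => smooth_cub z (has j) (hbs j)
  obtain ⟨B6, hB6⟩ := exists_smoothWithBounds fun j => smooth_cub z (hbs j) (has j)
  -- The second bound, together with `ε ≤ 1`, ensures `C * ε ^ 2 ≤ 1`, the smallness required for
  -- the solution near the expansion.
  refine ⟨min ε₀ (1 / (C + 1)), by positivity, C,
    fun n => max (max (max (B1 n) (B2 n)) (max (B3 n) (B4 n))) (max (B5 n) (B6 n)),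
    fun ε hε hlt => ?_⟩
  set e : Param κ := ⟨ε, hε⟩
  have he : η e = ε := hηε e (hlt.trans_le (min_le_left _ _))
  have hmodsol := solvesModulation_ev hη hH hz has hbs hss hqs ha' hb' hs' hq' e (hp0 e) (hm0 e)
    (hs0 e) (hq0 e)
  obtain ⟨n, hn⟩ := hε.2.2
  have hn' : κ = ε * n := by rw [← hn]; field_simp [hε.1.ne']
  have hsmall : C * ε ^ 2 ≤ 1 := by
    have h1 : ε ≤ 1 / (C + 1) := (hlt.trans_le (min_le_right _ _)).le
    rw [le_div_iff₀ (by positivity)] at h1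
    have h2 := mul_le_mul_of_nonneg_left hε.2.1 (mul_nonneg hC hε.1.le)
    nlinarith [hε.1]
  obtain ⟨W, hW, hW', hW0, hWU⟩ := hnls e (by rw [he]; exact hε.1) (by rw [he]; exact hsmall) n
    (by rw [he]; exact hn')
  have hexp : ∀ t ∈ Icc 0 T, ∀ x, ev (expansion lam z (η e) κ n (pull T (fun _ => e) a)
      (pull T (fun _ => e) b) (pull T (fun _ => e) s) (pull T (fun _ => e) q)) () t x
      = uMFE ε lam κ (ev a e) (ev b e) (ev s e) (ev q e) t x := fun t ht x => by
    rw [he, ev_expansion hε.1.ne' hn' _ _ _ _ _ ht]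
    simp only [uMFE, bCoeff, ev_pull _ _ _ ht]
  have hsol := solvesNLS_ev (fun _ : Unit => hη e) hW hW' ()
    (u0 := initialData ε κ (ap0 ε) (am0 ε)) (fun x => by
      rw [hW0, hexp 0 h0T, uMFE_zero (hs0 e x) (hq0 e x)]
      rw [initialData, initialData, hp0 e, hm0 e])
  rw [he] at hmodsol hWU
  replace hsol : SolvesNLS ε lam T (initialData ε κ (ap0 ε) (am0 ε)) (ev W ()) := by
    rw [← he]; exact he.symm ▸ hsol
  refine ⟨⟨_, hsol⟩, ⟨_, _, _, _, hmodsol⟩, fun u ap am sp sm hu hm => ?_⟩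
  -- By uniqueness arbitrary classical solutions coincide on the strip with the constructed ones and
  -- inherit their bounds.
  have hun := fun t (ht : t ∈ Icc 0 T) x => hu.unique hT hε.1.ne' hsol ht x
  have hmn := fun t (ht : t ∈ Icc 0 T) x => hm.unique hT hmodsol ht x
  refine ⟨⟨(hB1 e).congr (fun n => by simp) fun t ht x => (hmn t ht x).1,
    (hB2 e).congr (fun n => by simp) fun t ht x => (hmn t ht x).2.1,
    (hB3 e).congr (fun n => by simp) fun t ht x => (hmn t ht x).2.2.1,
    (hB4 e).congr (fun n => by simp) fun t ht x => (hmn t ht x).2.2.2,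
    (hB5 e).congr (fun n => by simp) fun t ht x => ?_,
    (hB6 e).congr (fun n => by simp) fun t ht x => ?_⟩, fun t ht x => ?_⟩
  · rw [ev_cub, bCoeff, bCoeff, (hmn t ht x).1, (hmn t ht x).2.1]
  · rw [ev_cub, bCoeff, bCoeff, (hmn t ht x).1, (hmn t ht x).2.1]
  · have h1 : uMFE ε lam κ ap am sp sm t x
        = uMFE ε lam κ (ev a e) (ev b e) (ev s e) (ev q e) t x := by
      simp only [uMFE, bCoeff, hmn t ht x]
    rw [h1, hun t ht x, ← hexp t ht x, ← ev_sub, he]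
    exact (norm_ev_le _ _ _ _).trans hWU
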